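/- Let $\mathcal A=\{A_1,\dots,A_m\}$ be an irreducible finite family of real $d\times d$ matrices (no common invariant subspace other than $\{0\}$ and $\mathbb R^d$), with joint spectral radius $\rho=\rho(\mathcal A)=\lim_{n}\max_{|w|=n}\|A_w\|^{1/n}$, where for a nonempty word $w=s_1\dots s_n$ over $\{1,\dots,m\}$ we put $A_w=A_{s_n}\cdots A_{s_1}$, $|w|=n$, and, with $\rho(A_w)$ the spectral radius, $\nu(w)=\rho(A_w)^{1/|w|}$. Assume that $\mathcal A$ has a unique dominant product: there are a word $\pi$ that is not a power of a shorter word and an $\varepsilon\in(0,1)$ such that $\nu(w)\le(1-\varepsilon)^{1/|w|}\,\nu(\pi)$ for every nonempty word $w$ that is not a power of $\pi$ or of a cyclic permutation of $\pi$. Assume that the leading eigenvalue $\lambda$ of $\Pi=A_\pi$ is unique and simple: $\lambda$ is a simple root of the characteristic polynomial of $\Pi$, and every eigenvalue $\mu\notin\{\lambda,\bar\lambda\}$ of $\Pi$ satisfies $|\mu|<|\lambda|$. A Barabanov norm of $\mathcal A$ is a norm $f$ on $\mathbb R^d$ with $\max_i f(A_ix)=\rho f(x)$ for all $x$. An invariant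 body of a family $\mathcal B=\{B_1,\dots,B_m\}$ is a compact convex set $G=-G\subset\mathbb R^d$ with nonempty interior and $\mathrm{co}\bigcup_i B_iG=\rho(\mathcal B)\,G$. Let $\mathcal A^*=\{A_1^T,\dots,A_m^T\}$. An ellipse is a set $\{a\cos t+b\sin t: t\in\mathbb R\}$ with $a,b\in\mathbb R^d$ (possibly degenerate). Uniqueness is understood up to multiplication by a positive constant. A norm is called piecewise linear if $\mathbb R^d$ is a finite union of polyhedral cones on each of which it is linear, and piecewise quadratic if $\mathbb R^d$ is a finite union of closed sets on each of which it is the square root of a nonnegative quadratic form. 1. If $\lambda\in\mathbb R$, then $\mathcal A^*$ has a unique invariant body $G^*$, it is a polytope, $\mathcal A$ has a unique Barabanov norm, and this norm is piecewise linear and is (up to a constant) given by $$f(x)=\max_{v^*}|(v^*,x)|,$$ the maximum being over all vertices $v^*$ of $G^*$. 2. If $\lambda\notin\mathbb R$, then $\mathcal A^*$ has an invariant body that is the convex hull of finitely many ellipses and is not a polytope. Whenever an invariant body of $\mathcal A^*$ is the convex hull of ellipses $E_1^*,\dots,E_N^*$, the function $$f(x)=\max_{i}\ \max_{z^*\in E_i^*}|(z^*,x)|$$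 is a piecewise-quadratic Barabanov norm of $\mathcal A$. If moreover $\frac1\pi\arg\lambda$ is irrational, then this Barabanov norm is unique. -/

import Mathlib

open Filter Topology
open scoped Pointwise Matrix

namespace Barabanov

/-! Words over the alphabet `{1, …, m}` are lists over `Fin m`. -/

/-- The product `A_{s_k} ⋯ A_{s_1}` associated with the word `s_1 … s_k`. -/
def wordProd {d m : ℕ} (A : Fin m → Matrix (Fin d) (Fin d) ℝ) (w : List (Fin m)) :
    Matrix (Fin d) (Fin d) ℝ :=
  (w.map A).reverse.prod

/-- Spectral radius of a real matrix: the largest modulus of a complex eigenvalue. -/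
noncomputable def specRad {d : ℕ} (M : Matrix (Fin d) (Fin d) ℝ) : ℝ :=
  (spectralRadius ℂ (M.map (fun t : ℝ => (t : ℂ)))).toReal

/-- The Euclidean operator norm of a matrix. -/
noncomputable def opNorm {d : ℕ} (M : Matrix (Fin d) (Fin d) ℝ) : ℝ :=
  ‖Matrix.toEuclideanCLM (n := Fin d) (𝕜 := ℝ) M‖

/-- Joint spectral radius: the limit of the maximum of `‖Π‖ ^ (1 / n)` over all products `Π` of
length `n` (a finite maximum; the limit always exists). -/
noncomputable def jsr {d m : ℕ} (A : Fin m → Matrix (Fin d) (Fin d) ℝ) : ℝ :=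
  limUnder atTop (fun n : ℕ =>
    ⨆ w : Fin n → Fin m, opNorm (wordProd A (List.ofFn w)) ^ (1 / (n : ℝ)))

/-- `ν(Π) = ρ(Π) ^ (1 / |Π|)`. -/
noncomputable def nu {d m : ℕ} (A : Fin m → Matrix (Fin d) (Fin d) ℝ) (w : List (Fin m)) : ℝ :=
  specRad (wordProd A w) ^ (1 / (w.length : ℝ))

/-- The `k`-th power (repeated concatenation) of a word. -/
def wordPow {m : ℕ} (u : List (Fin m)) (k : ℕ) : List (Fin m) :=
  (List.replicate k u).flatten

/-- A product is primitive if it is nonempty and is not a power of a shorter product. -/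
def IsPrimitiveWord {m : ℕ} (w : List (Fin m)) : Prop :=
  w ≠ [] ∧ ∀ (u : List (Fin m)) (k : ℕ), u.length < w.length → w ≠ wordPow u k

/-- A set of dominant products. -/
structure IsDominantSet {d m : ℕ} (A : Fin m → Matrix (Fin d) (Fin d) ℝ)
    (P : Set (List (Fin m))) : Prop where
  primitive : ∀ w ∈ P, IsPrimitiveWord w
  not_rotated : ∀ w ∈ P, ∀ u ∈ P, w.IsRotated u → w = u
  gap : ∃ q : ℝ, (∀ w ∈ P, nu A w = q) ∧
    ∃ ε : ℝ, 0 < ε ∧ ε < 1 ∧ ∀ S : List (Fin m), S ≠ [] →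
      (¬ ∃ w ∈ P, ∃ w' : List (Fin m), w.IsRotated w' ∧ ∃ k : ℕ, S = wordPow w' k) →
      nu A S ≤ (1 - ε) ^ (1 / (S.length : ℝ)) * q

/-- `lam` is the unique and simple leading eigenvalue of `M`: it is a simple root of the
characteristic polynomial, and all other eigenvalues, except for the complex conjugate of `lam`,
are strictly smaller in modulus. -/
def IsUniqueSimpleLeading {d : ℕ} (M : Matrix (Fin d) (Fin d) ℝ) (lam : ℂ) : Prop :=
  (M.map (fun t : ℝ => (t : ℂ))).charpoly.rootMultiplicity lam = 1 ∧
  ∀ μ : ℂ, (M.map (fun t : ℝ => (t : ℂ))).charpoly.IsRoot μ →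
    μ ≠ lam → μ ≠ (starRingEnd ℂ) lam → ‖μ‖ < ‖lam‖

/-- The matrices share no nontrivial invariant linear subspace. -/
def IsIrreducible {d m : ℕ} (A : Fin m → Matrix (Fin d) (Fin d) ℝ) : Prop :=
  ∀ U : Submodule ℝ (Fin d → ℝ), (∀ i, ∀ x ∈ U, A i *ᵥ x ∈ U) → U = ⊥ ∨ U = ⊤

/-- The transpose family. -/
def transposeFamily {d m : ℕ} (A : Fin m → Matrix (Fin d) (Fin d) ℝ) :
    Fin m → Matrix (Fin d) (Fin d) ℝ :=
  fun i => (A i)ᵀ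

/-- `f` is a norm on `ℝ^d`. -/
structure IsNorm {d : ℕ} (f : (Fin d → ℝ) → ℝ) : Prop where
  nonneg : ∀ x, 0 ≤ f x
  eq_zero : ∀ x, f x = 0 → x = 0
  smul : ∀ (c : ℝ) (x : Fin d → ℝ), f (c • x) = |c| * f x
  add_le : ∀ x y, f (x + y) ≤ f x + f y

/-- A Barabanov norm: a norm with `max_i f (A_i x) = ρ(A) f x` for all `x`. -/
structure IsBarabanovNorm {d m : ℕ} (A : Fin m → Matrix (Fin d) (Fin d) ℝ)
    (f : (Fin d → ℝ) → ℝ) : Prop where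
  isNorm : IsNorm f
  max_eq : ∀ x, IsGreatest (Set.range fun i => f (A i *ᵥ x)) (jsr A * f x)

/-- An invariant body: an origin-symmetric convex body `G` with `co (⋃ A_i G) = ρ(A) G`. -/
structure IsInvariantBody {d m : ℕ} (A : Fin m → Matrix (Fin d) (Fin d) ℝ)
    (G : Set (Fin d → ℝ)) : Prop where
  convex : Convex ℝ G
  isCompact : IsCompact G
  interior_nonempty : (interior G).Nonempty
  symm : ∀ x ∈ G, -x ∈ G
  invariant : convexHull ℝ (⋃ i, (fun x => A i *ᵥ x) '' G) = jsr A • G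

/-- A polytope: the convex hull of a finite set. -/
def IsPolytope {d : ℕ} (G : Set (Fin d → ℝ)) : Prop :=
  ∃ F : Set (Fin d → ℝ), F.Finite ∧ G = convexHull ℝ F

/-- The ellipse `Φ_{a,b}(Γ)`: the image of the unit circle under the linear map that takes the
basis of the plane to `a`, `b`. It is degenerate if `a` and `b` are linearly dependent. -/
def ellipse {d : ℕ} (a b : Fin d → ℝ) : Set (Fin d → ℝ) :=
  (fun p : ℝ × ℝ => p.1 • a + p.2 • b) '' {p : ℝ × ℝ | p.1 ^ 2 + p.2 ^ 2 = 1}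

/-- The convex hull of finitely many ellipses. -/
def ellipseHull {d N : ℕ} (a b : Fin N → Fin d → ℝ) : Set (Fin d → ℝ) :=
  convexHull ℝ (⋃ i, ellipse (a i) (b i))

/-- `f` is piecewise linear: `ℝ^d` is covered by finitely many polyhedral cones, on each of which
`f` coincides with a linear functional. -/
def IsPiecewiseLinear {d : ℕ} (f : (Fin d → ℝ) → ℝ) : Prop :=
  ∃ (N : ℕ) (C : Fin N → Set (Fin d → ℝ)) (l : Fin N → Fin d → ℝ),
    (∀ i, ∃ (K : ℕ) (c : Fin K → Fin d → ℝ), C i = {x | ∀ k, 0 ≤ c k ⬝ᵥ x}) ∧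
    (⋃ i, C i) = Set.univ ∧
    ∀ i, ∀ x ∈ C i, f x = l i ⬝ᵥ x

/-- `f` is piecewise quadratic, in the sense used for norms: `ℝ^d` is covered by finitely many
closed sets, on each of which `f` is the square root of a nonnegative quadratic form. -/
def IsPiecewiseQuadratic {d : ℕ} (f : (Fin d → ℝ) → ℝ) : Prop :=
  ∃ (N : ℕ) (C : Fin N → Set (Fin d → ℝ)) (Q : Fin N → QuadraticForm ℝ (Fin d → ℝ)),
    (∀ i, IsClosed (C i)) ∧ (⋃ i, C i) = Set.univ ∧
    (∀ i x, 0 ≤ Q i x) ∧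
    ∀ i, ∀ x ∈ C i, f x = √(Q i x)

end Barabanov

/-! After scaling to joint spectral radius one, irreducibility yields some Barabanov norm `g`
(`exists_isUnitBarabanov`). Follow a trajectory on which `g` is constantly 1. Along a convergent
subsequence of its points the transition products nearly fix the limit, so their spectral radii come
close to one, and the gap forces their words to be powers of a cyclic permutation of `P`. Hence the
trajectory is eventually driven by `P` (`IsTrajectory.exists_eq_pow`) and approaches the leading
eigenspace of `P`, a line or a plane described by a coordinate `U` and a section `V`. By compactness
the time needed to come within `δ` of it is bounded (`exists_near_uniform`).

Uniqueness: a Barabanov norm that equals `c‖U x‖` on the leading subspace must be `c · sup_w ‖U (B_w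
x)‖` everywhere (`eq_orbitSup`). On a line the assumption is automatic; on a plane with irrational
angle it holds because the powers of `lam` are dense in the circle.

Finiteness: let `n` be a seminorm that factors through `U`, is preserved by `P`, and is contracted
on the leading subspace by a factor `θ < 1` under every word that is not a power of `P`. Then `sup_w
n (B_w x)` is a Barabanov norm, and words of bounded length suffice
(`exists_length_le_orbitSup_eq`), because near the leading subspace only powers of `P` can compete.

Existence of `n`: the gap passes to limits of `P^l B_w P^k`, that is, to compressions of `B_w` to
the leading subspace followed by a rotation. In the real and irrational cases a rotation aligns each
vector with its image, so the stretching factor of the modulus is an eigenvalue and `n = ‖U x‖`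
works. If `lam` is a root of unity, the compressions lie in a compact semigroup without nonzero
fixed vectors (primitivity of `P` enters here). Its long products are uniformly small
(`exists_pow_contract`), which gives an adapted seminorm `sup θ^{-l} ‖U N x‖`; it is approximated by
a finite maximum of moduli of injective real-linear images of `U`, closed up under the finite group
generated by `lam`.

Duality: support functions of invariant bodies of the transposed family are Barabanov norms, and a
symmetric compact convex set supported by a Barabanov norm is an invariant body. Moduli of real
functionals support pairs of points, moduli of complex functionals support ellipses. On the leading
plane the norm constructed is a maximum of nondegenerate Euclidean norms, which no polytope can
support. Radius zero forces the zero family in dimension one. -/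

namespace Barabanov

/-! ### Products along words and powers of words. -/

section Words
variable {d m : ℕ} (A : Fin m → Matrix (Fin d) (Fin d) ℝ)

@[simp] lemma wordProd_nil : wordProd A [] = 1 := by simp [wordProd]

lemma wordProd_append (u w : List (Fin m)) :
    wordProd A (u ++ w) = wordProd A w * wordProd A u := by
  simp [wordProd]

lemma wordProd_cons (i : Fin m) (w : List (Fin m)) :
    wordProd A (i :: w) = wordProd A w * A i := by
  simp [wordProd]

lemma wordProd_singleton (i : Fin m) : wordProd A [i] = A i := by simp [wordProd]

@[simp] lemma wordPow_zero (u : List (Fin m)) : wordPow u 0 = [] := by simp [wordPow]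

lemma wordPow_succ (u : List (Fin m)) (k : ℕ) : wordPow u (k + 1) = u ++ wordPow u k := by
  simp [wordPow, List.replicate_succ]

lemma wordPow_add (u : List (Fin m)) (k l : ℕ) :
    wordPow u (k + l) = wordPow u k ++ wordPow u l := by
  rw [wordPow, wordPow, wordPow, List.replicate_add, List.flatten_append]

lemma wordPow_succ' (u : List (Fin m)) (k : ℕ) : wordPow u (k + 1) = wordPow u k ++ u := by
  rw [wordPow_add, wordPow_succ]; simp

@[simp] lemma wordPow_one (u : List (Fin m)) : wordPow u 1 = u := by simp [wordPow]

lemma length_wordPow (u : List (Fin m)) (k : ℕ) : (wordPow u k).length = k * u.length := by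
  simp [wordPow]

lemma wordProd_wordPow (u : List (Fin m)) (k : ℕ) :
    wordProd A (wordPow u k) = wordProd A u ^ k := by
  induction k with
  | zero => simp
  | succ k ih => rw [wordPow_succ, wordProd_append, ih, pow_succ]

lemma wordProd_smul (c : ℝ) (w : List (Fin m)) :
    wordProd (fun i => c • A i) w = c ^ w.length • wordProd A w := by
  induction w with
  | nil => simp
  | cons i w ih => simp [wordProd_cons, ih, pow_succ, smul_smul, mul_comm]

lemma wordProd_transposeFamily (w : List (Fin m)) :
    wordProd (transposeFamily A) w = (wordProd A w.reverse)ᵀ := by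
  induction w with
  | nil => simp
  | cons i w ih =>
    rw [wordProd_cons, ih, List.reverse_cons, wordProd_append, wordProd_singleton,
      Matrix.transpose_mul]
    rfl

lemma isIrreducible_smul {c : ℝ} (hc : c ≠ 0) (h : IsIrreducible A) :
    IsIrreducible (fun i => c • A i) := by
  intro U hU
  refine h U fun i x hx => ?_
  have := U.smul_mem c⁻¹ (hU i x hx)
  rwa [Matrix.smul_mulVec, smul_smul, inv_mul_cancel₀ hc, one_smul] at this

end Words

/-! ### Comparison of the Euclidean operator norm with the sup norm. -/

section OpNorm
variable {d : ℕ}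

lemma opNorm_nonneg (M : Matrix (Fin d) (Fin d) ℝ) : 0 ≤ opNorm M := norm_nonneg _

lemma opNorm_mul_le (M N : Matrix (Fin d) (Fin d) ℝ) : opNorm (M * N) ≤ opNorm M * opNorm N := by
  unfold opNorm
  rw [map_mul]
  exact norm_mul_le _ _

lemma opNorm_transpose (M : Matrix (Fin d) (Fin d) ℝ) : opNorm Mᵀ = opNorm M := by
  have h : Mᵀ = star M := by
    ext i j; simp [Matrix.star_apply]
  unfold opNorm
  rw [h, map_star]
  exact LinearIsometryEquiv.norm_map ContinuousLinearMap.adjoint _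

/-- The Euclidean operator norm is equivalent to the sup norm on matrix-vector products. -/
lemma exists_opNorm_bounds (d : ℕ) : ∃ C : ℝ, 0 < C ∧
    (∀ (M : Matrix (Fin d) (Fin d) ℝ) (x : Fin d → ℝ), ‖M *ᵥ x‖ ≤ C * opNorm M * ‖x‖) ∧
    (∀ (M : Matrix (Fin d) (Fin d) ℝ) (b : ℝ), 0 ≤ b → (∀ j, ‖M *ᵥ Pi.single j 1‖ ≤ b) →
      opNorm M ≤ C * b) := by
  let e : EuclideanSpace ℝ (Fin d) ≃L[ℝ] (Fin d → ℝ) := EuclideanSpace.equiv (Fin d) ℝ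
  set a := ‖(e : EuclideanSpace ℝ (Fin d) →L[ℝ] (Fin d → ℝ))‖
  set b := ‖(e.symm : (Fin d → ℝ) →L[ℝ] EuclideanSpace ℝ (Fin d))‖
  have ha : 0 ≤ a := norm_nonneg _
  have hb : 0 ≤ b := norm_nonneg _
  have h1 : ∀ y, ‖e y‖ ≤ a * ‖y‖ :=
    fun y => (e : EuclideanSpace ℝ (Fin d) →L[ℝ] (Fin d → ℝ)).le_opNorm y
  have h2 : ∀ y, ‖e.symm y‖ ≤ b * ‖y‖ :=
    fun y => (e.symm : (Fin d → ℝ) →L[ℝ] EuclideanSpace ℝ (Fin d)).le_opNorm y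
  -- One constant serves both bounds: `a * b` is the cost of changing norms, `d` that of summing
  -- over columns, and the final `1` makes it positive.
  refine ⟨a * b * (d + 1) + 1, by positivity, ?_, ?_⟩
  · intro M x
    have h3 : M *ᵥ x = e (Matrix.toEuclideanCLM (n := Fin d) (𝕜 := ℝ) M (e.symm x)) := rfl
    have h4 : ‖M *ᵥ x‖ ≤ a * (opNorm M * (b * ‖x‖)) := by
      rw [h3]
      refine (h1 _).trans (mul_le_mul_of_nonneg_left ?_ ha)
      refine (ContinuousLinearMap.le_opNorm _ _).trans ?_
      exact mul_le_mul_of_nonneg_left (h2 x) (norm_nonneg _)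
    have h5 : 0 ≤ opNorm M * ‖x‖ := mul_nonneg (opNorm_nonneg _) (norm_nonneg _)
    have h6 : 0 ≤ a * b * d := by positivity
    nlinarith
  · intro M B hB hM
    have h0 : 0 ≤ (a * b * (d + 1) + 1) * B := by positivity
    refine ContinuousLinearMap.opNorm_le_bound _ h0 fun y => ?_
    have h3 : Matrix.toEuclideanCLM (n := Fin d) (𝕜 := ℝ) M y = e.symm (M *ᵥ e y) := rfl
    have h4 : ‖M *ᵥ e y‖ ≤ d * B * ‖e y‖ := by
      have h5 : M *ᵥ e y = ∑ j, (e y) j • (M *ᵥ Pi.single j 1) := by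
        conv_lhs => rw [pi_eq_sum_univ' (e y)]
        rw [Matrix.mulVec_sum]
        exact Finset.sum_congr rfl fun j _ => by
          rw [Matrix.mulVec_smul]
      rw [h5]
      refine (norm_sum_le _ _).trans ?_
      calc ∑ j, ‖(e y) j • (M *ᵥ Pi.single j 1)‖ ≤ ∑ _j : Fin d, ‖e y‖ * B := by
            refine Finset.sum_le_sum fun j _ => ?_
            rw [norm_smul]
            exact mul_le_mul (norm_le_pi_norm (e y) j) (hM j) (norm_nonneg _) (norm_nonneg _)
        _ = d * B * ‖e y‖ := by simp; ring
    rw [h3]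
    calc ‖e.symm (M *ᵥ e y)‖ ≤ b * ‖M *ᵥ e y‖ := h2 _
      _ ≤ b * (d * B * (a * ‖y‖)) := by
          refine mul_le_mul_of_nonneg_left (h4.trans ?_) hb
          exact mul_le_mul_of_nonneg_left (h1 y) (by positivity)
      _ ≤ (a * b * (d + 1) + 1) * B * ‖y‖ := by
          have : 0 ≤ a * b * B * ‖y‖ := by positivity
          have : 0 ≤ B * ‖y‖ := by positivity
          nlinarith

end OpNorm

/-! ### The joint spectral radius as a limit, with its upper and lower growth bounds. -/

section JointSpectralRadius
variable {d m : ℕ} (A : Fin m → Matrix (Fin d) (Fin d) ℝ)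

/-- The largest operator norm of a product of length `n`. -/
noncomputable def wordMax (n : ℕ) : ℝ :=
  ⨆ w : Fin n → Fin m, opNorm (wordProd A (List.ofFn w))

lemma opNorm_le_wordMax (w : List (Fin m)) : opNorm (wordProd A w) ≤ wordMax A w.length := by
  have h := le_ciSup (f := fun v : Fin w.length → Fin m => opNorm (wordProd A (List.ofFn v)))
    (Set.finite_range _).bddAbove w.get
  simpa [wordMax] using h

lemma exists_wordMax [Nonempty (Fin m)] (n : ℕ) :
    ∃ w : List (Fin m), w.length = n ∧ opNorm (wordProd A w) = wordMax A n := by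
  obtain ⟨v, hv⟩ := exists_eq_ciSup_of_finite
    (f := fun v : Fin n → Fin m => opNorm (wordProd A (List.ofFn v)))
  exact ⟨List.ofFn v, by simp, hv⟩

lemma wordMax_nonneg (n : ℕ) : 0 ≤ wordMax A n := Real.iSup_nonneg fun _ => opNorm_nonneg _

lemma wordMax_add_le [Nonempty (Fin m)] (n k : ℕ) :
    wordMax A (n + k) ≤ wordMax A n * wordMax A k := by
  obtain ⟨w, hw, h⟩ := exists_wordMax A (n + k)
  rw [← h]
  conv_lhs => rw [← List.take_append_drop n w, wordProd_append]
  have h1 : (w.take n).length = n := by simp [hw]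
  have h2 : (w.drop n).length = k := by simp [hw]
  have h3 := opNorm_le_wordMax A (w.take n)
  have h4 := opNorm_le_wordMax A (w.drop n)
  rw [h1] at h3
  rw [h2] at h4
  rw [mul_comm]
  exact (opNorm_mul_le _ _).trans (mul_le_mul h4 h3 (opNorm_nonneg _) (wordMax_nonneg _ _))

lemma iSup_rpow_eq [Nonempty (Fin m)] (n : ℕ) :
    (⨆ w : Fin n → Fin m, opNorm (wordProd A (List.ofFn w)) ^ (1 / (n : ℝ))) =
      wordMax A n ^ (1 / (n : ℝ)) := by
  apply le_antisymm
  · refine ciSup_le fun w => ?_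
    have := opNorm_le_wordMax A (List.ofFn w)
    rw [List.length_ofFn] at this
    exact Real.rpow_le_rpow (opNorm_nonneg _) this (by positivity)
  · obtain ⟨v, hv⟩ := exists_eq_ciSup_of_finite
      (f := fun v : Fin n → Fin m => opNorm (wordProd A (List.ofFn v)))
    rw [wordMax, ← hv]
    exact le_ciSup
      (f := fun w : Fin n → Fin m => opNorm (wordProd A (List.ofFn w)) ^ (1 / (n : ℝ)))
      (Set.finite_range _).bddAbove v

/-- Fekete's lemma applied to logarithms: a single good length `k` controls all large lengths. -/
lemma eventually_wordMax_lt [Nonempty (Fin m)] {t : ℝ} {k : ℕ} (hk : k ≠ 0) (ht : 0 < t)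
    (h : wordMax A k < t ^ k) : ∀ᶠ n in atTop, wordMax A n < t ^ n := by
  obtain ⟨s, hs0, hst, hs⟩ : ∃ s, 0 < s ∧ s < t ∧ wordMax A k < s ^ k := by
    have hc : ContinuousAt (fun s : ℝ => s ^ k) t := (continuous_pow k).continuousAt
    have h1 : ∀ᶠ s in 𝓝[<] t, wordMax A k < s ^ k :=
      (hc.eventually (lt_mem_nhds h)).filter_mono nhdsWithin_le_nhds
    have h2 : ∀ᶠ s in 𝓝[<] t, 0 < s := (lt_mem_nhds ht).filter_mono nhdsWithin_le_nhds
    have h3 : ∀ᶠ s in 𝓝[<] t, s < t := self_mem_nhdsWithin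
    obtain ⟨s, h1, h2, h3⟩ := (h1.and (h2.and h3)).exists
    exact ⟨s, h2, h3, h1⟩
  -- Products may vanish, so the sequence is bounded below by `s ^ n` before taking logarithms; the
  -- maximum stays submultiplicative and equals `s ^ k` at `k`.
  set b : ℕ → ℝ := fun n => max (wordMax A n) (s ^ n) with hb
  have hpos : ∀ n, 0 < b n := fun n => lt_max_of_lt_right (pow_pos hs0 n)
  have hsub : Subadditive fun n => Real.log (b n) := by
    intro i j
    rw [← Real.log_mul (hpos i).ne' (hpos j).ne']
    refine Real.log_le_log (hpos _) (max_le ?_ ?_)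
    · exact (wordMax_add_le A i j).trans
        (mul_le_mul (le_max_left _ _) (le_max_left _ _) (wordMax_nonneg _ _) (hpos i).le)
    · rw [pow_add]
      exact mul_le_mul (le_max_right _ _) (le_max_right _ _) (pow_pos hs0 j).le (hpos i).le
  have hlow : ∀ n : ℕ, n * Real.log s ≤ Real.log (b n) := fun n => by
    rw [← Real.log_pow]
    exact Real.log_le_log (pow_pos hs0 n) (le_max_right _ _)
  have hL : Real.log (b k) / k < Real.log t := by
    have : b k = s ^ k := max_eq_right hs.le
    rw [this, Real.log_pow]
    have hk' : (k : ℝ) ≠ 0 := by exact_mod_cast hk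
    field_simp
    exact Real.log_lt_log hs0 hst
  filter_upwards [hsub.eventually_div_lt_of_div_lt hk hL, eventually_gt_atTop 0] with n hn hn0
  have hn0' : (0 : ℝ) < n := by exact_mod_cast hn0
  rw [div_lt_iff₀ hn0', mul_comm, ← Real.log_pow] at hn
  exact (le_max_left _ _).trans_lt ((Real.log_lt_log_iff (hpos n) (pow_pos ht n)).1 hn)

lemma exists_tendsto_wordMax [Nonempty (Fin m)] : ∃ r : ℝ, 0 ≤ r ∧
    Tendsto (fun n : ℕ => wordMax A n ^ (1 / (n : ℝ))) atTop (𝓝 r) ∧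
    (∀ n, n ≠ 0 → r ^ n ≤ wordMax A n) ∧ ∀ t, r < t → ∀ᶠ n in atTop, wordMax A n < t ^ n := by
  -- The limit is the infimum of the rates `t` beaten at some length. Any rate above it is
  -- eventually beaten, by Fekete; a length falling below it would beat a smaller rate.
  set S : Set ℝ := {t | 0 < t ∧ ∃ k, k ≠ 0 ∧ wordMax A k < t ^ k} with hS
  have hne : S.Nonempty := by
    refine ⟨wordMax A 1 + 1, by linarith [wordMax_nonneg A 1], 1, one_ne_zero, by simp⟩
  have hbd : BddBelow S := ⟨0, fun t ht => ht.1.le⟩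
  have h0 : 0 ≤ sInf S := le_csInf hne fun t ht => ht.1.le
  have hup : ∀ t, sInf S < t → ∀ᶠ n in atTop, wordMax A n < t ^ n := by
    intro t ht
    obtain ⟨s, ⟨hs, k, hk, hsk⟩, hst⟩ := exists_lt_of_csInf_lt hne ht
    filter_upwards [eventually_wordMax_lt A hk hs hsk] with n hn
    exact hn.trans_le (pow_le_pow_left₀ hs.le hst.le n)
  have hlow : ∀ n, n ≠ 0 → sInf S ^ n ≤ wordMax A n := by
    intro n hn
    by_contra! hlt
    have hpos : 0 < sInf S := by
      rcases h0.eq_or_lt with h | h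
      · rw [← h, zero_pow hn] at hlt
        exact absurd hlt (not_lt.2 (wordMax_nonneg _ _))
      · exact h
    have hc : ContinuousAt (fun s : ℝ => s ^ n) (sInf S) := (continuous_pow n).continuousAt
    have h1 : ∀ᶠ s in 𝓝[<] (sInf S), wordMax A n < s ^ n :=
      (hc.eventually (lt_mem_nhds hlt)).filter_mono nhdsWithin_le_nhds
    have h2 : ∀ᶠ s in 𝓝[<] (sInf S), 0 < s := (lt_mem_nhds hpos).filter_mono nhdsWithin_le_nhds
    have h3 : ∀ᶠ s in 𝓝[<] (sInf S), s < sInf S := self_mem_nhdsWithin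
    obtain ⟨s, h1, h2, h3⟩ := (h1.and (h2.and h3)).exists
    exact absurd (csInf_le hbd ⟨h2, n, hn, h1⟩) (not_le.2 h3)
  refine ⟨sInf S, h0, ?_, hlow, hup⟩
  rw [Metric.tendsto_atTop']
  intro η hη
  obtain ⟨K, hK⟩ := (eventually_atTop.1 (hup (sInf S + η) (by linarith)))
  refine ⟨max K 1, fun n hn => ?_⟩
  have hn0 : n ≠ 0 := by have := le_max_right K 1; omega
  have hnK : K ≤ n := by have := le_max_left K 1; omega
  have hn' : (1 / (n : ℝ)) = (n : ℝ)⁻¹ := one_div _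
  have e1 : sInf S ≤ wordMax A n ^ (1 / (n : ℝ)) := by
    rw [hn']
    calc sInf S = (sInf S ^ n) ^ (n : ℝ)⁻¹ := (Real.pow_rpow_inv_natCast h0 hn0).symm
      _ ≤ _ := Real.rpow_le_rpow (pow_nonneg h0 n) (hlow n hn0) (by positivity)
  have e2 : wordMax A n ^ (1 / (n : ℝ)) < sInf S + η := by
    rw [hn']
    calc _ < ((sInf S + η) ^ n) ^ (n : ℝ)⁻¹ :=
          Real.rpow_lt_rpow (wordMax_nonneg _ _) (hK n hnK) (by positivity)
      _ = _ := Real.pow_rpow_inv_natCast (by linarith) hn0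
  rw [Real.dist_eq, abs_lt]
  constructor <;> linarith

lemma jsr_spec [Nonempty (Fin m)] : 0 ≤ jsr A ∧ (∀ n, n ≠ 0 → jsr A ^ n ≤ wordMax A n) ∧
    ∀ t, jsr A < t → ∀ᶠ n in atTop, wordMax A n < t ^ n := by
  obtain ⟨r, h0, ht, h1, h2⟩ := exists_tendsto_wordMax A
  have : jsr A = r := by
    unfold jsr
    simp_rw [iSup_rpow_eq]
    exact ht.limUnder_eq
  rw [this]
  exact ⟨h0, h1, h2⟩

/-- Transposition reverses words, which permutes the words of each length, and preserves the
operator norm. -/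
lemma jsr_transposeFamily : jsr (transposeFamily A) = jsr A := by
  unfold jsr
  congr 1
  ext n
  refine (Equiv.arrowCongr Fin.revPerm (Equiv.refl (Fin m))).iSup_congr fun w => ?_
  rw [wordProd_transposeFamily, opNorm_transpose]
  congr 3
  apply List.ext_getElem
  · simp
  · intro i h1 h2
    simp only [List.getElem_ofFn, List.getElem_reverse, List.length_ofFn, Equiv.arrowCongr_apply,
      Equiv.coe_refl, Function.comp_apply, id_eq]
    congr 1
    ext
    simp
    omega

lemma norm_wordProd_le [Nonempty (Fin m)] {t : ℝ} (ht : jsr A < t) :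
    ∃ C : ℝ, 0 < C ∧ ∀ w x, ‖wordProd A w *ᵥ x‖ ≤ C * t ^ w.length * ‖x‖ := by
  obtain ⟨h0, -, h2⟩ := jsr_spec A
  have ht0 : 0 < t := h0.trans_lt ht
  obtain ⟨K, hK⟩ := eventually_atTop.1 (h2 t ht)
  obtain ⟨C, hC, hC1, -⟩ := exists_opNorm_bounds d
  have hD : ∃ D : ℝ, 0 < D ∧ ∀ n, wordMax A n ≤ D * t ^ n := by
    -- The finitely many lengths below `K` are absorbed by the sum, the others by the `1`.
    refine ⟨1 + ∑ n ∈ Finset.range K, wordMax A n / t ^ n, ?_, fun n => ?_⟩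
    · have : 0 ≤ ∑ n ∈ Finset.range K, wordMax A n / t ^ n :=
        Finset.sum_nonneg fun n _ => div_nonneg (wordMax_nonneg _ _) (pow_pos ht0 n).le
      linarith
    · rw [← div_le_iff₀ (pow_pos ht0 n)]
      rcases lt_or_ge n K with h | h
      · have := Finset.single_le_sum (f := fun n => wordMax A n / t ^ n)
          (fun n _ => div_nonneg (wordMax_nonneg _ _) (pow_pos ht0 n).le) (Finset.mem_range.2 h)
        linarith
      · have : 0 ≤ ∑ n ∈ Finset.range K, wordMax A n / t ^ n :=
          Finset.sum_nonneg fun n _ => div_nonneg (wordMax_nonneg _ _) (pow_pos ht0 n).le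
        have h3 := (div_le_one (pow_pos ht0 n)).2 (hK n h).le
        linarith
  obtain ⟨D, hD0, hD⟩ := hD
  refine ⟨C * D, by positivity, fun w x => (hC1 _ x).trans ?_⟩
  refine mul_le_mul_of_nonneg_right ?_ (norm_nonneg _)
  rw [mul_assoc]
  exact mul_le_mul_of_nonneg_left ((opNorm_le_wordMax A w).trans (hD _)) hC.le

/-- The bound is phrased through the columns because it serves to show that a limit of seminorms
does not vanish on all basis vectors. -/
lemma exists_le_norm_wordProd [Nonempty (Fin m)] :
    ∃ c : ℝ, 0 < c ∧ ∀ n, n ≠ 0 → ∃ w : List (Fin m), w.length = n ∧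
      ∀ b, 0 ≤ b → (∀ j, ‖wordProd A w *ᵥ Pi.single j 1‖ ≤ b) → c * jsr A ^ n ≤ b := by
  obtain ⟨-, h1, -⟩ := jsr_spec A
  obtain ⟨C, hC, -, hC2⟩ := exists_opNorm_bounds d
  refine ⟨C⁻¹, inv_pos.2 hC, fun n hn => ?_⟩
  obtain ⟨w, hw, h⟩ := exists_wordMax A n
  refine ⟨w, hw, fun b hb hj => ?_⟩
  rw [inv_mul_le_iff₀ hC]
  exact ((h1 n hn).trans h.ge).trans (hC2 _ b hb hj)

end JointSpectralRadius

/-! ### Seminorms and norms on `ℝ^d`, and irreducibility as a source of definiteness. -/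

section Seminorms
variable {d : ℕ}

/-- `f` is a seminorm on `ℝ^d`. -/
structure IsSeminorm (f : (Fin d → ℝ) → ℝ) : Prop where
  nonneg : ∀ x, 0 ≤ f x
  smul : ∀ (c : ℝ) (x : Fin d → ℝ), f (c • x) = |c| * f x
  add_le : ∀ x y, f (x + y) ≤ f x + f y

lemma IsNorm.isSeminorm {f : (Fin d → ℝ) → ℝ} (h : IsNorm f) : IsSeminorm f :=
  ⟨h.nonneg, h.smul, h.add_le⟩

namespace IsSeminorm
variable {f : (Fin d → ℝ) → ℝ} (hf : IsSeminorm f)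
include hf

lemma map_zero : f 0 = 0 := by simpa using hf.smul 0 0

lemma map_neg (x : Fin d → ℝ) : f (-x) = f x := by simpa using hf.smul (-1) x

lemma map_sub_rev (x y : Fin d → ℝ) : f (x - y) = f (y - x) := by
  rw [← hf.map_neg, neg_sub]

lemma le_add_sub (x y : Fin d → ℝ) : f x ≤ f y + f (x - y) := by
  simpa using hf.add_le y (x - y)

lemma sum_le {ι : Type*} (s : Finset ι) (x : ι → Fin d → ℝ) :
    f (∑ i ∈ s, x i) ≤ ∑ i ∈ s, f (x i) := by
  classical
  induction s using Finset.induction_on with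
  | empty => simp [hf.map_zero]
  | insert i s hi ih =>
    rw [Finset.sum_insert hi, Finset.sum_insert hi]
    exact (hf.add_le _ _).trans (add_le_add_right ih _)

lemma exists_le_norm : ∃ C : ℝ, 0 < C ∧ ∀ x, f x ≤ C * ‖x‖ := by
  have hs : 0 ≤ ∑ j, f (Pi.single j 1) := Finset.sum_nonneg fun j _ => hf.nonneg _
  refine ⟨∑ j, f (Pi.single j 1) + 1, by linarith, fun x => ?_⟩
  have h1 : f x ≤ ∑ j, f (x j • Pi.single j 1) := by
    conv_lhs => rw [pi_eq_sum_univ' x]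
    exact (hf.sum_le _ _).trans (le_of_eq (Finset.sum_congr rfl fun j _ => by congr))
  refine h1.trans ?_
  calc ∑ j, f (x j • Pi.single j 1) ≤ ∑ j, f (Pi.single j 1) * ‖x‖ := by
        refine Finset.sum_le_sum fun j _ => ?_
        rw [hf.smul, mul_comm]
        exact mul_le_mul_of_nonneg_left (norm_le_pi_norm x j) (hf.nonneg _)
    _ ≤ _ := by
        rw [← Finset.sum_mul]
        have := norm_nonneg x
        nlinarith

lemma continuous : Continuous f := by
  obtain ⟨C, hC, h⟩ := hf.exists_le_norm
  refine (LipschitzWith.of_dist_le_mul (K := ⟨C, hC.le⟩) fun x y => ?_).continuous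
  rw [Real.dist_eq, dist_eq_norm]
  refine le_trans ?_ (h (x - y))
  rw [abs_sub_le_iff]
  exact ⟨by linarith [hf.le_add_sub x y], by linarith [hf.le_add_sub y x, hf.map_sub_rev x y]⟩

/-- The null space of a seminorm. -/
def ker : Submodule ℝ (Fin d → ℝ) where
  carrier := {x | f x = 0}
  add_mem' {x y} hx hy := le_antisymm ((hf.add_le x y).trans (by
    rw [Set.mem_ofPred_eq] at hx hy; simp [hx, hy])) (hf.nonneg _)
  zero_mem' := hf.map_zero
  smul_mem' c x hx := by
    rw [Set.mem_ofPred_eq] at hx ⊢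
    simp [hf.smul, hx]

lemma mem_ker {x : Fin d → ℝ} : x ∈ hf.ker ↔ f x = 0 := Iff.rfl

/-- A nonzero seminorm that does not increase along an irreducible family is a norm. -/
lemma isNorm_of_irreducible {m : ℕ} {B : Fin m → Matrix (Fin d) (Fin d) ℝ}
    (hB : IsIrreducible B) (h : ∀ i x, f (B i *ᵥ x) ≤ f x) (hne : ∃ x, f x ≠ 0) : IsNorm f := by
  -- Monotonicity of `f` makes its null space invariant, so it is zero or everything.
  rcases hB hf.ker fun i x hx => le_antisymm ((h i x).trans (hf.mem_ker.1 hx).le) (hf.nonneg _)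
    with h1 | h1
  · exact ⟨hf.nonneg, fun x hx => by
      have : x ∈ hf.ker := hx
      simpa [h1] using this, hf.smul, hf.add_le⟩
  · obtain ⟨x, hx⟩ := hne
    exact absurd (hf.mem_ker.1 (h1 ▸ Submodule.mem_top)) hx

end IsSeminorm

lemma isNorm_norm : IsNorm fun x : Fin d → ℝ => ‖x‖ :=
  ⟨fun x => norm_nonneg x, fun x hx => norm_eq_zero.1 hx, fun c x => by
    rw [norm_smul, Real.norm_eq_abs], fun x y => norm_add_le x y⟩

namespace IsNorm
variable {f : (Fin d → ℝ) → ℝ} (hf : IsNorm f)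
include hf

lemma continuous : Continuous f := hf.isSeminorm.continuous

lemma pos_of_ne {x : Fin d → ℝ} (hx : x ≠ 0) : 0 < f x :=
  (hf.nonneg x).lt_of_ne fun h => hx (hf.eq_zero x h.symm)

lemma exists_norm_le : ∃ C : ℝ, 0 < C ∧ ∀ x, ‖x‖ ≤ C * f x := by
  -- An empty sphere occurs only for `d = 0`; otherwise the constant comes from the minimum of `f`
  -- on the sphere.
  rcases (Metric.sphere (0 : Fin d → ℝ) 1).eq_empty_or_nonempty with he | hne
  · refine ⟨1, one_pos, fun x => ?_⟩
    by_cases hx : x = 0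
    · simp [hx, hf.isSeminorm.map_zero]
    · have : ‖x‖⁻¹ • x ∈ Metric.sphere (0 : Fin d → ℝ) 1 := by
        simp [norm_smul, hx]
      simp [he] at this
  · obtain ⟨y, hy, hmin⟩ := (isCompact_sphere (0 : Fin d → ℝ) 1).exists_isMinOn hne
      hf.continuous.continuousOn
    have hy0 : y ≠ 0 := by rintro rfl; simp at hy
    refine ⟨(f y)⁻¹, inv_pos.2 (hf.pos_of_ne hy0), fun x => ?_⟩
    by_cases hx : x = 0
    · simp [hx, hf.isSeminorm.map_zero]
    · have h1 : ‖x‖⁻¹ • x ∈ Metric.sphere (0 : Fin d → ℝ) 1 := by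
        simp [norm_smul, hx]
      have h2 := hmin h1
      simp only [Set.mem_ofPred_eq] at h2
      rw [hf.smul, abs_of_nonneg (by positivity), ← div_eq_inv_mul,
        le_div_iff₀ (norm_pos_iff.2 hx)] at h2
      rwa [← div_eq_inv_mul, le_div_iff₀ (hf.pos_of_ne hy0), mul_comm]

lemma isCompact_sphere : IsCompact {x | f x = 1} := by
  obtain ⟨C, hC, h⟩ := hf.exists_norm_le
  refine Metric.isCompact_of_isClosed_isBounded (isClosed_eq hf.continuous continuous_const)
    (isBounded_iff_forall_norm_le.2 ⟨C, fun x hx => ?_⟩)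
  have := h x
  rw [Set.mem_ofPred_eq] at hx
  rwa [hx, mul_one] at this

end IsNorm

/-- Every seminorm is bounded by a multiple of a norm. -/
lemma IsSeminorm.exists_le_norm' {f g : (Fin d → ℝ) → ℝ} (hf : IsSeminorm f) (hg : IsNorm g) :
    ∃ C : ℝ, 0 < C ∧ ∀ x, f x ≤ C * g x := by
  obtain ⟨C, hC, h⟩ := hf.exists_le_norm
  obtain ⟨D, hD, h'⟩ := hg.exists_norm_le
  refine ⟨C * D, by positivity, fun x => (h x).trans ?_⟩
  rw [mul_assoc]
  exact mul_le_mul_of_nonneg_left (h' x) hC.le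

end Seminorms

/-! ### Boundedness of products and existence of a Barabanov norm. -/

section Existence
variable {d m : ℕ} {B : Fin m → Matrix (Fin d) (Fin d) ℝ}

/-- A Barabanov norm of a family normalised to have joint spectral radius one. -/
structure IsUnitBarabanov (B : Fin m → Matrix (Fin d) (Fin d) ℝ) (g : (Fin d → ℝ) → ℝ) :
    Prop where
  isNorm : IsNorm g
  max_eq : ∀ x, IsGreatest (Set.range fun i => g (B i *ᵥ x)) (g x)

namespace IsUnitBarabanov
variable {g : (Fin d → ℝ) → ℝ} (hg : IsUnitBarabanov B g)
include hg

lemma le (i : Fin m) (x : Fin d → ℝ) : g (B i *ᵥ x) ≤ g x := (hg.max_eq x).2 ⟨i, rfl⟩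

lemma exists_eq (x : Fin d → ℝ) : ∃ i, g (B i *ᵥ x) = g x := (hg.max_eq x).1

lemma wordProd_le (w : List (Fin m)) (x : Fin d → ℝ) : g (wordProd B w *ᵥ x) ≤ g x := by
  induction w generalizing x with
  | nil => simp
  | cons i w ih =>
    rw [wordProd_cons, ← Matrix.mulVec_mulVec]
    exact (ih _).trans (hg.le i x)

end IsUnitBarabanov

/-- The vectors with bounded orbit form an invariant subspace `E`. If `E` is everything, a basis
gives the uniform bound. If `E = 0`, every nonzero vector is doubled by some word, by compactness of
length at most `L`; iteration gives exponential growth, which subexponential growth of the products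
excludes. -/
lemma exists_wordProd_bound (hB : IsIrreducible B)
    (hJ : ∀ t : ℝ, 1 < t → ∃ C : ℝ, 0 < C ∧ ∀ w x, ‖wordProd B w *ᵥ x‖ ≤ C * t ^ w.length * ‖x‖) :
    ∃ C : ℝ, 0 < C ∧ ∀ w x, ‖wordProd B w *ᵥ x‖ ≤ C * ‖x‖ := by
  let E : Submodule ℝ (Fin d → ℝ) :=
    { carrier := {x | ∃ C : ℝ, ∀ w, ‖wordProd B w *ᵥ x‖ ≤ C}
      add_mem' := by
        rintro x y ⟨C, hC⟩ ⟨D, hD⟩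
        refine ⟨C + D, fun w => ?_⟩
        rw [Matrix.mulVec_add]
        exact (norm_add_le _ _).trans (add_le_add (hC w) (hD w))
      zero_mem' := ⟨0, fun w => by simp⟩
      smul_mem' := by
        rintro c x ⟨C, hC⟩
        refine ⟨|c| * C, fun w => ?_⟩
        rw [Matrix.mulVec_smul, norm_smul, Real.norm_eq_abs]
        exact mul_le_mul_of_nonneg_left (hC w) (abs_nonneg _) }
  have hE : ∀ i, ∀ x ∈ E, B i *ᵥ x ∈ E := by
    rintro i x ⟨C, hC⟩
    refine ⟨C, fun w => ?_⟩
    rw [Matrix.mulVec_mulVec, ← wordProd_cons]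
    exact hC _
  rcases hB E hE with h | h
  · by_cases hd : ∃ x : Fin d → ℝ, x ≠ 0
    swap
    · push Not at hd
      exact ⟨1, one_pos, fun w x => by simp [hd]⟩
    exfalso
    have hgrow : ∀ x : Fin d → ℝ, x ≠ 0 → ∃ w, 2 * ‖x‖ < ‖wordProd B w *ᵥ x‖ := by
      intro x hx
      by_contra! hc
      have : x ∈ E := ⟨_, hc⟩
      rw [h] at this
      exact hx (by simpa using this)
    obtain ⟨L, hL⟩ : ∃ L : ℕ, ∀ x : Fin d → ℝ, x ≠ 0 →
        ∃ w : List (Fin m), w.length ≤ L ∧ 2 * ‖x‖ < ‖wordProd B w *ᵥ x‖ := by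
      obtain ⟨T, hT⟩ := (isCompact_sphere (0 : Fin d → ℝ) 1).elim_finite_subcover
        (fun w : List (Fin m) => {x | 2 * ‖x‖ < ‖wordProd B w *ᵥ x‖})
        (fun w => isOpen_lt (by fun_prop) (by fun_prop)) (fun x hx => by
          obtain ⟨w, hw⟩ := hgrow x (by rintro rfl; simp at hx)
          exact Set.mem_iUnion.2 ⟨w, hw⟩)
      refine ⟨T.sup List.length, fun x hx => ?_⟩
      have h1 : ‖x‖⁻¹ • x ∈ Metric.sphere (0 : Fin d → ℝ) 1 := by
        simp [norm_smul, hx]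
      obtain ⟨w, hw, hlt⟩ := Set.mem_iUnion₂.1 (hT h1)
      refine ⟨w, Finset.le_sup (f := List.length) hw, ?_⟩
      have hx' := norm_pos_iff.2 hx
      simp only [Set.mem_ofPred_eq, Matrix.mulVec_smul, norm_smul, norm_inv, norm_norm] at hlt
      rw [mul_left_comm] at hlt
      exact lt_of_mul_lt_mul_left hlt (by positivity)
    obtain ⟨x, hx⟩ := hd
    have hiter : ∀ k : ℕ, ∃ w : List (Fin m), w.length ≤ k * L ∧
        2 ^ k * ‖x‖ ≤ ‖wordProd B w *ᵥ x‖ := by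
      intro k
      induction k with
      | zero => exact ⟨[], by simp, by simp⟩
      | succ k ih =>
        obtain ⟨w, hw, hwx⟩ := ih
        have hne : wordProd B w *ᵥ x ≠ 0 := by
          rw [← norm_pos_iff]
          have := norm_pos_iff.2 hx
          exact lt_of_lt_of_le (by positivity) hwx
        obtain ⟨u, hu, hux⟩ := hL _ hne
        refine ⟨w ++ u, by rw [List.length_append]; linarith [add_mul k 1 L], ?_⟩
        rw [wordProd_append, ← Matrix.mulVec_mulVec, pow_succ]
        nlinarith
    -- Any value of `t ^ L` below the doubling factor 2 would do; with 3/2 the ratio 4/3 drives the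
    -- contradiction.
    obtain ⟨t, ht1, htL⟩ : ∃ t : ℝ, 1 < t ∧ t ^ L ≤ 3 / 2 := by
      have hc : ContinuousAt (fun s : ℝ => s ^ L) 1 := (continuous_pow L).continuousAt
      have h1 : ∀ᶠ s in 𝓝[>] (1 : ℝ), s ^ L < 3 / 2 :=
        (hc.eventually (gt_mem_nhds (by norm_num))).filter_mono nhdsWithin_le_nhds
      have h2 : ∀ᶠ s in 𝓝[>] (1 : ℝ), 1 < s := self_mem_nhdsWithin
      obtain ⟨s, h1, h2⟩ := (h1.and h2).exists
      exact ⟨s, h2, h1.le⟩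
    obtain ⟨C, hC, hCw⟩ := hJ t ht1
    obtain ⟨k, hk⟩ := pow_unbounded_of_one_lt C (show (1 : ℝ) < 4 / 3 by norm_num)
    obtain ⟨w, hw, hwx⟩ := hiter k
    have hx' := norm_pos_iff.2 hx
    have h1 : (2 : ℝ) ^ k * ‖x‖ ≤ C * (3 / 2) ^ k * ‖x‖ := by
      refine hwx.trans ((hCw w x).trans ?_)
      refine mul_le_mul_of_nonneg_right (mul_le_mul_of_nonneg_left ?_ hC.le) hx'.le
      calc t ^ w.length ≤ t ^ (k * L) := pow_le_pow_right₀ ht1.le hw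
        _ = (t ^ L) ^ k := by rw [mul_comm, pow_mul]
        _ ≤ (3 / 2) ^ k := pow_le_pow_left₀ (by positivity) htL k
    have h2 : (2 : ℝ) ^ k ≤ C * (3 / 2) ^ k := le_of_mul_le_mul_right h1 hx'
    have h3 : (2 : ℝ) ^ k = (4 / 3) ^ k * (3 / 2) ^ k := by rw [← mul_pow]; norm_num
    rw [h3] at h2
    exact absurd (le_of_mul_le_mul_right h2 (by positivity)) (not_le.2 hk)
  · have hall : ∀ x, ∃ C : ℝ, ∀ w, ‖wordProd B w *ᵥ x‖ ≤ C := fun x => by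
      have : x ∈ E := h ▸ Submodule.mem_top
      exact this
    choose C hC using hall
    have hC0 : ∀ x, 0 ≤ C x := fun x => (norm_nonneg _).trans (hC x [])
    refine ⟨∑ j, C (Pi.single j 1) + 1, by
      have := Finset.sum_nonneg fun j (_ : j ∈ Finset.univ) => hC0 (Pi.single j (1 : ℝ))
      linarith, fun w x => ?_⟩
    have h1 : wordProd B w *ᵥ x = ∑ j, x j • (wordProd B w *ᵥ Pi.single j 1) := by
      conv_lhs => rw [pi_eq_sum_univ' x]
      rw [Matrix.mulVec_sum]
      exact Finset.sum_congr rfl fun j _ => by rw [Matrix.mulVec_smul]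
    rw [h1]
    refine (norm_sum_le _ _).trans ?_
    calc ∑ j, ‖x j • (wordProd B w *ᵥ Pi.single j 1)‖ ≤ ∑ j, C (Pi.single j 1) * ‖x‖ := by
          refine Finset.sum_le_sum fun j _ => ?_
          rw [norm_smul, mul_comm]
          exact mul_le_mul (hC _ _) (norm_le_pi_norm x j) (norm_nonneg _) (hC0 _)
      _ ≤ _ := by
          rw [← Finset.sum_mul]
          have := norm_nonneg x
          nlinarith

/-- The supremum of a seminorm over all products of a bounded family. -/
noncomputable def orbitSup (B : Fin m → Matrix (Fin d) (Fin d) ℝ) (n : (Fin d → ℝ) → ℝ)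
    (x : Fin d → ℝ) : ℝ := ⨆ w, n (wordProd B w *ᵥ x)

section OrbitSup
variable {n : (Fin d → ℝ) → ℝ} (hn : IsSeminorm n)
  (hb : ∃ C : ℝ, 0 < C ∧ ∀ w x, ‖wordProd B w *ᵥ x‖ ≤ C * ‖x‖)
include hn hb

lemma bddAbove_orbit (x : Fin d → ℝ) : BddAbove (Set.range fun w => n (wordProd B w *ᵥ x)) := by
  obtain ⟨C, hC, h⟩ := hb
  obtain ⟨D, hD, h'⟩ := hn.exists_le_norm
  refine ⟨D * (C * ‖x‖), ?_⟩
  rintro _ ⟨w, rfl⟩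
  exact (h' _).trans (mul_le_mul_of_nonneg_left (h w x) hD.le)

lemma le_orbitSup (w : List (Fin m)) (x : Fin d → ℝ) :
    n (wordProd B w *ᵥ x) ≤ orbitSup B n x :=
  le_ciSup (bddAbove_orbit hn hb x) w

lemma le_orbitSup_self (x : Fin d → ℝ) : n x ≤ orbitSup B n x := by
  simpa using le_orbitSup hn hb [] x

lemma isSeminorm_orbitSup : IsSeminorm (orbitSup B n) := by
  have h0 : ∀ x, 0 ≤ orbitSup B n x := fun x => (hn.nonneg x).trans (le_orbitSup_self hn hb x)
  refine ⟨h0, fun c x => ?_, fun x y => ?_⟩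
  · unfold orbitSup
    rw [Real.mul_iSup_of_nonneg (abs_nonneg c)]
    simp_rw [Matrix.mulVec_smul, hn.smul]
  · refine ciSup_le fun w => ?_
    rw [Matrix.mulVec_add]
    exact (hn.add_le _ _).trans (add_le_add (le_orbitSup hn hb w x) (le_orbitSup hn hb w y))

lemma orbitSup_le (i : Fin m) (x : Fin d → ℝ) : orbitSup B n (B i *ᵥ x) ≤ orbitSup B n x := by
  refine ciSup_le fun w => ?_
  rw [Matrix.mulVec_mulVec, ← wordProd_cons]
  exact le_orbitSup hn hb _ x

end OrbitSup

/-- The maximum of `N (B_w x)` over words of length `k`. -/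
noncomputable def iterMax (B : Fin m → Matrix (Fin d) (Fin d) ℝ) (N : (Fin d → ℝ) → ℝ) :
    ℕ → (Fin d → ℝ) → ℝ
  | 0, x => N x
  | k + 1, x => ⨆ i, iterMax B N k (B i *ᵥ x)

section IterMax
variable {N : (Fin d → ℝ) → ℝ}

lemma iterMax_le_succ (k : ℕ) (i : Fin m) (x : Fin d → ℝ) :
    iterMax B N k (B i *ᵥ x) ≤ iterMax B N (k + 1) x :=
  le_ciSup (f := fun i => iterMax B N k (B i *ᵥ x)) (Set.finite_range _).bddAbove i

lemma exists_iterMax_succ [Nonempty (Fin m)] (k : ℕ) (x : Fin d → ℝ) :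
    ∃ i, iterMax B N k (B i *ᵥ x) = iterMax B N (k + 1) x :=
  exists_eq_ciSup_of_finite (f := fun i => iterMax B N k (B i *ᵥ x))

lemma le_iterMax (w : List (Fin m)) (x : Fin d → ℝ) :
    N (wordProd B w *ᵥ x) ≤ iterMax B N w.length x := by
  induction w generalizing x with
  | nil => simp [iterMax]
  | cons i w ih =>
    rw [wordProd_cons, ← Matrix.mulVec_mulVec]
    exact (ih _).trans (iterMax_le_succ _ i x)

lemma isSeminorm_iterMax [Nonempty (Fin m)] (hN : IsSeminorm N) (k : ℕ) : IsSeminorm (iterMax B N k) := by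
  induction k with
  | zero => exact ⟨hN.nonneg, hN.smul, hN.add_le⟩
  | succ k ih =>
    refine ⟨fun x => Real.iSup_nonneg fun i => ih.nonneg _, fun c x => ?_, fun x y => ?_⟩
    · rw [iterMax, iterMax, Real.mul_iSup_of_nonneg (abs_nonneg c)]
      simp_rw [Matrix.mulVec_smul, ih.smul]
    · refine ciSup_le fun i => ?_
      rw [Matrix.mulVec_add]
      exact (ih.add_le _ _).trans (add_le_add (iterMax_le_succ k i x) (iterMax_le_succ k i y))

lemma antitone_iterMax [Nonempty (Fin m)] (h : ∀ i x, N (B i *ᵥ x) ≤ N x) (x : Fin d → ℝ) :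
    Antitone fun k => iterMax B N k x := by
  refine antitone_nat_of_succ_le fun k => ?_
  induction k generalizing x with
  | zero => exact ciSup_le fun i => h i x
  | succ k ih => exact ciSup_le fun i => (ih _).trans (iterMax_le_succ k i x)

end IterMax

/-- An irreducible family of joint spectral radius one has a Barabanov norm. -/
theorem exists_isUnitBarabanov [Nonempty (Fin m)] (hB : IsIrreducible B)
    (hJ : ∀ t : ℝ, 1 < t → ∃ C : ℝ, 0 < C ∧ ∀ w x, ‖wordProd B w *ᵥ x‖ ≤ C * t ^ w.length * ‖x‖)
    (hJ' : ∃ c : ℝ, 0 < c ∧ ∀ n : ℕ, n ≠ 0 → ∃ w : List (Fin m), w.length = n ∧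
      ∀ b, 0 ≤ b → (∀ j, ‖wordProd B w *ᵥ Pi.single j 1‖ ≤ b) → c ≤ b) :
    ∃ g, IsUnitBarabanov B g := by
  have hb := exists_wordProd_bound hB hJ
  have hn := (isNorm_norm (d := d)).isSeminorm
  set N := orbitSup B fun x => ‖x‖
  have hN : IsSeminorm N := isSeminorm_orbitSup hn hb
  have hNB : ∀ i x, N (B i *ᵥ x) ≤ N x := orbitSup_le hn hb
  have hM : ∀ k, IsSeminorm (iterMax B N k) := isSeminorm_iterMax hN
  have hanti := antitone_iterMax hNB
  -- `N` does not increase along the family, so the maxima over words of length `k` decrease in `k`;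
  -- their limit is the candidate.
  set f : (Fin d → ℝ) → ℝ := fun x => ⨅ k, iterMax B N k x
  have hbdd : ∀ x, BddBelow (Set.range fun k => iterMax B N k x) := fun x =>
    ⟨0, by rintro _ ⟨k, rfl⟩; exact (hM k).nonneg x⟩
  have hlim : ∀ x, Tendsto (fun k => iterMax B N k x) atTop (𝓝 (f x)) := fun x =>
    tendsto_atTop_ciInf (hanti x) (hbdd x)
  have hle : ∀ k x, f x ≤ iterMax B N k x := fun k x => ciInf_le (hbdd x) k
  have hf : IsSeminorm f := by
    refine ⟨fun x => le_ciInf fun k => (hM k).nonneg x, fun c x => ?_, fun x y => ?_⟩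
    · refine tendsto_nhds_unique (hlim _) ?_
      simp_rw [(hM _).smul]
      exact (hlim x).const_mul _
    · exact le_of_tendsto_of_tendsto' (hlim _) ((hlim x).add (hlim y)) fun k => (hM k).add_le x y
  have hfB : ∀ i x, f (B i *ᵥ x) ≤ f x := fun i x =>
    le_ciInf fun k => (ciInf_le (hbdd _) k).trans
      ((iterMax_le_succ k i x).trans (hanti x (Nat.le_succ k)))
  -- If the limit vanished, all columns of all products of some length `k` would be smaller than the
  -- lower bound `hJ'` allows.
  have hne : ∃ x, f x ≠ 0 := by
    by_contra! hz
    obtain ⟨c, hc, hw⟩ := hJ'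
    have hsmall : ∀ᶠ k in atTop, ∀ j : Fin d, iterMax B N k (Pi.single j 1) < c / 2 := by
      rw [eventually_all]
      intro j
      exact (hlim (Pi.single j 1)).eventually (gt_mem_nhds (by rw [hz]; linarith))
    obtain ⟨k, hk, hk0⟩ := (hsmall.and (eventually_ne_atTop 0)).exists
    obtain ⟨w, hwk, hwc⟩ := hw k hk0
    have := hwc (c / 2) (by linarith) fun j => by
      refine le_trans ?_ (hk j).le
      rw [← hwk]
      exact (le_orbitSup_self hn hb _).trans (le_iterMax w _)
    linarith
  refine ⟨f, hf.isNorm_of_irreducible hB hfB hne, fun x => ⟨?_, ?_⟩⟩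
  · choose i hi using fun k => exists_iterMax_succ (B := B) (N := N) k x
    -- By pigeonhole one letter is maximising for infinitely many `k`; monotonicity in `k` makes it
    -- attain the limit.
    obtain ⟨i₀, hi₀⟩ : ∃ i₀, ∃ᶠ k in atTop, i k = i₀ := by
      by_contra! hcon
      have := eventually_all.2 hcon
      obtain ⟨k, hk⟩ := this.exists
      exact hk (i k) rfl
    refine ⟨i₀, le_antisymm (hfB _ _) (le_ciInf fun k => ?_)⟩
    obtain ⟨l, hkl, hl⟩ := (frequently_atTop.1 hi₀) k
    refine le_trans ?_ (hanti _ hkl)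
    simp only
    rw [← hl, hi l]
    exact hle _ x
  · rintro _ ⟨i, rfl⟩
    exact hfB i x

end Existence

/-! ### Spectral bounds: closedness, decay of powers, compactness of contractions. -/

section Spectrum
variable {d : ℕ}

/-- The complexification of a real matrix. -/
def toC (M : Matrix (Fin d) (Fin d) ℝ) : Matrix (Fin d) (Fin d) ℂ := M.map fun t : ℝ => (t : ℂ)

/-- All complex eigenvalues of `M` have modulus at most `r`. -/
def EigLE (M : Matrix (Fin d) (Fin d) ℝ) (r : ℝ) : Prop :=
  ∀ μ ∈ spectrum ℂ (toC M), ‖μ‖ ≤ r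

lemma continuous_toC : Continuous (toC (d := d)) :=
  Continuous.matrix_map continuous_id Complex.continuous_ofReal

lemma mem_spectrum_iff_det {M : Matrix (Fin d) (Fin d) ℂ} {μ : ℂ} :
    μ ∈ spectrum ℂ M ↔ (Matrix.scalar (Fin d) μ - M).det = 0 := by
  rw [Matrix.mem_spectrum_iff_isRoot_charpoly, Polynomial.IsRoot, Matrix.eval_charpoly]

lemma mem_spectrum_iff_exists {M : Matrix (Fin d) (Fin d) ℂ} {μ : ℂ} :
    μ ∈ spectrum ℂ M ↔ ∃ x, x ≠ 0 ∧ M *ᵥ x = μ • x := by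
  rw [mem_spectrum_iff_det, ← Matrix.exists_mulVec_eq_zero_iff]
  refine exists_congr fun x => and_congr_right fun _ => ?_
  rw [Matrix.sub_mulVec, sub_eq_zero, eq_comm, Matrix.scalar_apply, Matrix.diagonal_const_mulVec]

/-- The characteristic polynomial at `μ` is a product of `d` factors `μ - ν`, each of modulus at
least `‖μ‖ - r`. -/
lemma pow_le_norm_det {M : Matrix (Fin d) (Fin d) ℝ} {r : ℝ} (hM : EigLE M r) {μ : ℂ}
    (hμ : r < ‖μ‖) : (‖μ‖ - r) ^ d ≤ ‖(Matrix.scalar (Fin d) μ - toC M).det‖ := by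
  rw [← Matrix.eval_charpoly]
  have hs : (toC M).charpoly.Splits := IsAlgClosed.splits _
  have h1 := hs.eval_eq_prod_roots_of_monic (Matrix.charpoly_monic _) μ
  have hcard : Multiset.card (toC M).charpoly.roots = d := by
    rw [← hs.natDegree_eq_card_roots, Matrix.charpoly_natDegree_eq_dim, Fintype.card_fin]
  have h2 : ∀ ν ∈ (toC M).charpoly.roots, ‖μ‖ - r ≤ ‖μ - ν‖ := by
    intro ν hν
    have := hM ν (Matrix.mem_spectrum_iff_isRoot_charpoly.2 (Polynomial.isRoot_of_mem_roots hν))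
    linarith [norm_sub_norm_le μ ν]
  have h3 : ∀ s : Multiset ℂ, (∀ ν ∈ s, ‖μ‖ - r ≤ ‖μ - ν‖) →
      (‖μ‖ - r) ^ Multiset.card s ≤ ‖(s.map fun ν => μ - ν).prod‖ := by
    intro s
    induction s using Multiset.induction_on with
    | empty => simp
    | cons a s ih =>
      intro h
      rw [Multiset.card_cons, Multiset.map_cons, Multiset.prod_cons, norm_mul, pow_succ']
      exact mul_le_mul (h a (by simp)) (ih fun ν hν => h ν (by simp [hν]))
        (pow_nonneg (by linarith) _) (norm_nonneg _)
  rw [h1]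
  simpa [hcard] using h3 _ h2

/-- The determinant bound of `pow_le_norm_det` is closed in `M` for each fixed `μ` outside the disc,
and it excludes `μ` from the spectrum. This makes the spectral gap stable under limits without
continuity of eigenvalues. -/
lemma isClosed_eigLE (r : ℝ) : IsClosed {M : Matrix (Fin d) (Fin d) ℝ | EigLE M r} := by
  have h : {M : Matrix (Fin d) (Fin d) ℝ | EigLE M r} = ⋂ μ : {μ : ℂ // r < ‖μ‖},
      {M | (‖μ.1‖ - r) ^ d ≤ ‖(Matrix.scalar (Fin d) μ.1 - toC M).det‖} := by
    ext M
    simp only [Set.mem_iInter, Set.mem_ofPred_eq]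
    refine ⟨fun hM μ => pow_le_norm_det hM μ.2, fun hM μ hμ => ?_⟩
    by_contra! hlt
    have h1 := hM ⟨μ, hlt⟩
    rw [mem_spectrum_iff_det.1 hμ, norm_zero] at h1
    exact absurd h1 (not_le.2 (pow_pos (by linarith) d))
  rw [h]
  refine isClosed_iInter fun μ => isClosed_le continuous_const ?_
  exact (Continuous.matrix_det (continuous_const.sub continuous_toC)).norm

lemma toC_mulVec_ofReal (M : Matrix (Fin d) (Fin d) ℝ) (x : Fin d → ℝ) :
    toC M *ᵥ (fun j => (x j : ℂ)) = fun j => ((M *ᵥ x) j : ℂ) := by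
  ext i
  simp [toC, Matrix.mulVec, dotProduct]

lemma toC_mul (M N : Matrix (Fin d) (Fin d) ℝ) : toC (M * N) = toC M * toC N := by
  ext i j; simp [toC, Matrix.mul_apply]

lemma toC_smul (c : ℝ) (M : Matrix (Fin d) (Fin d) ℝ) : toC (c • M) = (c : ℂ) • toC M := by
  ext i j; simp [toC]

lemma EigLE.one_le {M : Matrix (Fin d) (Fin d) ℝ} {r : ℝ} (hM : EigLE M r) {x : Fin d → ℝ}
    (hx : x ≠ 0) (h : M *ᵥ x = x) : 1 ≤ r := by
  have h1 : (1 : ℂ) ∈ spectrum ℂ (toC M) := by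
    refine mem_spectrum_iff_exists.2 ⟨fun j => (x j : ℂ), fun h0 => hx ?_, ?_⟩
    · ext j
      simpa using congrFun h0 j
    · rw [toC_mulVec_ofReal, h, one_smul]
  simpa using hM 1 h1

lemma finite_spectrum (M : Matrix (Fin d) (Fin d) ℂ) : (spectrum ℂ M).Finite := by
  have : spectrum ℂ M ⊆ {μ | μ ∈ M.charpoly.roots} := fun μ hμ =>
    (Polynomial.mem_roots (Matrix.charpoly_monic M).ne_zero).2
      (Matrix.mem_spectrum_iff_isRoot_charpoly.1 hμ)
  exact (Multiset.finite_toSet _).subset this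

lemma specRad_nonneg (M : Matrix (Fin d) (Fin d) ℝ) : 0 ≤ specRad M := ENNReal.toReal_nonneg

lemma spectralRadius_ne_top (M : Matrix (Fin d) (Fin d) ℝ) : spectralRadius ℂ (toC M) ≠ ⊤ := by
  obtain ⟨C, hC⟩ := ((finite_spectrum (toC M)).image fun μ => ‖μ‖₊).bddAbove
  refine ne_top_of_le_ne_top (ENNReal.coe_ne_top (r := C)) ?_
  exact iSup₂_le fun μ hμ => ENNReal.coe_le_coe.2 (hC ⟨μ, hμ, rfl⟩)

lemma eigLE_specRad (M : Matrix (Fin d) (Fin d) ℝ) : EigLE M (specRad M) := by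
  intro μ hμ
  have h : (‖μ‖₊ : ENNReal) ≤ spectralRadius ℂ (toC M) := le_iSup₂_of_le μ hμ le_rfl
  have h2 := ENNReal.toReal_mono (spectralRadius_ne_top M) h
  rw [ENNReal.coe_toReal, coe_nnnorm] at h2
  exact h2

lemma specRad_le {M : Matrix (Fin d) (Fin d) ℝ} {r : ℝ} (hr : 0 ≤ r) (h : EigLE M r) :
    specRad M ≤ r := by
  have : spectralRadius ℂ (toC M) ≤ ENNReal.ofReal r := by
    refine iSup₂_le fun μ hμ => ?_
    rw [← ENNReal.ofReal_coe_nnreal, coe_nnnorm]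
    exact ENNReal.ofReal_le_ofReal (h μ hμ)
  exact ENNReal.toReal_le_of_le_ofReal hr this

lemma EigLE.smul {M : Matrix (Fin d) (Fin d) ℝ} {r c : ℝ} (hc : 0 < c) (h : EigLE M r) :
    EigLE (c • M) (c * r) := by
  intro μ hμ
  obtain ⟨x, hx, hMx⟩ := mem_spectrum_iff_exists.1 hμ
  have hc' : (c : ℂ) ≠ 0 := by exact_mod_cast hc.ne'
  have h1 : (c : ℂ)⁻¹ * μ ∈ spectrum ℂ (toC M) := by
    refine mem_spectrum_iff_exists.2 ⟨x, hx, ?_⟩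
    rw [toC_smul, Matrix.smul_mulVec] at hMx
    rw [mul_smul, ← hMx, smul_smul, inv_mul_cancel₀ hc', one_smul]
  have h2 := h _ h1
  rw [norm_mul, norm_inv, Complex.norm_real, Real.norm_eq_abs, abs_of_pos hc,
    inv_mul_le_iff₀ hc] at h2
  exact h2

section Decay
attribute [local instance] Matrix.linftyOpNormedRing Matrix.linftyOpNormedAlgebra

/-- Powers of a matrix with spectrum in the open unit disc tend to zero. -/
lemma tendsto_pow_mulVec {M : Matrix (Fin d) (Fin d) ℂ} (h : ∀ μ ∈ spectrum ℂ M, ‖μ‖ < 1)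
    (x : Fin d → ℂ) : Tendsto (fun n : ℕ => (M ^ n) *ᵥ x) atTop (𝓝 0) := by
  have h1 : spectralRadius ℂ M < 1 := by
    rcases (spectrum ℂ M).eq_empty_or_nonempty with he | hne
    · simp [spectralRadius, he]
    · exact_mod_cast spectrum.spectralRadius_lt_of_forall_lt_of_nonempty hne
        (r := 1) fun μ hμ => by simpa [← NNReal.coe_lt_coe] using h μ hμ
  obtain ⟨r, hr1, hr2⟩ := ENNReal.lt_iff_exists_nnreal_btwn.1 h1
  -- Gelfand's formula: eventually `‖M ^ n‖ < r ^ n` with `r < 1`.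
  have h2 := (spectrum.limsup_pow_nnnorm_pow_one_div_le_spectralRadius M).trans_lt hr1
  have h3 := Filter.eventually_lt_of_limsup_lt h2
  have hr2' : (r : ℝ) < 1 := by exact_mod_cast hr2
  have h4 : Tendsto (fun n : ℕ => ‖M ^ n‖) atTop (𝓝 0) := by
    refine squeeze_zero' (Eventually.of_forall fun n => norm_nonneg _) ?_
      (tendsto_pow_atTop_nhds_zero_of_lt_one r.2 hr2')
    filter_upwards [h3, eventually_gt_atTop 0] with n hn hn0
    have hn0' : (0 : ℝ) < n := by exact_mod_cast hn0
    have h5 : (‖M ^ n‖₊ : ENNReal) < (r : ENNReal) ^ n := by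
      have := ENNReal.rpow_lt_rpow hn hn0'
      rwa [← ENNReal.rpow_mul, one_div, inv_mul_cancel₀ hn0'.ne', ENNReal.rpow_one,
        ENNReal.rpow_natCast] at this
    have h6 : ‖M ^ n‖₊ < r ^ n := by exact_mod_cast h5
    exact_mod_cast h6.le
  have h5 : Tendsto (fun n : ℕ => M ^ n) atTop (𝓝 0) := tendsto_zero_iff_norm_tendsto_zero.2 h4
  have h6 : Continuous fun N : Matrix (Fin d) (Fin d) ℂ => N *ᵥ x := by fun_prop
  have h7 := (h6.tendsto 0).comp h5
  rw [Matrix.zero_mulVec] at h7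
  exact h7

end Decay

lemma toC_pow (M : Matrix (Fin d) (Fin d) ℝ) (n : ℕ) : toC (M ^ n) = toC M ^ n := by
  induction n with
  | zero =>
    ext i j
    by_cases h : i = j <;> simp [toC, h]
  | succ n ih => rw [pow_succ, toC_mul, ih, pow_succ]

lemma tendsto_of_toC {x : ℕ → Fin d → ℝ}
    (h : Tendsto (fun n => fun j => ((x n j : ℝ) : ℂ)) atTop (𝓝 0)) : Tendsto x atTop (𝓝 0) := by
  rw [tendsto_pi_nhds] at h ⊢
  intro j
  have := (Complex.continuous_re.tendsto _).comp (h j)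
  simpa [Function.comp_def] using this

lemma EigLE.tendsto_pow {M : Matrix (Fin d) (Fin d) ℝ} {r : ℝ} (hM : EigLE M r) (hr : r < 1)
    (x : Fin d → ℝ) : Tendsto (fun n : ℕ => (M ^ n) *ᵥ x) atTop (𝓝 0) := by
  refine tendsto_of_toC ?_
  have h : (fun (n : ℕ) (j : Fin d) => (((M ^ n) *ᵥ x) j : ℂ)) =
      fun n => toC M ^ n *ᵥ fun j => (x j : ℂ) := by
    funext n
    rw [← toC_pow, toC_mulVec_ofReal]
  rw [h]
  exact tendsto_pow_mulVec (fun μ hμ => (hM μ hμ).trans_lt hr) _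

/-- A matrix that does not increase a norm has spectrum in the closed unit disc. -/
lemma eigLE_one_of_norm {M : Matrix (Fin d) (Fin d) ℝ} {g : (Fin d → ℝ) → ℝ} (hg : IsNorm g)
    (h : ∀ x, g (M *ᵥ x) ≤ g x) : EigLE M 1 := by
  intro μ hμ
  obtain ⟨x, hx, hMx⟩ := mem_spectrum_iff_exists.1 hμ
  have hpow : ∀ n : ℕ, toC (M ^ n) *ᵥ x = μ ^ n • x := by
    intro n
    induction n with
    | zero => simp [toC]
    | succ n ih =>
      rw [pow_succ, toC_mul, ← Matrix.mulVec_mulVec, hMx, Matrix.mulVec_smul, ih, smul_smul,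
        pow_succ']
  have hgp : ∀ (n : ℕ) y, g ((M ^ n) *ᵥ y) ≤ g y := by
    intro n
    induction n with
    | zero => simp
    | succ n ih =>
      intro y
      rw [pow_succ, ← Matrix.mulVec_mulVec]
      exact (ih _).trans (h y)
  obtain ⟨C, hC, hCg⟩ := hg.exists_norm_le
  obtain ⟨j, hj⟩ : ∃ j, x j ≠ 0 := Function.ne_iff.1 hx
  set a : Fin d → ℝ := fun i => (x i).re
  set b : Fin d → ℝ := fun i => (x i).im
  have hx2 : x = (fun i => (a i : ℂ)) + Complex.I • fun i => (b i : ℂ) := by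
    ext i
    simp only [Pi.add_apply, Pi.smul_apply, smul_eq_mul, a, b]
    rw [mul_comm, Complex.re_add_im]
  -- Real and imaginary parts of the eigenvector have bounded orbits, so `‖μ‖ ^ n` is bounded.
  have hbound : ∀ n : ℕ, ‖μ‖ ^ n * ‖x j‖ ≤ C * g a + C * g b := by
    intro n
    have h1 : μ ^ n * x j = (((M ^ n) *ᵥ a) j : ℂ) + Complex.I * (((M ^ n) *ᵥ b) j : ℂ) := by
      have := congrFun (hpow n) j
      rw [hx2, Matrix.mulVec_add, Matrix.mulVec_smul, toC_mulVec_ofReal, toC_mulVec_ofReal] at this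
      rw [hx2]
      simpa using this.symm
    rw [← norm_pow, ← norm_mul, h1]
    refine (norm_add_le _ _).trans (add_le_add ?_ ?_)
    · rw [Complex.norm_real]
      exact (norm_le_pi_norm _ j).trans ((hCg _).trans
        (mul_le_mul_of_nonneg_left (hgp n a) hC.le))
    · rw [norm_mul, Complex.norm_I, one_mul, Complex.norm_real]
      exact (norm_le_pi_norm _ j).trans ((hCg _).trans
        (mul_le_mul_of_nonneg_left (hgp n b) hC.le))
  by_contra! hlt
  have hxj : 0 < ‖x j‖ := norm_pos_iff.2 hj
  obtain ⟨n, hn⟩ := pow_unbounded_of_one_lt ((C * g a + C * g b) / ‖x j‖) hlt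
  rw [div_lt_iff₀ hxj] at hn
  linarith [hbound n]

/-- The matrices that do not increase a norm form a compact set. -/
lemma isCompact_contractions {g : (Fin d → ℝ) → ℝ} (hg : IsNorm g) :
    IsCompact {M : Matrix (Fin d) (Fin d) ℝ | ∀ x, g (M *ᵥ x) ≤ g x} := by
  obtain ⟨C, hC, hCg⟩ := hg.exists_norm_le
  obtain ⟨D, hD, hDg⟩ := hg.isSeminorm.exists_le_norm
  have hcl : IsClosed {M : Matrix (Fin d) (Fin d) ℝ | ∀ x, g (M *ᵥ x) ≤ g x} := by
    rw [Set.ofPred_forall]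
    refine isClosed_iInter fun x => isClosed_le (hg.continuous.comp ?_) continuous_const
    fun_prop
  have hK : IsCompact (Set.univ.pi fun _ : Fin d => Set.univ.pi fun _ : Fin d =>
      Set.Icc (-(C * D)) (C * D) : Set (Matrix (Fin d) (Fin d) ℝ)) :=
    isCompact_univ_pi fun _ => isCompact_univ_pi fun _ => isCompact_Icc
  refine hK.of_isClosed_subset hcl fun (M : Matrix (Fin d) (Fin d) ℝ) hM i _ j _ => ?_
  have h1 : M i j = (M *ᵥ Pi.single j 1) i := by rw [Matrix.mulVec_single_one]; rfl
  have h2 : |M i j| ≤ C * D := by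
    rw [h1]
    refine (norm_le_pi_norm (M *ᵥ Pi.single j 1) i).trans ((hCg _).trans ?_)
    refine mul_le_mul_of_nonneg_left ((hM _).trans ((hDg _).trans ?_)) hC.le
    have : ‖(Pi.single j 1 : Fin d → ℝ)‖ ≤ 1 := by
      rw [Pi.norm_single]; simp
    nlinarith
  exact abs_le.1 h2

end Spectrum

/-! ### Trajectories of constant norm are eventually driven by the dominant product. -/

section Trajectories
variable {d m : ℕ} {B : Fin m → Matrix (Fin d) (Fin d) ℝ}

/-- `x` is the trajectory driven by the switching sequence `s`. -/
def IsTrajectory (B : Fin m → Matrix (Fin d) (Fin d) ℝ) (s : ℕ → Fin m) (x : ℕ → Fin d → ℝ) :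
    Prop := ∀ k, x (k + 1) = B (s k) *ᵥ x k

/-- The word read by the switching sequence `s` from time `i` during `n` steps. -/
def seg (s : ℕ → Fin m) (i n : ℕ) : List (Fin m) := (List.range' i n).map s

@[simp] lemma length_seg (s : ℕ → Fin m) (i n : ℕ) : (seg s i n).length = n := by simp [seg]

lemma seg_add (s : ℕ → Fin m) (i n k : ℕ) : seg s i (n + k) = seg s i n ++ seg s (i + n) k := by
  rw [seg, seg, seg, ← List.map_append]
  congr 1
  simp

lemma take_seg (s : ℕ → Fin m) (i : ℕ) {n k : ℕ} (h : n ≤ k) :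
    (seg s i k).take n = seg s i n := by
  obtain ⟨l, rfl⟩ := Nat.exists_eq_add_of_le h
  rw [seg_add]
  exact List.take_left' (length_seg s i n)

lemma IsTrajectory.eq_wordProd {s : ℕ → Fin m} {x : ℕ → Fin d → ℝ} (h : IsTrajectory B s x)
    (i n : ℕ) : x (i + n) = wordProd B (seg s i n) *ᵥ x i := by
  induction n with
  | zero => simp [seg]
  | succ n ih =>
    rw [seg_add, wordProd_append, ← Matrix.mulVec_mulVec, ← ih, ← add_assoc, h (i + n)]
    simp [seg, wordProd_singleton]

/-- Every point starts a trajectory along which the Barabanov norm is constant. -/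
lemma IsUnitBarabanov.exists_trajectory {g : (Fin d → ℝ) → ℝ} (hg : IsUnitBarabanov B g)
    (x₀ : Fin d → ℝ) : ∃ s x, IsTrajectory B s x ∧ x 0 = x₀ ∧ ∀ k, g (x k) = g x₀ := by
  choose i hi using hg.exists_eq
  let x : ℕ → Fin d → ℝ := fun k => Nat.rec x₀ (fun _ y => B (i y) *ᵥ y) k
  have hx : ∀ k, x (k + 1) = B (i (x k)) *ᵥ x k := fun k => rfl
  refine ⟨fun k => i (x k), x, hx, rfl, fun k => ?_⟩
  induction k with
  | zero => rfl
  | succ k ih => rw [hx, hi, ih]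

lemma tendsto_mulVec {ι : Type*} {l : Filter ι} {W : ι → Matrix (Fin d) (Fin d) ℝ}
    {z : ι → Fin d → ℝ} {M : Matrix (Fin d) (Fin d) ℝ} {y : Fin d → ℝ} (hW : Tendsto W l (𝓝 M))
    (hz : Tendsto z l (𝓝 y)) : Tendsto (fun k => W k *ᵥ z k) l (𝓝 (M *ᵥ y)) := by
  have hc : Continuous fun p : Matrix (Fin d) (Fin d) ℝ × (Fin d → ℝ) => p.1 *ᵥ p.2 := by
    fun_prop
  have h := (hc.tendsto (M, y)).comp (hW.prodMk_nhds hz)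
  exact h

/-- Along a trajectory of constant norm the spectral radii of the transition products come
arbitrarily close to one. -/
lemma IsTrajectory.exists_not_eigLE {g : (Fin d → ℝ) → ℝ} (hg : IsUnitBarabanov B g)
    {s : ℕ → Fin m} {x : ℕ → Fin d → ℝ} (h : IsTrajectory B s x) (hx : ∀ k, g (x k) = 1)
    {r : ℝ} (hr : r < 1) : ∃ φ : ℕ → ℕ, StrictMono φ ∧
      ∀ i j, i < j → ¬ EigLE (wordProd B (seg s (φ i) (φ j - φ i))) r := by
  obtain ⟨y, hy, φ, hφ, hlim⟩ := hg.isNorm.isCompact_sphere.tendsto_subseq hx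
  have hy0 : y ≠ 0 := by
    rintro rfl
    rw [Set.mem_ofPred_eq, hg.isNorm.isSeminorm.map_zero] at hy
    exact zero_ne_one hy
  suffices hK : ∃ K, ∀ i j, K ≤ i → i < j →
      ¬ EigLE (wordProd B (seg s (φ i) (φ j - φ i))) r by
    obtain ⟨K, hK⟩ := hK
    refine ⟨fun i => φ (K + i), fun a b hab => hφ (by omega), fun i j hij => ?_⟩
    exact hK _ _ (by omega) (by omega)
  -- Otherwise arbitrarily late pairs of times have transition products with spectral radius at most
  -- `r`. A limit `M` of these contractions inherits the bound, yet it fixes the nonzero limit point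
  -- `y`.
  by_contra! hcon
  choose i j hi hij hE using hcon
  have : FirstCountableTopology (Matrix (Fin d) (Fin d) ℝ) :=
    inferInstanceAs (FirstCountableTopology (Fin d → Fin d → ℝ))
  obtain ⟨M, -, ψ, hψ, hM⟩ := (isCompact_contractions hg.isNorm).tendsto_subseq
    (x := fun K => wordProd B (seg s (φ (i K)) (φ (j K) - φ (i K))))
    (fun K z => hg.wordProd_le _ z)
  have hME : EigLE M r := (isClosed_eigLE r).mem_of_tendsto hM
    (Eventually.of_forall fun K => hE (ψ K))
  have hi' : Tendsto (fun K => i (ψ K)) atTop atTop :=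
    (tendsto_atTop_mono hi tendsto_id).comp hψ.tendsto_atTop
  have hj' : Tendsto (fun K => j (ψ K)) atTop atTop :=
    tendsto_atTop_mono (fun K => (hij (ψ K)).le) hi'
  have h1 : Tendsto (fun K => wordProd B (seg s (φ (i (ψ K))) (φ (j (ψ K)) - φ (i (ψ K)))) *ᵥ
      x (φ (i (ψ K)))) atTop (𝓝 (M *ᵥ y)) := by
    exact tendsto_mulVec hM (hlim.comp hi')
  have h2 : Tendsto (fun K => x (φ (j (ψ K)))) atTop (𝓝 y) := hlim.comp hj'
  have h3 : M *ᵥ y = y := by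
    refine tendsto_nhds_unique h1 (h2.congr fun K => ?_)
    rw [← h.eq_wordProd, Nat.add_sub_cancel' (hφ (hij (ψ K))).le]
  exact absurd (hME.one_le hy0 h3) (not_le.2 hr)

lemma mul_pow_mul_comm {R : Type*} [Monoid R] (a b : R) (n : ℕ) :
    b * (a * b) ^ n = (b * a) ^ n * b := by
  induction n with
  | zero => simp
  | succ n ih => rw [pow_succ, ← mul_assoc, ih, pow_succ, mul_assoc, mul_assoc, mul_assoc]

/-- The words that are powers of a cyclic permutation of `P`. -/
def IsRotPow (P S : List (Fin m)) : Prop :=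
  ∃ w' : List (Fin m), P.IsRotated w' ∧ ∃ k : ℕ, S = wordPow w' k

lemma exists_append_of_isRotated {P Q : List (Fin m)} (h : P.IsRotated Q) :
    ∃ u v, P = u ++ v ∧ Q = v ++ u := by
  obtain ⟨n, hn⟩ := h
  rw [List.rotate_eq_drop_append_take_mod] at hn
  exact ⟨_, _, (List.take_append_drop _ P).symm, hn.symm⟩

/-- A trajectory of constant norm is eventually driven by the dominant product. -/
lemma IsTrajectory.exists_eq_pow {g : (Fin d → ℝ) → ℝ} (hg : IsUnitBarabanov B g)
    {s : ℕ → Fin m} {x : ℕ → Fin d → ℝ} (h : IsTrajectory B s x) (hx : ∀ k, g (x k) = 1)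
    {r : ℝ} (hr : r < 1) {P : List (Fin m)} (hP : P ≠ [])
    (hgap : ∀ w, w ≠ [] → ¬ IsRotPow P w → EigLE (wordProd B w) r) :
    ∃ K, ∀ n, x (K + n * P.length) = (wordProd B P ^ n) *ᵥ x K := by
  obtain ⟨φ, hφ, hE⟩ := h.exists_not_eigLE hg hx hr
  have hPl : 0 < P.length := List.length_pos_of_ne_nil hP
  set a := φ 0 with ha
  set Q := seg s a P.length with hQ
  -- Each segment from `a` to a later time `φ j` is a power of a cyclic permutation of `P`; its
  -- first `|P|` letters identify that permutation, so it is the same `Q` for all `j`.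
  have key : ∀ j, 0 < j → P.IsRotated Q ∧ ∃ k, seg s a (φ j - a) = wordPow Q k := by
    intro j hj
    have hlt : a < φ j := hφ hj
    have hne : seg s a (φ j - a) ≠ [] := by
      rw [← List.length_pos_iff_ne_nil, length_seg]; omega
    have h1 : IsRotPow P (seg s a (φ j - a)) := by
      by_contra hc
      exact hE 0 j hj (hgap _ hne hc)
    obtain ⟨w', hw', k, hk⟩ := h1
    have hk0 : k ≠ 0 := by rintro rfl; exact hne (by simpa using hk)
    obtain ⟨k, rfl⟩ := Nat.exists_eq_succ_of_ne_zero hk0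
    have hlen : w'.length = P.length := hw'.perm.length_eq.symm
    have hle : P.length ≤ φ j - a := by
      have := congrArg List.length hk
      rw [length_seg, length_wordPow, hlen] at this
      rw [this]
      exact Nat.le_mul_of_pos_left _ (Nat.succ_pos k)
    have h2 : w' = Q := by
      rw [hQ, ← take_seg s a hle, hk, wordPow_succ, List.take_left' hlen]
    exact ⟨h2 ▸ hw', _, h2 ▸ hk⟩
  have hrot := (key 1 one_pos).1
  have hlenQ : Q.length = P.length := length_seg _ _ _
  have hpow : ∀ n, seg s a (n * P.length) = wordPow Q n := by
    intro n
    obtain ⟨-, k, hk⟩ := key (n * P.length + a + 1) (by omega)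
    have h1 : n * P.length ≤ φ (n * P.length + a + 1) - a := by
      have := hφ.le_apply (x := n * P.length + a + 1)
      omega
    have h2 := congrArg List.length hk
    rw [length_seg, length_wordPow, hlenQ] at h2
    have h3 : n ≤ k := by
      rw [h2] at h1
      exact Nat.le_of_mul_le_mul_right h1 hPl
    obtain ⟨l, rfl⟩ := Nat.exists_eq_add_of_le h3
    rw [← take_seg s a h1, hk, wordPow_add]
    exact List.take_left' (by rw [length_wordPow, hlenQ])
  -- From time `a` the sequence reads `(v u)(v u)…`; starting `|v|` steps later it reads `(u v)(u
  -- v)… = P P…`.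
  obtain ⟨u, v, hP', hQ'⟩ := exists_append_of_isRotated hrot
  have hv : ∀ n, seg s a (n * P.length + v.length) = wordPow Q n ++ v := by
    intro n
    have h1 : n * P.length + v.length ≤ (n + 1) * P.length := by
      rw [hP', List.length_append]; nlinarith
    rw [← take_seg s a h1, hpow, wordPow_succ', ← hpow n]
    rw [hQ', ← List.append_assoc]
    exact List.take_left' (by simp)
  refine ⟨a + v.length, fun n => ?_⟩
  have h1 := h.eq_wordProd a (n * P.length + v.length)
  have h2 := h.eq_wordProd a v.length
  have h0 := hv 0
  simp only [zero_mul, zero_add, wordPow_zero, List.nil_append] at h0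
  rw [hv, wordProd_append, wordProd_wordPow, hQ', wordProd_append, mul_pow_mul_comm] at h1
  rw [h0] at h2
  rw [h2, add_assoc, add_comm v.length, h1, hP', wordProd_append, Matrix.mulVec_mulVec]

end Trajectories

/-! ### Uniform exit times from compact sets. -/

section Uniform
variable {d m : ℕ} {B : Fin m → Matrix (Fin d) (Fin d) ℝ}

/-- The points of the compact set `F` from which a trajectory can stay in `F` for `k` steps. -/
def stayIn (B : Fin m → Matrix (Fin d) (Fin d) ℝ) (F : Set (Fin d → ℝ)) : ℕ → Set (Fin d → ℝ)
  | 0 => F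
  | k + 1 => F ∩ ⋃ i, {x | B i *ᵥ x ∈ stayIn B F k}

lemma stayIn_succ_subset (F : Set (Fin d → ℝ)) (k : ℕ) : stayIn B F (k + 1) ⊆ stayIn B F k := by
  induction k with
  | zero => exact Set.inter_subset_left
  | succ k ih =>
    refine Set.inter_subset_inter_right _ (Set.iUnion_mono fun i x hx => ih hx)

lemma isClosed_stayIn {F : Set (Fin d → ℝ)} (hF : IsClosed F) (k : ℕ) :
    IsClosed (stayIn B F k) := by
  induction k with
  | zero => exact hF
  | succ k ih =>
    refine hF.inter (isClosed_iUnion_of_finite fun i => ih.preimage ?_)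
    fun_prop

lemma exists_iterate_mem {F : Set (Fin d → ℝ)} {s : ℕ → Fin m} {x : ℕ → Fin d → ℝ}
    (h : IsTrajectory B s x) (k : ℕ) (hx : ∀ j ≤ k, x j ∈ F) : x 0 ∈ stayIn B F k := by
  induction k generalizing s x with
  | zero => exact hx 0 le_rfl
  | succ k ih =>
    refine ⟨hx 0 (by omega), Set.mem_iUnion.2 ⟨s 0, ?_⟩⟩
    rw [Set.mem_ofPred_eq, ← h 0]
    exact ih (s := fun k => s (k + 1)) (x := fun k => x (k + 1)) (fun k => h (k + 1))
      fun j hj => hx (j + 1) (by omega)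

/-- If no trajectory stays in the compact set `F` forever, then the time spent in `F` is
bounded. -/
lemma exists_stayIn_eq_empty {F : Set (Fin d → ℝ)} (hF : IsCompact F)
    (h : ∀ s x, IsTrajectory B s x → ∃ k, x k ∉ F) : ∃ K, stayIn B F K = ∅ := by
  by_contra! hne
  obtain ⟨x₀, hx₀⟩ := IsCompact.nonempty_iInter_of_sequence_nonempty_isCompact_isClosed
    (stayIn B F) (stayIn_succ_subset F) hne hF (isClosed_stayIn hF.isClosed)
  have hanti : Antitone (stayIn B F) := antitone_nat_of_succ_le (stayIn_succ_subset F)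
  -- Cantor's intersection theorem gives a point that can stay for every finite time. Some letter
  -- works for infinitely many lengths, hence for all, and so leads to another such point; iterating
  -- gives a trajectory that never leaves.
  have hstep : ∀ x, (∀ k, x ∈ stayIn B F k) → ∃ i, ∀ k, B i *ᵥ x ∈ stayIn B F k := by
    intro x hx
    choose i hi using fun k => Set.mem_iUnion.1 (hx (k + 1)).2
    obtain ⟨i₀, hi₀⟩ : ∃ i₀, ∃ᶠ k in atTop, i k = i₀ := by
      by_contra! hcon
      obtain ⟨k, hk⟩ := (eventually_all.2 hcon).exists
      exact hk (i k) rfl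
    refine ⟨i₀, fun k => ?_⟩
    obtain ⟨l, hkl, hl⟩ := (frequently_atTop.1 hi₀) k
    exact hanti hkl (hl ▸ hi l)
  have : Nonempty (Fin m) := (hstep x₀ fun k => Set.mem_iInter.1 hx₀ k).nonempty
  choose! i hi using hstep
  let x : ℕ → Fin d → ℝ := fun k => Nat.rec x₀ (fun _ y => B (i y) *ᵥ y) k
  have hx : IsTrajectory B (fun k => i (x k)) x := fun k => rfl
  have hmem : ∀ n k, x n ∈ stayIn B F k := by
    intro n
    induction n with
    | zero => exact fun k => Set.mem_iInter.1 hx₀ k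
    | succ n ih => exact hi _ ih
  obtain ⟨k, hk⟩ := h _ _ hx
  exact hk (hmem k 0)

end Uniform

/-! ### Left and right leading eigenvectors, the leading projection and decay off it. -/

section Leading
variable {d : ℕ}

/-- `lam` is an eigenvalue of algebraic multiplicity one with eigenvector `v`. -/
structure IsSimpleEigen (M : Matrix (Fin d) (Fin d) ℂ) (lam : ℂ) (v : Fin d → ℂ) : Prop where
  ne_zero : v ≠ 0
  eigen : M *ᵥ v = lam • v
  simple : ∀ z, (∃ c : ℂ, M *ᵥ z - lam • z = c • v) → ∃ c : ℂ, z = c • v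

/-- Multiplicity one means that the maximal generalised eigenspace is a line. It contains every `z`
with `(M - lam) z` in the eigenline, since the square of `M - lam` kills such `z`. -/
lemma exists_isSimpleEigen {M : Matrix (Fin d) (Fin d) ℂ} {lam : ℂ}
    (h : M.charpoly.rootMultiplicity lam = 1) : ∃ v, IsSimpleEigen M lam v := by
  set φ : Module.End ℂ (Fin d → ℂ) := Matrix.toLin' M
  have hφ : ∀ z, (φ - algebraMap ℂ _ lam) z = M *ᵥ z - lam • z := fun z => by
    simp [φ, Module.algebraMap_end_apply]
  have h1 : Module.finrank ℂ (φ.maxGenEigenspace lam) = 1 := by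
    rw [LinearMap.finrank_maxGenEigenspace_eq, Matrix.charpoly_toLin', h]
  obtain ⟨⟨v, hv⟩, hv0, hspan⟩ := finrank_eq_one_iff'.1 h1
  have hv0' : v ≠ 0 := fun h => hv0 (Subtype.ext h)
  have hspan' : ∀ w ∈ φ.maxGenEigenspace lam, ∃ c : ℂ, w = c • v := fun w hw => by
    obtain ⟨c, hc⟩ := hspan ⟨w, hw⟩
    exact ⟨c, (congrArg Subtype.val hc).symm⟩
  have hmem : ∀ w, w ∈ φ.maxGenEigenspace lam ↔ ∃ k : ℕ, ((φ - algebraMap ℂ _ lam) ^ k) w = 0 :=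
    fun w => Module.End.mem_maxGenEigenspace φ lam w
  have heig : M *ᵥ v = lam • v := by
    obtain ⟨k, hk⟩ := (hmem v).1 hv
    have h2 : (φ - algebraMap ℂ _ lam) v ∈ φ.maxGenEigenspace lam := by
      refine (hmem _).2 ⟨k, ?_⟩
      rw [← Module.End.mul_apply, ← pow_succ, pow_succ', Module.End.mul_apply, hk, map_zero]
    obtain ⟨c, hc⟩ := hspan' _ h2
    have h3 : ∀ k : ℕ, ((φ - algebraMap ℂ _ lam) ^ k) v = c ^ k • v := by
      intro k
      induction k with
      | zero => simp
      | succ k ih =>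
        rw [pow_succ, Module.End.mul_apply, hc, map_smul, ih, smul_smul, pow_succ']
    rw [h3] at hk
    -- `M - lam` acts on the line as a scalar that is also nilpotent.
    have h4 : c = 0 := by
      rcases smul_eq_zero.1 hk with h | h
      · exact eq_zero_of_pow_eq_zero h
      · exact absurd h hv0'
    rw [hφ, h4, zero_smul, sub_eq_zero] at hc
    exact hc
  refine ⟨v, hv0', heig, fun z hz => hspan' z ((hmem z).2 ⟨2, ?_⟩)⟩
  obtain ⟨c, hc⟩ := hz
  rw [pow_two, Module.End.mul_apply, hφ z, hc, map_smul, hφ, heig, sub_self, smul_zero]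

lemma IsSimpleEigen.smul {M : Matrix (Fin d) (Fin d) ℂ} {lam : ℂ} {v : Fin d → ℂ}
    (h : IsSimpleEigen M lam v) {c : ℂ} (hc : c ≠ 0) : IsSimpleEigen (c • M) (c * lam) v := by
  refine ⟨h.ne_zero, by rw [Matrix.smul_mulVec, h.eigen, smul_smul], fun z ⟨b, hb⟩ => ?_⟩
  refine h.simple z ⟨c⁻¹ * b, ?_⟩
  rw [mul_smul, ← hb, Matrix.smul_mulVec, mul_smul, ← smul_sub, smul_smul, inv_mul_cancel₀ hc,
    one_smul]

lemma IsSimpleEigen.of_eigen {M : Matrix (Fin d) (Fin d) ℂ} {lam : ℂ} {v w : Fin d → ℂ}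
    (h : IsSimpleEigen M lam v) (hw : w ≠ 0) (hMw : M *ᵥ w = lam • w) : IsSimpleEigen M lam w := by
  obtain ⟨c, rfl⟩ := h.simple w ⟨0, by rw [hMw]; simp⟩
  have hc : c ≠ 0 := by rintro rfl; simp at hw
  refine ⟨hw, hMw, fun z ⟨b, hb⟩ => ?_⟩
  obtain ⟨e, rfl⟩ := h.simple z ⟨b * c, by rw [hb, smul_smul]⟩
  exact ⟨e * c⁻¹, by rw [smul_smul, mul_assoc, inv_mul_cancel₀ hc, mul_one]⟩

lemma exists_left_eigenvector {M : Matrix (Fin d) (Fin d) ℂ} {lam : ℂ} {v : Fin d → ℂ}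
    (hv : v ≠ 0) (h : M *ᵥ v = lam • v) : ∃ u, u ≠ 0 ∧ u ᵥ* M = lam • u := by
  have h1 : lam ∈ spectrum ℂ M := mem_spectrum_iff_exists.2 ⟨v, hv, h⟩
  have h2 : lam ∈ spectrum ℂ Mᵀ := by
    rw [mem_spectrum_iff_det] at h1 ⊢
    rw [← Matrix.det_transpose, Matrix.transpose_sub, Matrix.transpose_transpose]
    simpa using h1
  obtain ⟨u, hu, hMu⟩ := mem_spectrum_iff_exists.1 h2
  exact ⟨u, hu, by rw [← Matrix.mulVec_transpose, hMu]⟩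

/-- Left and right eigenvectors of a simple eigenvalue are not orthogonal. -/
lemma IsSimpleEigen.dotProduct_ne_zero {M : Matrix (Fin d) (Fin d) ℂ} {lam : ℂ}
    {u v : Fin d → ℂ} (h : IsSimpleEigen M lam v) (hu : u ≠ 0) (huM : u ᵥ* M = lam • u) :
    u ⬝ᵥ v ≠ 0 := by
  intro h0
  set T : (Fin d → ℂ) →ₗ[ℂ] (Fin d → ℂ) := Matrix.toLin' M - lam • LinearMap.id with hT
  have hTz : ∀ z, T z = M *ᵥ z - lam • z := fun z => by simp [hT]
  let L : (Fin d → ℂ) →ₗ[ℂ] ℂ :=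
    { toFun := fun z => u ⬝ᵥ z
      map_add' := dotProduct_add u
      map_smul' := fun c z => dotProduct_smul c u z }
  have hL : ∀ z, L z = u ⬝ᵥ z := fun z => rfl
  have hker : LinearMap.ker T = Submodule.span ℂ {v} := by
    ext z
    rw [LinearMap.mem_ker, hTz, Submodule.mem_span_singleton]
    constructor
    · intro hz
      obtain ⟨c, hc⟩ := h.simple z ⟨0, by simpa using hz⟩
      exact ⟨c, hc.symm⟩
    · rintro ⟨c, rfl⟩
      rw [Matrix.mulVec_smul, h.eigen, smul_comm, sub_self]
  have h1 : Module.finrank ℂ (LinearMap.ker T) = 1 := by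
    rw [hker, finrank_span_singleton h.ne_zero]
  have h2 := T.finrank_range_add_finrank_ker
  have h3 := L.finrank_range_add_finrank_ker
  have hle : LinearMap.range T ≤ LinearMap.ker L := by
    rintro _ ⟨z, rfl⟩
    rw [LinearMap.mem_ker, hL, hTz, dotProduct_sub, Matrix.dotProduct_mulVec, huM,
      smul_dotProduct, dotProduct_smul, sub_self]
  have hLne : L ≠ 0 := by
    intro hL0
    obtain ⟨j, hj⟩ : ∃ j, u j ≠ 0 := Function.ne_iff.1 hu
    have := LinearMap.congr_fun hL0 (Pi.single j 1)
    rw [hL] at this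
    simp at this
    exact hj this
  have h4 : Module.finrank ℂ (LinearMap.range L) = 1 := by
    rw [LinearMap.range_eq_top.2 (LinearMap.surjective hLne), finrank_top, Module.finrank_self]
  -- The range of `M - lam` and the annihilator of `u` are both hyperplanes. If `u ⬝ᵥ v = 0`, then
  -- `v` is in the range of `M - lam`, against simplicity.
  have heq : LinearMap.range T = LinearMap.ker L :=
    Submodule.eq_of_le_of_finrank_eq hle (by omega)
  have hv : v ∈ LinearMap.range T := by
    rw [heq, LinearMap.mem_ker, hL, h0]
  obtain ⟨z, hz⟩ := hv
  rw [hTz] at hz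
  obtain ⟨c, rfl⟩ := h.simple z ⟨1, by rw [hz, one_smul]⟩
  rw [Matrix.mulVec_smul, h.eigen, smul_comm, sub_self] at hz
  exact h.ne_zero hz.symm

/-- The real linear functional with values in `ℂ` given by a complex row vector. -/
noncomputable def rowMap (u : Fin d → ℂ) : (Fin d → ℝ) →ₗ[ℝ] ℂ where
  toFun x := u ⬝ᵥ fun j => (x j : ℂ)
  map_add' x y := by
    simp only [Pi.add_apply, Complex.ofReal_add]
    exact dotProduct_add u (fun j => (x j : ℂ)) (fun j => (y j : ℂ))
  map_smul' c x := by
    simp only [Pi.smul_apply, smul_eq_mul, Complex.ofReal_mul, RingHom.id_apply,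
      Complex.real_smul]
    exact dotProduct_smul (c : ℂ) u (fun j => (x j : ℂ))

/-- The real linear map `ζ ↦ Re (ζ v)`. -/
noncomputable def colMap (v : Fin d → ℂ) : ℂ →ₗ[ℝ] (Fin d → ℝ) where
  toFun ζ := fun j => (ζ * v j).re
  map_add' x y := by ext j; simp [add_mul]
  map_smul' c x := by ext j; simp [mul_assoc]

lemma rowMap_apply (u : Fin d → ℂ) (x : Fin d → ℝ) :
    rowMap u x = u ⬝ᵥ fun j => (x j : ℂ) := rfl

lemma colMap_apply (v : Fin d → ℂ) (ζ : ℂ) (j : Fin d) : colMap v ζ j = (ζ * v j).re := rfl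

lemma rowMap_mulVec {M : Matrix (Fin d) (Fin d) ℝ} {lam : ℂ} {u : Fin d → ℂ}
    (hu : u ᵥ* toC M = lam • u) (x : Fin d → ℝ) : rowMap u (M *ᵥ x) = lam * rowMap u x := by
  rw [rowMap_apply, ← toC_mulVec_ofReal, Matrix.dotProduct_mulVec, hu, smul_dotProduct,
    smul_eq_mul, rowMap_apply]

lemma mulVec_colMap {M : Matrix (Fin d) (Fin d) ℝ} {lam : ℂ} {v : Fin d → ℂ}
    (hv : toC M *ᵥ v = lam • v) (ζ : ℂ) : M *ᵥ colMap v ζ = colMap v (lam * ζ) := by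
  have key : ∀ z : Fin d → ℂ, (M *ᵥ fun j => (z j).re) = fun j => ((toC M *ᵥ z) j).re := by
    intro z
    ext i
    simp [Matrix.mulVec, dotProduct, toC]
  have h1 : (colMap v ζ : Fin d → ℝ) = fun j => ((ζ • v) j).re := rfl
  rw [h1, key, Matrix.mulVec_smul, hv, smul_smul, mul_comm ζ]
  rfl

/-- The real part is half the sum with the conjugate. The second term vanishes when the eigenvalue
is not real and equals the first for real data, which explains the two normalisations of the right
eigenvector in `exists_isLeadingData`. -/
lemma rowMap_colMap (u v : Fin d → ℂ) (ζ : ℂ) : rowMap u (colMap v ζ) =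
    (ζ * (u ⬝ᵥ v) + (starRingEnd ℂ) ζ * (u ⬝ᵥ fun j => (starRingEnd ℂ) (v j))) / 2 := by
  simp only [rowMap_apply, colMap_apply, dotProduct, Finset.mul_sum, ← Finset.sum_add_distrib,
    Finset.sum_div]
  refine Finset.sum_congr rfl fun j _ => ?_
  rw [Complex.re_eq_add_conj, map_mul]
  ring

/-- Spectral data of a real matrix `M` with leading eigenvalue `lam` of modulus one: a left
eigenvector `U`, a right eigenvector `V`, and decay on the complementary invariant subspace. -/
structure IsLeadingData (M : Matrix (Fin d) (Fin d) ℝ) (lam : ℂ) (U : (Fin d → ℝ) →ₗ[ℝ] ℂ)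
    (V : ℂ →ₗ[ℝ] (Fin d → ℝ)) : Prop where
  norm_eq : ‖lam‖ = 1
  map_U : ∀ x, U (M *ᵥ x) = lam * U x
  map_V : ∀ ζ, M *ᵥ V ζ = V (lam * ζ)
  UVU : ∀ x, U (V (U x)) = U x
  U_ne : ∃ x, U x ≠ 0
  decay : ∀ x, Tendsto (fun n : ℕ => (M ^ n) *ᵥ (x - V (U x))) atTop (𝓝 0)
  real : lam.im = 0 → ∀ x, (U x).im = 0
  cplx : lam.im ≠ 0 → ∀ ζ, U (V ζ) = ζ

/-- With `p = V ∘ U` and `N = M (1 - p)`, an eigenvector of `N` for a nonzero eigenvalue is an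
eigenvector of `M` killed by `U`. Neither `lam` nor its conjugate can occur, as `u ⬝ᵥ v ≠ 0`, so the
powers of `N` decay; they agree with those of `M` on the kernel of `U`. -/
lemma decay_of_simple {M : Matrix (Fin d) (Fin d) ℝ} {lam : ℂ} {u v : Fin d → ℂ}
    {V : ℂ →ₗ[ℝ] (Fin d → ℝ)}
    (hs : IsSimpleEigen (toC M) lam v) (huv : u ⬝ᵥ v ≠ 0)
    (hmax : ∀ μ ∈ spectrum ℂ (toC M), μ ≠ lam → μ ≠ (starRingEnd ℂ) lam → ‖μ‖ < 1)
    (hU : ∀ x, rowMap u (M *ᵥ x) = lam * rowMap u x) (hV : ∀ ζ, M *ᵥ V ζ = V (lam * ζ))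
    (hUVU : ∀ x, rowMap u (V (rowMap u x)) = rowMap u x) (x : Fin d → ℝ) :
    Tendsto (fun n : ℕ => (M ^ n) *ᵥ (x - V (rowMap u x))) atTop (𝓝 0) := by
  set U := rowMap u with hUdef
  set p : Matrix (Fin d) (Fin d) ℝ := LinearMap.toMatrix' (V ∘ₗ U) with hp
  have hpx : ∀ y, p *ᵥ y = V (U y) := fun y => by
    rw [hp, ← Matrix.toLin'_apply, Matrix.toLin'_toMatrix']; rfl
  set N := M * (1 - p) with hN
  have hNx : ∀ y, N *ᵥ y = M *ᵥ (y - V (U y)) := fun y => by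
    rw [hN, ← Matrix.mulVec_mulVec, Matrix.sub_mulVec, Matrix.one_mulVec, hpx]
  have hpN : ∀ y, p *ᵥ (N *ᵥ y) = 0 := fun y => by
    rw [hpx, hNx, hU, map_sub, hUVU, sub_self, mul_zero, map_zero]
  have hspec : ∀ μ ∈ spectrum ℂ (toC N), ‖μ‖ < 1 := by
    intro μ hμ
    by_cases hμ0 : μ = 0
    · simp [hμ0]
    obtain ⟨z, hz, hNz⟩ := mem_spectrum_iff_exists.1 hμ
    set a : Fin d → ℝ := fun i => (z i).re with ha
    set b : Fin d → ℝ := fun i => (z i).im with hb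
    have hzab : z = (fun i => (a i : ℂ)) + Complex.I • fun i => (b i : ℂ) := by
      ext i
      simp only [Pi.add_apply, Pi.smul_apply, smul_eq_mul, a, b]
      rw [mul_comm, Complex.re_add_im]
    have hcomp : ∀ K : Matrix (Fin d) (Fin d) ℝ, toC K *ᵥ z =
        (fun i => ((K *ᵥ a) i : ℂ)) + Complex.I • fun i => ((K *ᵥ b) i : ℂ) := by
      intro K
      rw [hzab, Matrix.mulVec_add, Matrix.mulVec_smul, toC_mulVec_ofReal, toC_mulVec_ofReal]
    have hpz : toC p *ᵥ z = 0 := by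
      have h1 : toC p *ᵥ (toC N *ᵥ z) = 0 := by
        rw [Matrix.mulVec_mulVec, ← toC_mul, hcomp,
          ← Matrix.mulVec_mulVec a p N, ← Matrix.mulVec_mulVec b p N, hpN, hpN]
        ext i; simp
      rw [hNz, Matrix.mulVec_smul] at h1
      exact (smul_eq_zero.1 h1).resolve_left hμ0
    have hab : p *ᵥ a = 0 ∧ p *ᵥ b = 0 := by
      rw [hcomp] at hpz
      constructor <;> ext i
      · simpa using congrArg Complex.re (congrFun hpz i)
      · simpa using congrArg Complex.im (congrFun hpz i)
    have hU0 : ∀ y, p *ᵥ y = 0 → U y = 0 := fun y hy => by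
      rw [← hUVU, ← hpx, hy, map_zero]
    have hMz : toC M *ᵥ z = μ • z := by
      rw [← hNz, hcomp, hcomp, hNx, hNx, ← hpx, ← hpx, hab.1, hab.2, sub_zero, sub_zero]
    have hUa := hU0 a hab.1
    have hUb := hU0 b hab.2
    rw [hUdef, rowMap_apply] at hUa hUb
    refine hmax μ (mem_spectrum_iff_exists.2 ⟨z, hz, hMz⟩) ?_ ?_
    · rintro rfl
      obtain ⟨c, hc⟩ := hs.simple z ⟨0, by rw [hMz]; simp⟩
      have h1 : u ⬝ᵥ z = 0 := by
        rw [hzab, dotProduct_add, dotProduct_smul, hUa, hUb]; simp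
      rw [hc, dotProduct_smul, smul_eq_mul] at h1
      have hc0 := (mul_eq_zero.1 h1).resolve_right huv
      exact hz (by rw [hc, hc0, zero_smul])
    · intro hμl
      have hzc : (fun i => (a i : ℂ)) - Complex.I • (fun i => (b i : ℂ)) =
          fun i => (starRingEnd ℂ) (z i) := by
        ext i
        apply Complex.ext <;> simp [a, b]
      set z' : Fin d → ℂ := fun i => (starRingEnd ℂ) (z i) with hz'
      -- Conjugating an eigenvector for the conjugate of `lam` reduces to the previous case.
      have hMz' : toC M *ᵥ z' = lam • z' := by
        ext i
        have h1 := congrArg (starRingEnd ℂ) (congrFun hMz i)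
        rw [hμl] at h1
        simp only [Pi.smul_apply, smul_eq_mul, map_mul, Complex.conj_conj] at h1
        rw [Pi.smul_apply, smul_eq_mul, ← h1]
        simp [Matrix.mulVec, dotProduct, toC, hz']
      obtain ⟨c, hc⟩ := hs.simple z' ⟨0, by rw [hMz']; simp⟩
      have h1 : u ⬝ᵥ z' = 0 := by
        rw [← hzc, dotProduct_sub, dotProduct_smul, hUa, hUb]; simp
      rw [hc, dotProduct_smul, smul_eq_mul] at h1
      have hc0 := (mul_eq_zero.1 h1).resolve_right huv
      rw [hc0, zero_smul] at hc
      refine hz (funext fun i => ?_)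
      simpa [hz'] using congrFun hc i
  set y := x - V (U x) with hy
  have hUy : U y = 0 := by rw [hy, map_sub, hUVU, sub_self]
  have hpow : ∀ n : ℕ, (N ^ n) *ᵥ y = (M ^ n) *ᵥ y ∧ U ((M ^ n) *ᵥ y) = 0 := by
    intro n
    induction n with
    | zero => simp [hUy]
    | succ n ih =>
      have h1 : (M ^ (n + 1)) *ᵥ y = M *ᵥ ((M ^ n) *ᵥ y) := by
        rw [pow_succ', Matrix.mulVec_mulVec]
      have h2 : (N ^ (n + 1)) *ᵥ y = N *ᵥ ((N ^ n) *ᵥ y) := by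
        rw [pow_succ', Matrix.mulVec_mulVec]
      rw [h1, h2, ih.1, hNx, ih.2, map_zero, sub_zero, hU, ih.2, mul_zero]
      exact ⟨rfl, rfl⟩
  refine tendsto_of_toC ?_
  have h : (fun (n : ℕ) (j : Fin d) => (((M ^ n) *ᵥ y) j : ℂ)) =
      fun n => toC N ^ n *ᵥ fun j => (y j : ℂ) := by
    funext n
    rw [← toC_pow, toC_mulVec_ofReal, (hpow n).1]
  rw [h]
  exact tendsto_pow_mulVec hspec _

/-- Real and imaginary parts of the eigenvector both satisfy the equation, and one of them is
nonzero. -/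
lemma exists_real_eigenvector {M : Matrix (Fin d) (Fin d) ℝ} {lam : ℂ} (hr : lam.im = 0)
    {v : Fin d → ℂ} (hv : v ≠ 0) (h : toC M *ᵥ v = lam • v) :
    ∃ w : Fin d → ℝ, w ≠ 0 ∧ M *ᵥ w = lam.re • w := by
  have hl : (lam.re : ℂ) = lam := by apply Complex.ext <;> simp [hr]
  have hre : (M *ᵥ fun j => (v j).re) = lam.re • fun j => (v j).re := by
    ext i
    have := congrArg Complex.re (congrFun h i)
    rw [← hl] at this
    simpa [Matrix.mulVec, dotProduct, toC] using this
  have him : (M *ᵥ fun j => (v j).im) = lam.re • fun j => (v j).im := by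
    ext i
    have := congrArg Complex.im (congrFun h i)
    rw [← hl] at this
    simpa [Matrix.mulVec, dotProduct, toC] using this
  by_cases h0 : (fun j => (v j).re) = 0
  · refine ⟨_, fun h1 => hv (funext fun j => ?_), him⟩
    exact Complex.ext (congrFun h0 j) (congrFun h1 j)
  · exact ⟨_, h0, hre⟩

/-- A matrix with a unique and simple leading eigenvalue of modulus one has spectral data. -/
lemma exists_isLeadingData {M : Matrix (Fin d) (Fin d) ℝ} {lam : ℂ} (hn : ‖lam‖ = 1)
    {v₀ : Fin d → ℂ} (hs₀ : IsSimpleEigen (toC M) lam v₀)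
    (hmax : ∀ μ ∈ spectrum ℂ (toC M), μ ≠ lam → μ ≠ (starRingEnd ℂ) lam → ‖μ‖ < 1) :
    ∃ U V, IsLeadingData M lam U V := by
  obtain ⟨u₀, hu₀, huM₀⟩ := exists_left_eigenvector hs₀.ne_zero hs₀.eigen
  by_cases hr : lam.im = 0
  · have hl : (lam.re : ℂ) = lam := by apply Complex.ext <;> simp [hr]
    obtain ⟨v, hv, hMv⟩ := exists_real_eigenvector hr hs₀.ne_zero hs₀.eigen
    obtain ⟨u, hu, hMu⟩ := exists_real_eigenvector (M := Mᵀ) hr hu₀ (by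
      rw [← huM₀, ← Matrix.mulVec_transpose]; rfl)
    set vc : Fin d → ℂ := fun j => (v j : ℂ)
    set uc : Fin d → ℂ := fun j => (u j : ℂ)
    have hvc0 : vc ≠ 0 := fun h => hv (funext fun j => by simpa [vc] using congrFun h j)
    have huc0 : uc ≠ 0 := fun h => hu (funext fun j => by simpa [uc] using congrFun h j)
    have hs : IsSimpleEigen (toC M) lam vc := hs₀.of_eigen hvc0 (by
      rw [toC_mulVec_ofReal, hMv, ← hl]; ext i; simp [vc])
    have huM : uc ᵥ* toC M = lam • uc := by
      rw [← Matrix.mulVec_transpose]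
      change toC Mᵀ *ᵥ (fun j => (u j : ℂ)) = _
      rw [toC_mulVec_ofReal, hMu, ← hl]; ext i; simp [uc]
    have huv := hs.dotProduct_ne_zero huc0 huM
    set c := uc ⬝ᵥ vc with hc
    have hcr : c.im = 0 := by simp [hc, uc, vc, dotProduct]
    have hcr' : (c.re : ℂ) = c := by apply Complex.ext <;> simp [hcr]
    have hcc : (starRingEnd ℂ) c = c := Complex.conj_eq_iff_im.2 hcr
    set w : Fin d → ℂ := c⁻¹ • vc with hw
    have hMw : toC M *ᵥ w = lam • w := by
      rw [hw, Matrix.mulVec_smul, hs.eigen, smul_comm]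
    have hwr : (fun j => (starRingEnd ℂ) (w j)) = w := by
      ext j
      simp [hw, vc, hcc]
    have huw : uc ⬝ᵥ w = 1 := by
      rw [hw, dotProduct_smul, ← hc, smul_eq_mul, inv_mul_cancel₀ huv]
    have hUre : ∀ x, (rowMap uc x).im = 0 := fun x => by
      simp [rowMap_apply, dotProduct, uc]
    have hUVU : ∀ x, rowMap uc (colMap w (rowMap uc x)) = rowMap uc x := fun x => by
      rw [rowMap_colMap, hwr, huw, Complex.conj_eq_iff_im.2 (hUre x)]
      ring
    refine ⟨rowMap uc, colMap w, hn, rowMap_mulVec huM, mulVec_colMap hMw, hUVU, ?_,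
      decay_of_simple hs huv hmax (rowMap_mulVec huM) (mulVec_colMap hMw) hUVU,
      fun _ => hUre, fun h => absurd hr h⟩
    refine ⟨v, ?_⟩
    exact huv
  · set c := u₀ ⬝ᵥ v₀ with hc
    have huv : c ≠ 0 := hs₀.dotProduct_ne_zero hu₀ huM₀
    set w : Fin d → ℂ := (2 * c⁻¹) • v₀ with hw
    have hMw : toC M *ᵥ w = lam • w := by
      rw [hw, Matrix.mulVec_smul, hs₀.eigen, smul_comm]
    have huw : u₀ ⬝ᵥ w = 2 := by
      rw [hw, dotProduct_smul, ← hc, smul_eq_mul, mul_assoc, inv_mul_cancel₀ huv, mul_one]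
    -- Left and right eigenvectors for the distinct eigenvalues `lam` and its conjugate are
    -- orthogonal; only the first half of `rowMap_colMap` survives, whence the factor 2 in `w`.
    have huw' : (u₀ ⬝ᵥ fun j => (starRingEnd ℂ) (w j)) = 0 := by
      have h1 : toC M *ᵥ (fun j => (starRingEnd ℂ) (w j)) =
          (starRingEnd ℂ) lam • fun j => (starRingEnd ℂ) (w j) := by
        ext i
        have h2 := congrArg (starRingEnd ℂ) (congrFun hMw i)
        simp only [Pi.smul_apply, smul_eq_mul, map_mul] at h2
        rw [Pi.smul_apply, smul_eq_mul, ← h2]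
        simp [Matrix.mulVec, dotProduct, toC]
      have h2 : lam * (u₀ ⬝ᵥ fun j => (starRingEnd ℂ) (w j)) =
          (starRingEnd ℂ) lam * (u₀ ⬝ᵥ fun j => (starRingEnd ℂ) (w j)) := by
        rw [← smul_eq_mul, ← smul_dotProduct, ← huM₀, ← Matrix.dotProduct_mulVec, h1,
          dotProduct_smul, smul_eq_mul]
      rcases mul_eq_mul_right_iff.1 h2 with h | h
      · exact absurd (Complex.conj_eq_iff_im.1 h.symm) hr
      · exact h
    have hUV : ∀ ζ, rowMap u₀ (colMap w ζ) = ζ := fun ζ => by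
      rw [rowMap_colMap, huw, huw']; ring
    refine ⟨rowMap u₀, colMap w, hn, rowMap_mulVec huM₀, mulVec_colMap hMw,
      fun x => hUV _, ⟨colMap w 1, by rw [hUV]; exact one_ne_zero⟩,
      decay_of_simple hs₀ huv hmax (rowMap_mulVec huM₀) (mulVec_colMap hMw) (fun x => hUV _),
      fun h => absurd h hr, fun _ => hUV⟩

end Leading

/-! ### Recurrence and density of powers of a unimodular number. -/

section UnitComplex

/-- By compactness of the circle two powers with distant exponents are close; their quotient is a
high power near 1. -/
lemma exists_pow_near_one {lam : ℂ} (h : ‖lam‖ = 1) :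
    ∃ φ : ℕ → ℕ, (∀ k, k ≤ φ k) ∧ Tendsto (fun k => lam ^ φ k) atTop (𝓝 1) := by
  have hpow : ∀ n : ℕ, ‖lam ^ n‖ = 1 := fun n => by rw [norm_pow, h, one_pow]
  have key : ∀ (N : ℕ) (η : ℝ), 0 < η → ∃ n, N ≤ n ∧ ‖lam ^ n - 1‖ < η := by
    intro N η hη
    obtain ⟨z, -, ψ, hψ, hz⟩ := (isCompact_sphere (0 : ℂ) 1).tendsto_subseq
      (x := fun n => lam ^ n) (fun n => by simp [h])
    obtain ⟨K, hK⟩ := Metric.cauchySeq_iff.1 hz.cauchySeq η hη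
    have h1 := hK (K + N) (by omega) K le_rfl
    have h2 : ψ K + N ≤ ψ (K + N) := by
      rw [add_comm, add_comm K]; exact hψ.add_le_nat N K
    refine ⟨ψ (K + N) - ψ K, by omega, ?_⟩
    have h3 : lam ^ ψ (K + N) = lam ^ ψ K * lam ^ (ψ (K + N) - ψ K) := by
      rw [← pow_add]; congr 1; omega
    simp only [Function.comp_apply] at h1
    rw [h3, dist_eq_norm, ← mul_sub_one, norm_mul, hpow, one_mul] at h1
    exact h1
  choose φ h1 h2 using fun k : ℕ => key k (1 / ((k : ℝ) + 1)) (by positivity)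
  refine ⟨φ, h1, ?_⟩
  rw [tendsto_iff_norm_sub_tendsto_zero]
  exact squeeze_zero (fun k => norm_nonneg _) (fun k => (h2 k).le)
    tendsto_one_div_add_atTop_nhds_zero_nat

/-- The powers of a unimodular number whose argument is an irrational multiple of `π` are dense
in the unit circle. -/
lemma mem_closure_pow_of_irrational {lam : ℂ} (h : ‖lam‖ = 1)
    (hirr : Irrational (lam.arg / Real.pi)) {ω : ℂ} (hω : ‖ω‖ = 1) :
    ω ∈ closure (Set.range fun n : ℕ => lam ^ n) := by
  have hpow : ∀ n : ℕ, ‖lam ^ n‖ = 1 := fun n => by rw [norm_pow, h, one_pow]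
  have hirr' : Irrational (lam.arg / (2 * Real.pi)) := by
    have h1 : lam.arg / (2 * Real.pi) = lam.arg / Real.pi / (2 : ℕ) := by
      push_cast
      rw [div_div, mul_comm]
    rw [h1]
    exact hirr.div_natCast two_ne_zero
  have hdense := dense_addSubgroupClosure_pair_iff.2 hirr'
  have hlam : Complex.exp (lam.arg * Complex.I) = lam := by
    have := Complex.norm_mul_exp_arg_mul_I lam
    rwa [h, Complex.ofReal_one, one_mul] at this
  have hωe : Complex.exp (ω.arg * Complex.I) = ω := by
    have := Complex.norm_mul_exp_arg_mul_I ω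
    rwa [hω, Complex.ofReal_one, one_mul] at this
  obtain ⟨φ, hφ, hφ1⟩ := exists_pow_near_one h
  rw [Metric.mem_closure_iff]
  intro η hη
  have hc : Continuous fun t : ℝ => Complex.exp (t * Complex.I) := by fun_prop
  obtain ⟨x, hx1, hx2⟩ := hdense.exists_mem_open
    (Metric.isOpen_ball.preimage hc : IsOpen ((fun t : ℝ => Complex.exp (t * Complex.I)) ⁻¹'
      Metric.ball ω (η / 2))) ⟨ω.arg, by
        rw [Set.mem_preimage, hωe]; exact Metric.mem_ball_self (half_pos hη)⟩
  obtain ⟨k, l, rfl⟩ := AddSubgroup.mem_closure_pair.1 hx1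
  have hexp : Complex.exp (((k • lam.arg + l • (2 * Real.pi) : ℝ) : ℂ) * Complex.I) = lam ^ k := by
    have h2 : ((k • lam.arg + l • (2 * Real.pi) : ℝ) : ℂ) * Complex.I =
        k * (lam.arg * Complex.I) + l * (2 * Real.pi * Complex.I) := by
      push_cast [zsmul_eq_mul]; ring
    rw [h2, Complex.exp_add, Complex.exp_int_mul, hlam, Complex.exp_int_mul_two_pi_mul_I, mul_one]
  rw [Set.mem_preimage, hexp, Metric.mem_ball] at hx2
  have h3 : ∀ᶠ N in atTop, ‖lam ^ φ N - 1‖ < η / 2 := by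
    have := (tendsto_iff_norm_sub_tendsto_zero.1 hφ1).eventually (gt_mem_nhds (half_pos hη))
    exact this
  obtain ⟨N, hN, hNk⟩ := (h3.and (eventually_ge_atTop k.natAbs)).exists
  have hk : 0 ≤ k + (φ N : ℤ) := by have := hφ N; omega
  -- Density of the generated group allows negative exponents `k`; multiplying by a high power of
  -- `lam` near 1 makes the exponent nonnegative.
  refine ⟨lam ^ (k + (φ N : ℤ)).toNat, ⟨_, rfl⟩, ?_⟩
  have hlam0 : lam ≠ 0 := by rintro rfl; simp at h
  have h4 : lam ^ (k + (φ N : ℤ)).toNat = lam ^ k * lam ^ φ N := by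
    rw [← zpow_natCast, Int.toNat_of_nonneg hk, zpow_add₀ hlam0, zpow_natCast]
  have h5 : ‖lam ^ k‖ = 1 := by rw [norm_zpow, h, one_zpow]
  rw [dist_comm, h4]
  calc dist (lam ^ k * lam ^ φ N) ω ≤ dist (lam ^ k * lam ^ φ N) (lam ^ k) + dist (lam ^ k) ω :=
        dist_triangle _ _ _
    _ < η / 2 + η / 2 := by
        refine add_lt_add ?_ hx2
        rw [dist_eq_norm, ← mul_sub_one, norm_mul, h5, one_mul]
        exact hN
    _ = η := add_halves η

end UnitComplex

/-! ### Attraction to the leading subspace and the finite formula for Barabanov norms. -/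

section Core
variable {d m : ℕ} {B : Fin m → Matrix (Fin d) (Fin d) ℝ} {P : List (Fin m)} {r : ℝ} {lam : ℂ}
  {U : (Fin d → ℝ) →ₗ[ℝ] ℂ} {V : ℂ →ₗ[ℝ] (Fin d → ℝ)}

namespace IsLeadingData
variable {M : Matrix (Fin d) (Fin d) ℝ} (hL : IsLeadingData M lam U V)
include hL

lemma map_U_pow (n : ℕ) (x : Fin d → ℝ) : U ((M ^ n) *ᵥ x) = lam ^ n * U x := by
  induction n with
  | zero => simp
  | succ n ih => rw [pow_succ', ← Matrix.mulVec_mulVec, hL.map_U, ih, pow_succ']; ring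

lemma map_V_pow (n : ℕ) (ζ : ℂ) : (M ^ n) *ᵥ V ζ = V (lam ^ n * ζ) := by
  induction n generalizing ζ with
  | zero => simp
  | succ n ih => rw [pow_succ, ← Matrix.mulVec_mulVec, hL.map_V, ih, pow_succ, mul_assoc]

lemma pow_sub (n : ℕ) (x : Fin d → ℝ) :
    (M ^ n) *ᵥ x - V (U ((M ^ n) *ᵥ x)) = (M ^ n) *ᵥ (x - V (U x)) := by
  rw [Matrix.mulVec_sub, hL.map_V_pow, hL.map_U_pow]

/-- The projection onto the leading subspace, followed by multiplication by `ω`. -/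
noncomputable def _root_.Barabanov.projMatrix (U : (Fin d → ℝ) →ₗ[ℝ] ℂ)
    (V : ℂ →ₗ[ℝ] (Fin d → ℝ)) (ω : ℂ) : Matrix (Fin d) (Fin d) ℝ :=
  LinearMap.toMatrix' (V ∘ₗ LinearMap.mulLeft ℝ ω ∘ₗ U)

omit hL in
lemma _root_.Barabanov.projMatrix_mulVec (ω : ℂ) (x : Fin d → ℝ) :
    projMatrix U V ω *ᵥ x = V (ω * U x) := by
  rw [projMatrix, ← Matrix.toLin'_apply, Matrix.toLin'_toMatrix']; rfl

omit hL in
lemma _root_.Barabanov.tendsto_matrix_of_mulVec {ι : Type*} {l : Filter ι}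
    {W : ι → Matrix (Fin d) (Fin d) ℝ}
    (h : ∀ x, Tendsto (fun k => W k *ᵥ x) l (𝓝 (M *ᵥ x))) : Tendsto W l (𝓝 M) := by
  refine tendsto_pi_nhds.2 fun i => tendsto_pi_nhds.2 fun j => ?_
  have h1 := tendsto_pi_nhds.1 (h (Pi.single j 1)) i
  simpa [Matrix.mulVec_single_one, Matrix.col_apply] using h1

omit hL in
lemma _root_.Barabanov.tendsto_projMatrix {ι : Type*} {l : Filter ι} {c : ι → ℂ} {ω : ℂ}
    (hc : Tendsto c l (𝓝 ω)) : Tendsto (fun k => projMatrix U V (c k)) l (𝓝 (projMatrix U V ω)) := by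
  refine tendsto_matrix_of_mulVec fun x => ?_
  simp_rw [projMatrix_mulVec]
  exact ((LinearMap.continuous_of_finiteDimensional V).tendsto _).comp (hc.mul_const _)

lemma projMatrix_mul_pow (ω : ℂ) (n : ℕ) :
    projMatrix U V ω * M ^ n = projMatrix U V (ω * lam ^ n) := by
  refine Matrix.ext_of_mulVec_single fun j => ?_
  rw [← Matrix.mulVec_mulVec, projMatrix_mulVec, projMatrix_mulVec, hL.map_U_pow, mul_assoc]

/-- On the leading subspace `M` multiplies the coordinate by `lam`, and on the complement its powers
decay. -/
lemma tendsto_pow_of_tendsto {φ : ℕ → ℕ} (hφ : ∀ k, k ≤ φ k)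
    (h : Tendsto (fun k => lam ^ φ k) atTop (𝓝 1)) :
    Tendsto (fun k => M ^ φ k) atTop (𝓝 (projMatrix U V 1)) := by
  refine tendsto_matrix_of_mulVec fun x => ?_
  have h1 : ∀ k, (M ^ φ k) *ᵥ x = (M ^ φ k) *ᵥ (x - V (U x)) + projMatrix U V (lam ^ φ k) *ᵥ x := by
    intro k
    rw [projMatrix_mulVec, Matrix.mulVec_sub, hL.map_V_pow, sub_add_cancel]
  simp_rw [h1]
  rw [← zero_add (projMatrix U V 1 *ᵥ x)]
  refine Tendsto.add ((hL.decay x).comp (tendsto_atTop_mono hφ tendsto_id)) ?_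
  exact tendsto_mulVec (tendsto_projMatrix h) tendsto_const_nhds

end IsLeadingData

/-- A normalised irreducible family with a dominant product `P` whose leading eigenvalue is unique
and simple. -/
structure IsDominantFamily (B : Fin m → Matrix (Fin d) (Fin d) ℝ) (P : List (Fin m)) (r : ℝ)
    (lam : ℂ) (U : (Fin d → ℝ) →ₗ[ℝ] ℂ) (V : ℂ →ₗ[ℝ] (Fin d → ℝ)) : Prop where
  irreducible : IsIrreducible B
  ne_nil : P ≠ []
  nonneg : 0 ≤ r
  lt_one : r < 1
  barabanov : ∃ g, IsUnitBarabanov B g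
  gap : ∀ w, w ≠ [] → ¬ IsRotPow P w → EigLE (wordProd B w) r
  lead : IsLeadingData (wordProd B P) lam U V

lemma IsUnitBarabanov.exists_bound {g : (Fin d → ℝ) → ℝ} (hg : IsUnitBarabanov B g) :
    ∃ C : ℝ, 0 < C ∧ ∀ w x, ‖wordProd B w *ᵥ x‖ ≤ C * ‖x‖ := by
  obtain ⟨C, hC, h1⟩ := hg.isNorm.exists_norm_le
  obtain ⟨D, hD, h2⟩ := hg.isNorm.isSeminorm.exists_le_norm
  refine ⟨C * D, by positivity, fun w x => (h1 _).trans ?_⟩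
  rw [mul_assoc]
  exact mul_le_mul_of_nonneg_left ((hg.wordProd_le w x).trans (h2 x)) hC.le

namespace IsDominantFamily
variable (hB : IsDominantFamily B P r lam U V)
include hB

/-- Such a trajectory is eventually driven by `P`, whose powers kill the component off the leading
subspace. -/
lemma exists_near {g : (Fin d → ℝ) → ℝ} (hg : IsUnitBarabanov B g)
    {s : ℕ → Fin m} {x : ℕ → Fin d → ℝ} (h : IsTrajectory B s x) (hx : ∀ k, g (x k) = 1)
    {δ : ℝ} (hδ : 0 < δ) : ∃ k, g (x k - V (U (x k))) < δ := by
  obtain ⟨K, hK⟩ := h.exists_eq_pow hg hx hB.lt_one hB.ne_nil hB.gap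
  have h1 := (hg.isNorm.continuous.tendsto _).comp (hB.lead.decay (x K))
  rw [hg.isNorm.isSeminorm.map_zero] at h1
  obtain ⟨n, hn⟩ := (h1.eventually (gt_mem_nhds hδ)).exists
  refine ⟨K + n * P.length, ?_⟩
  rw [hK, hB.lead.pow_sub]
  exact hn

/-- The unit vectors at distance at least `δ` from their projections form a compact set in which, by
`exists_near`, no trajectory stays forever; `exists_stayIn_eq_empty` bounds the time spent there. -/
lemma exists_near_uniform {g : (Fin d → ℝ) → ℝ} (hg : IsUnitBarabanov B g) {δ : ℝ} (hδ : 0 < δ) :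
    ∃ K : ℕ, ∀ x, g x = 1 → ∃ w : List (Fin m), w.length ≤ K ∧ g (wordProd B w *ᵥ x) = 1 ∧
      g (wordProd B w *ᵥ x - V (U (wordProd B w *ᵥ x))) < δ := by
  have hc : Continuous fun x => g (x - V (U x)) := hg.isNorm.continuous.comp
    (continuous_id.sub ((LinearMap.continuous_of_finiteDimensional V).comp
      (LinearMap.continuous_of_finiteDimensional U)))
  have hF : IsCompact ({x | g x = 1} ∩ {x | δ ≤ g (x - V (U x))}) :=
    hg.isNorm.isCompact_sphere.inter_right (isClosed_le continuous_const hc)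
  obtain ⟨K, hK⟩ := exists_stayIn_eq_empty (B := B) hF (by
    intro s x hx
    by_contra! hall
    obtain ⟨k, hk⟩ := hB.exists_near hg hx (fun k => (hall k).1) hδ
    exact absurd (hall k).2 (not_le.2 hk))
  refine ⟨K, fun x hx => ?_⟩
  obtain ⟨s, y, hy, rfl, hy1⟩ := hg.exists_trajectory x
  by_contra! hcon
  have : y 0 ∈ stayIn B ({x | g x = 1} ∩ {x | δ ≤ g (x - V (U x))}) K := by
    refine exists_iterate_mem hy K fun j hj => ⟨(hy1 j).trans hx, ?_⟩
    have h1 := hy.eq_wordProd 0 j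
    rw [zero_add] at h1
    have h2 := hcon (seg s 0 j) (by simpa using hj)
    rw [← h1] at h2
    exact h2 ((hy1 j).trans hx)
  rw [hK] at this
  exact this

/-- Formula for a Barabanov norm that is a multiple of the modulus on the leading subspace. -/
lemma eq_orbitSup {g : (Fin d → ℝ) → ℝ} (hg : IsUnitBarabanov B g) {c : ℝ} (hc : 0 < c)
    (h : ∀ x, g (V (U x)) = c * ‖U x‖) (x : Fin d → ℝ) :
    g x = c * orbitSup B (fun y => ‖U y‖) x := by
  have hgs := hg.isNorm.isSeminorm
  -- Powers of `P` preserve `‖U z‖`, do not increase `g`, and push `z` to the leading subspace,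
  -- where `g` is `c` times the modulus.
  have hle : ∀ z, c * ‖U z‖ ≤ g z := by
    intro z
    have hpow : ∀ n : ℕ, c * ‖U z‖ ≤ g z + g ((wordProd B P ^ n) *ᵥ (z - V (U z))) := by
      intro n
      have h1 : ‖U ((wordProd B P ^ n) *ᵥ z)‖ = ‖U z‖ := by
        rw [hB.lead.map_U_pow, norm_mul, norm_pow, hB.lead.norm_eq, one_pow, one_mul]
      have h2 := h ((wordProd B P ^ n) *ᵥ z)
      rw [h1] at h2
      rw [← h2, ← hB.lead.pow_sub, hgs.map_sub_rev]
      refine (hgs.le_add_sub _ ((wordProd B P ^ n) *ᵥ z)).trans ?_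
      have h3 := hg.wordProd_le (wordPow P n) z
      rw [wordProd_wordPow] at h3
      linarith
    have hlim := ((hg.isNorm.continuous.tendsto _).comp (hB.lead.decay z)).const_add (g z)
    rw [hgs.map_zero, add_zero] at hlim
    exact ge_of_tendsto' hlim hpow
  have hn : ∀ w, ‖U (wordProd B w *ᵥ x)‖ ≤ g x / c := fun w => by
    rw [le_div_iff₀ hc, mul_comm]
    exact (hle _).trans (hg.wordProd_le w x)
  apply le_antisymm
  · rcases eq_or_ne x 0 with rfl | hx
    · rw [hgs.map_zero]
      exact mul_nonneg hc.le (Real.iSup_nonneg fun _ => norm_nonneg _)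
    -- Conversely, some word keeps `g x` and moves `x` within `δ` of the leading subspace.
    refine le_of_forall_pos_le_add fun δ hδ => ?_
    have hgx := hg.isNorm.pos_of_ne hx
    obtain ⟨K, hK⟩ := hB.exists_near_uniform hg (div_pos hδ hgx)
    obtain ⟨w, -, hw1, hw2⟩ := hK ((g x)⁻¹ • x) (by
      rw [hgs.smul, abs_of_pos (inv_pos.2 hgx), inv_mul_cancel₀ hgx.ne'])
    rw [Matrix.mulVec_smul, map_smul, map_smul, ← smul_sub, hgs.smul, abs_of_pos (inv_pos.2 hgx),
      inv_mul_lt_iff₀ hgx, mul_div_cancel₀ _ hgx.ne'] at hw2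
    rw [Matrix.mulVec_smul, hgs.smul, abs_of_pos (inv_pos.2 hgx), inv_mul_eq_one₀ hgx.ne'] at hw1
    calc g x = g (wordProd B w *ᵥ x) := hw1
      _ ≤ g (V (U (wordProd B w *ᵥ x))) + δ := (hgs.le_add_sub _ _).trans (by linarith)
      _ ≤ _ := by
        rw [h]
        refine add_le_add_left (mul_le_mul_of_nonneg_left ?_ hc.le) _
        exact le_ciSup (f := fun w => ‖U (wordProd B w *ᵥ x)‖)
          ⟨g x / c, by rintro _ ⟨w, rfl⟩; exact hn w⟩ w
  · rw [mul_comm, ← le_div_iff₀ hc]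
    exact ciSup_le hn

section Finite
variable {n : (Fin d → ℝ) → ℝ} {θ : ℝ}

/-- A seminorm on the leading subspace that is invariant under the dominant product and strictly
contracted by all other products. -/
structure _root_.Barabanov.IsContracted (B : Fin m → Matrix (Fin d) (Fin d) ℝ)
    (P : List (Fin m)) (U : (Fin d → ℝ) →ₗ[ℝ] ℂ) (V : ℂ →ₗ[ℝ] (Fin d → ℝ))
    (n : (Fin d → ℝ) → ℝ) (θ : ℝ) : Prop where
  isSeminorm : IsSeminorm n
  nonneg : 0 ≤ θ
  lt_one : θ < 1
  map_P : ∀ x, n (wordProd B P *ᵥ x) = n x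
  map_VU : ∀ x, n (V (U x)) = n x
  contract : ∀ w, (∀ k, w ≠ wordPow P k) → ∀ x, n (wordProd B w *ᵥ V (U x)) ≤ θ * n x
  ne_zero : ∃ x, n x ≠ 0

/-- A nonempty word factors through its first letter, so the supremum passes to the best letter. The
empty word is the only exception, and it gives the same value as `P` because `P` preserves `n`. -/
lemma isUnitBarabanov_orbitSup (hn : IsContracted B P U V n θ) :
    IsUnitBarabanov B (orbitSup B n) := by
  obtain ⟨g, hg⟩ := hB.barabanov
  have hb := hg.exists_bound
  have hs := isSeminorm_orbitSup hn.isSeminorm hb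
  have hle := orbitSup_le hn.isSeminorm hb
  have hnorm := hs.isNorm_of_irreducible hB.irreducible hle (by
    obtain ⟨x, hx⟩ := hn.ne_zero
    refine ⟨x, fun h0 => hx ?_⟩
    have := le_orbitSup_self hn.isSeminorm hb x
    exact le_antisymm (by linarith) (hn.isSeminorm.nonneg x))
  refine ⟨hnorm, fun x => ⟨?_, ?_⟩⟩
  · obtain ⟨i₀, w₀, hP⟩ := List.exists_cons_of_ne_nil hB.ne_nil
    have : Nonempty (Fin m) := ⟨i₀⟩
    obtain ⟨i, hi⟩ := Finite.exists_max fun i => orbitSup B n (B i *ᵥ x)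
    have hcons : ∀ j w, n (wordProd B (j :: w) *ᵥ x) ≤ orbitSup B n (B i *ᵥ x) := by
      intro j w
      rw [wordProd_cons, ← Matrix.mulVec_mulVec]
      exact (le_orbitSup hn.isSeminorm hb _ _).trans (hi j)
    refine ⟨i, le_antisymm (hle i x) (ciSup_le fun w => ?_)⟩
    cases w with
    | nil =>
      rw [wordProd_nil, Matrix.one_mulVec, ← hn.map_P, hP]
      exact hcons _ _
    | cons j w => exact hcons j w
  · rintro _ ⟨i, rfl⟩
    exact hle i x

omit hB in
lemma _root_.Barabanov.IsContracted.map_wordPow (hn : IsContracted B P U V n θ) (k : ℕ)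
    (x : Fin d → ℝ) : n (wordProd B (wordPow P k) *ᵥ x) = n x := by
  induction k with
  | zero => simp
  | succ k ih =>
    rw [wordPow_succ', wordProd_append, ← Matrix.mulVec_mulVec, hn.map_P, ih]

/-- On the leading subspace powers of `P` preserve `n` and all other words shrink it. -/
lemma orbitSup_VU (hn : IsContracted B P U V n θ) (x : Fin d → ℝ) :
    orbitSup B n (V (U x)) = n x := by
  obtain ⟨g, hg⟩ := hB.barabanov
  apply le_antisymm
  · refine ciSup_le fun w => ?_
    by_cases hw : ∃ k, w = wordPow P k
    · obtain ⟨k, rfl⟩ := hw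
      rw [hn.map_wordPow, hn.map_VU]
    · push Not at hw
      have := hn.isSeminorm.nonneg x
      nlinarith [hn.contract w hw x, hn.lt_one]
  · have := le_orbitSup_self hn.isSeminorm hg.exists_bound (V (U x))
    rwa [hn.map_VU] at this

/-- The supremum over all products is a maximum over products of bounded length. -/
theorem exists_length_le_orbitSup_eq (hn : IsContracted B P U V n θ) :
    ∃ K : ℕ, ∀ x, ∃ w : List (Fin m), w.length ≤ K ∧ orbitSup B n x = n (wordProd B w *ᵥ x) := by
  obtain ⟨g, hg⟩ := hB.barabanov
  have hb := hg.exists_bound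
  have hh := hB.isUnitBarabanov_orbitSup hn
  set h := orbitSup B n with hdef
  have hhs := hh.isNorm.isSeminorm
  have hθ := hn.lt_one
  obtain ⟨K, hK⟩ := hB.exists_near_uniform hh (δ := (1 - θ) / 2) (by linarith)
  -- Within `(1 - θ) / 2` of the leading subspace a word that is not a power of `P` yields at most
  -- `θ + (1 - θ) / 2 < 1`. The value 1 must come from powers of `P`, which all give `n x`.
  have hnear : ∀ x, h x = 1 → h (x - V (U x)) < (1 - θ) / 2 → n x = 1 := by
    intro x hx1 hx2
    have hnx : n x ≤ 1 := hx1 ▸ le_orbitSup_self hn.isSeminorm hb x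
    by_contra hne
    have hlt : n x < 1 := lt_of_le_of_ne hnx hne
    have hsup : h x ≤ max (n x) ((1 + θ) / 2) := by
      refine ciSup_le fun w => ?_
      by_cases hw : ∃ k, w = wordPow P k
      · obtain ⟨k, rfl⟩ := hw
        rw [hn.map_wordPow]
        exact le_max_left _ _
      · push Not at hw
        refine le_trans ?_ (le_max_right _ _)
        have h1 := hn.contract w hw x
        have h2 := hn.isSeminorm.le_add_sub (wordProd B w *ᵥ x) (wordProd B w *ᵥ V (U x))
        rw [← Matrix.mulVec_sub] at h2
        have h3 := le_orbitSup hn.isSeminorm hb w (x - V (U x))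
        have h4 : θ * n x ≤ θ := by nlinarith [hn.nonneg]
        linarith
    rw [hx1] at hsup
    exact absurd hsup (not_le.2 (max_lt hlt (by linarith)))
  refine ⟨K, fun x => ?_⟩
  rcases eq_or_ne x 0 with rfl | hx
  · exact ⟨[], by simp, by simp [hhs.map_zero, hn.isSeminorm.map_zero]⟩
  have hpos := hh.isNorm.pos_of_ne hx
  obtain ⟨w, hwK, hw1, hw2⟩ := hK ((h x)⁻¹ • x) (by
    rw [hhs.smul, abs_of_pos (inv_pos.2 hpos), inv_mul_cancel₀ hpos.ne'])
  have h1 := hnear _ hw1 hw2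
  rw [Matrix.mulVec_smul, hn.isSeminorm.smul, abs_of_pos (inv_pos.2 hpos),
    inv_mul_eq_one₀ hpos.ne'] at h1
  exact ⟨w, hwK, h1⟩

end Finite

/-- Products with the leading projections inherit the spectral gap. -/
lemma eigLE_projMatrix {w : List (Fin m)} (hw : ∀ k, w ≠ wordPow P k) {ω : ℂ}
    (hω : ω ∈ closure (Set.range fun n : ℕ => lam ^ n)) :
    EigLE (projMatrix U V ω * wordProd B w * projMatrix U V 1) r := by
  have hPl : 0 < P.length := List.length_pos_of_ne_nil hB.ne_nil
  have hword : ∀ k l, EigLE (wordProd B P ^ l * wordProd B w * wordProd B P ^ (k + 1)) r := by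
    intro k l
    rw [← wordProd_wordPow, ← wordProd_wordPow, mul_assoc, ← wordProd_append, ← wordProd_append]
    refine hB.gap _ (by simp [wordPow_succ, hB.ne_nil]) ?_
    rintro ⟨Q, hQ, j, hj⟩
    have hlen : Q.length = P.length := hQ.perm.length_eq.symm
    cases j with
    | zero => simp [wordPow_succ, hB.ne_nil] at hj
    | succ j =>
      rw [wordPow_succ, wordPow_succ, List.append_assoc, List.append_assoc] at hj
      -- The word begins with `P`, so the cyclic permutation in question is `P` itself; cancelling
      -- powers of `P` on both sides would make `w` a power of `P`.
      obtain ⟨h1, h2⟩ := List.append_inj hj hlen.symm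
      subst h1
      have h4 : k + l ≤ j := by
        have := congrArg List.length h2
        simp only [List.length_append, length_wordPow] at this
        by_contra! hlt
        have : (j + 1) * P.length ≤ (k + l) * P.length := Nat.mul_le_mul_right _ hlt
        nlinarith
      obtain ⟨e, rfl⟩ := Nat.exists_eq_add_of_le h4
      rw [show k + l + e = k + (e + l) by ring, wordPow_add, wordPow_add] at h2
      exact hw e (List.append_cancel_right (List.append_cancel_left h2))
  obtain ⟨φ, hφ, hφ1⟩ := exists_pow_near_one hB.lead.norm_eq
  have hφ' : ∀ k, k + 1 ≤ φ (k + 1) := fun k => hφ (k + 1)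
  -- The shift to `φ (k + 1)` keeps the exponent positive, so that the approximating words begin
  -- with `P`.
  have h1 := hB.lead.tendsto_pow_of_tendsto (φ := fun k => φ (k + 1))
    (fun k => (Nat.le_succ k).trans (hφ' k)) ((tendsto_add_atTop_iff_nat 1).2 hφ1)
  have h2 : ∀ l, EigLE (projMatrix U V (lam ^ l) * wordProd B w * projMatrix U V 1) r := by
    intro l
    have h3 : projMatrix U V (lam ^ l) = projMatrix U V 1 * wordProd B P ^ l := by
      rw [hB.lead.projMatrix_mul_pow, one_mul]
    rw [h3]
    refine (isClosed_eigLE r).mem_of_tendsto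
      (((h1.mul_const (wordProd B P ^ l)).mul_const (wordProd B w)).mul h1)
      (Eventually.of_forall fun k => ?_)
    obtain ⟨j, hj⟩ := Nat.exists_eq_add_of_le' (hφ' k)
    have h4 := hword (φ (k + 1) - 1) (φ (k + 1) + l)
    rw [pow_add (wordProd B P) (φ (k + 1)) l, Nat.sub_add_cancel (by omega)] at h4
    exact h4
  obtain ⟨c, hc, hclim⟩ := mem_closure_iff_seq_limit.1 hω
  refine (isClosed_eigLE r).mem_of_tendsto
    (((tendsto_projMatrix hclim).mul_const (wordProd B w)).mul_const (projMatrix U V 1))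
    (Eventually.of_forall fun k => ?_)
  obtain ⟨l, hl⟩ := hc k
  simp only at hl
  rw [← hl]
  exact h2 l

end IsDominantFamily
end Core

/-! ### Combinatorics of primitive words. -/

section Words
variable {m : ℕ}

/-- Euclid's algorithm on the lengths: the shorter word is a prefix of the longer, and what remains
still commutes with it. -/
lemma exists_wordPow_of_append_comm (x y : List (Fin m)) (h : x ++ y = y ++ x) :
    ∃ u a b, x = wordPow u a ∧ y = wordPow u b := by
  induction hn : x.length + y.length using Nat.strong_induction_on generalizing x y with
  | _ n ih =>
    subst hn
    rcases eq_or_ne x [] with rfl | hx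
    · exact ⟨y, 0, 1, by simp, by simp⟩
    rcases eq_or_ne y [] with rfl | hy
    · exact ⟨x, 1, 0, by simp, by simp⟩
    have hx' := List.length_pos_of_ne_nil hx
    have hy' := List.length_pos_of_ne_nil hy
    rcases List.append_eq_append_iff.1 h with ⟨z, h1, h2⟩ | ⟨z, h1, h2⟩
    · subst h1
      have h3 : x ++ z = z ++ x := by simpa using h
      obtain ⟨u, a, b, ha, hb⟩ := ih _ (by simp; omega) x z h3 rfl
      refine ⟨u, a, a + b, ha, ?_⟩
      rw [wordPow_add, ← ha, ← hb]
    · subst h1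
      have h3 : z ++ y = y ++ z := by simpa using h
      obtain ⟨u, a, b, ha, hb⟩ := ih _ (by simp; omega) z y h3 rfl
      refine ⟨u, b + a, b, ?_, hb⟩
      rw [wordPow_add, ← ha, ← hb]

/-- A primitive word occurs in its own powers only at the obvious positions. -/
lemma exists_eq_wordPow_of_append {P : List (Fin m)} (hP : IsPrimitiveWord P) {n : ℕ}
    (hn : 2 ≤ n) (w v : List (Fin m)) (j : ℕ) (h : w ++ (wordPow P n ++ v) = wordPow P j) :
    ∃ k, w = wordPow P k := by
  obtain ⟨n, rfl⟩ := Nat.exists_eq_add_of_le hn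
  have hPl := List.length_pos_of_ne_nil hP.1
  induction hl : w.length using Nat.strong_induction_on generalizing w j with
  | _ l ih =>
    subst hl
    have hlen := congrArg List.length h
    simp only [List.length_append, length_wordPow] at hlen
    -- Two copies of `P` on the left force at least two on the right.
    obtain ⟨j, rfl⟩ : ∃ i, j = i + 2 := by
      refine ⟨j - 2, ?_⟩
      have : 2 ≤ j := by
        by_contra! hlt
        have : j * P.length ≤ 1 * P.length := Nat.mul_le_mul_right _ (by omega)
        nlinarith [Nat.zero_le (n * P.length)]
      omega
    rcases le_or_gt P.length w.length with hle | hlt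
    · have h1 : w = P ++ w.drop P.length := by
        have h2 := congrArg (List.take P.length) h
        rw [List.take_append_of_le_length hle, wordPow_succ, List.take_left' rfl] at h2
        conv_lhs => rw [← List.take_append_drop P.length w, h2]
      rw [h1, wordPow_succ, List.append_assoc] at h
      obtain ⟨k, hk⟩ := ih _ (by rw [List.length_drop]; omega) _ _
        (List.append_cancel_left h) rfl
      exact ⟨k + 1, by rw [wordPow_succ, ← hk, ← h1]⟩
    · have h1 : P = w ++ P.drop w.length := by
        have h2 := congrArg (List.take w.length) h
        rw [List.take_left' rfl, wordPow_succ, List.take_append_of_le_length hlt.le] at h2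
        conv_lhs => rw [← List.take_append_drop w.length P, ← h2]
      set y := P.drop w.length with hy
      -- For `|w| < |P|` write `P = w y`. Comparing the occurrence of `P` after `w` with the second
      -- period gives `P = y w`, so `w` and `y` commute and have a common root; primitivity then
      -- forces `w` to be empty.
      have h3 : P = y ++ w := by
        have h4 : w ++ (P ++ (wordPow P (1 + n) ++ v)) = w ++ (y ++ (w ++ (y ++ wordPow P j))) := by
          have h5 : wordPow P (2 + n) = P ++ wordPow P (1 + n) := by
            rw [← wordPow_succ]; congr 1; omega
          rw [h5, wordPow_succ P (j + 1), wordPow_succ P j] at h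
          rw [← List.append_assoc P, h]
          calc P ++ (P ++ wordPow P j) = (w ++ y) ++ ((w ++ y) ++ wordPow P j) := by rw [← h1]
            _ = _ := by simp only [List.append_assoc]
        have h6 := List.append_cancel_left h4
        rw [← List.append_assoc y] at h6
        refine (List.append_inj h6 ?_).1
        have := congrArg List.length h1
        rw [List.length_append] at this ⊢
        omega
      obtain ⟨u, a, b, ha, hb⟩ := exists_wordPow_of_append_comm w y (h1.symm.trans h3)
      rcases eq_or_ne w [] with hw | hw
      · exact ⟨0, by simp [hw]⟩
      exfalso
      refine hP.2 u (a + b) ?_ (by rw [wordPow_add, ← ha, ← hb]; exact h1)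
      have ha' := congrArg List.length ha
      rw [length_wordPow] at ha'
      have hw' := List.length_pos_of_ne_nil hw
      have : a ≠ 0 := by rintro rfl; omega
      have : u.length ≤ a * u.length := Nat.le_mul_of_pos_left _ (Nat.pos_of_ne_zero this)
      omega

end Words

/-! ### Uniform contraction in compact matrix semigroups. -/

lemma EigLE.abs_le {d : ℕ} {M : Matrix (Fin d) (Fin d) ℝ} {r : ℝ} (hM : EigLE M r)
    {x : Fin d → ℝ} (hx : x ≠ 0) {c : ℝ} (h : M *ᵥ x = c • x) : |c| ≤ r := by
  have h1 : (c : ℂ) ∈ spectrum ℂ (toC M) := by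
    refine mem_spectrum_iff_exists.2 ⟨fun j => (x j : ℂ), fun h0 => hx ?_, ?_⟩
    · ext j
      simpa using congrFun h0 j
    · rw [toC_mulVec_ofReal, h]
      ext j
      simp
  simpa using hM _ h1

lemma isSeminorm_iSup_norm {d : ℕ} {ι : Type*} [Finite ι] [Nonempty ι]
    (t : ι → (Fin d → ℝ) →ₗ[ℝ] ℂ) : IsSeminorm fun x => ⨆ j, ‖t j x‖ := by
  have hle : ∀ j x, ‖t j x‖ ≤ ⨆ j, ‖t j x‖ := fun j x =>
    le_ciSup (f := fun j => ‖t j x‖) (Set.finite_range _).bddAbove j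
  refine ⟨fun x => Real.iSup_nonneg fun _ => norm_nonneg _, fun c x => ?_, fun x y => ?_⟩
  · rw [Real.mul_iSup_of_nonneg (abs_nonneg c)]
    simp_rw [map_smul, norm_smul, Real.norm_eq_abs]
  · refine ciSup_le fun j => ?_
    rw [map_add]
    exact (norm_add_le _ _).trans (add_le_add (hle j x) (hle j y))

/-- In a compact semigroup of contractions without nonzero fixed vectors, long products are
uniformly small. -/
lemma exists_pow_contract {d : ℕ} {K : Set (Matrix (Fin d) (Fin d) ℝ)} (hK : IsCompact K)
    (hmul : ∀ M ∈ K, ∀ N ∈ K, M * N ∈ K) (hfix : ∀ M ∈ K, ∀ x, M *ᵥ x = x → x = 0)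
    {g : (Fin d → ℝ) → ℝ} (hg : IsNorm g) (hgK : ∀ M ∈ K, ∀ x, g (M *ᵥ x) ≤ g x) :
    ∃ R : ℕ, ∀ N ∈ K ^ R, ∀ x, g (N *ᵥ x) ≤ 1 / 2 * g x := by
  have hgs := hg.isSeminorm
  -- Absence of nonzero fixed vectors becomes quantitative: `δ` is the minimum of `g (M x - x)` over
  -- `K` and the unit sphere, unless that product is empty.
  obtain ⟨δ, hδ, hδK⟩ : ∃ δ, 0 < δ ∧ ∀ M ∈ K, ∀ x, δ * g x ≤ g (M *ᵥ x - x) := by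
    rcases (K ×ˢ {x | g x = 1}).eq_empty_or_nonempty with he | hne
    · refine ⟨1, one_pos, fun M hM x => ?_⟩
      rcases eq_or_ne x 0 with rfl | hx
      · simp [hgs.map_zero]
      · exfalso
        have hpos := hg.pos_of_ne hx
        have : (M, (g x)⁻¹ • x) ∈ K ×ˢ {x | g x = 1} := ⟨hM, by
          rw [Set.mem_ofPred_eq, hgs.smul, abs_of_pos (inv_pos.2 hpos),
            inv_mul_cancel₀ hpos.ne']⟩
        rw [he] at this
        exact this
    · have hc : Continuous fun p : Matrix (Fin d) (Fin d) ℝ × (Fin d → ℝ) =>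
          g (p.1 *ᵥ p.2 - p.2) := hg.continuous.comp (by fun_prop)
      obtain ⟨⟨M₀, x₀⟩, ⟨hM₀, hx₀⟩, hmin⟩ :=
        (hK.prod hg.isCompact_sphere).exists_isMinOn hne hc.continuousOn
      have hx₀0 : x₀ ≠ 0 := by
        rintro rfl
        simp only [Set.mem_ofPred_eq, hgs.map_zero] at hx₀
        exact zero_ne_one hx₀
      refine ⟨g (M₀ *ᵥ x₀ - x₀), hg.pos_of_ne fun h0 => hx₀0 (hfix M₀ hM₀ _ (sub_eq_zero.1 h0)),
        fun M hM x => ?_⟩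
      rcases eq_or_ne x 0 with rfl | hx
      · simp [hgs.map_zero]
      have hpos := hg.pos_of_ne hx
      have h1 : (M, (g x)⁻¹ • x) ∈ K ×ˢ {x | g x = 1} := ⟨hM, by
        rw [Set.mem_ofPred_eq, hgs.smul, abs_of_pos (inv_pos.2 hpos), inv_mul_cancel₀ hpos.ne']⟩
      have h2 := hmin h1
      simp only [Set.mem_ofPred_eq] at h2
      rwa [Matrix.mulVec_smul, ← smul_sub, hgs.smul, abs_of_pos (inv_pos.2 hpos),
        ← div_eq_inv_mul, le_div_iff₀ hpos] at h2
  obtain ⟨T, hT⟩ : ∃ T : Finset (Fin d → ℝ), ∀ x, g x = 1 ∨ g x ≤ 1 →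
      ∃ c ∈ T, g (x - c) < δ / 4 := by
    have hball : IsCompact {x | g x ≤ 1} := by
      obtain ⟨C, hC, h⟩ := hg.exists_norm_le
      refine Metric.isCompact_of_isClosed_isBounded (isClosed_le hg.continuous continuous_const)
        (isBounded_iff_forall_norm_le.2 ⟨C, fun x hx => ?_⟩)
      rw [Set.mem_ofPred_eq] at hx
      nlinarith [h x]
    obtain ⟨T, hT⟩ := hball.elim_finite_subcover (fun c : Fin d → ℝ => {x | g (x - c) < δ / 4})
      (fun c => isOpen_lt (hg.continuous.comp (by fun_prop)) continuous_const) (fun x _ =>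
        Set.mem_iUnion.2 ⟨x, by
          rw [Set.mem_ofPred_eq, sub_self, hgs.map_zero]; positivity⟩)
    refine ⟨T, fun x hx => ?_⟩
    obtain ⟨c, hc, hxc⟩ := Set.mem_iUnion₂.1 (hT (show x ∈ {x | g x ≤ 1} from
      hx.elim (fun h => h.le) id))
    exact ⟨c, hc, hxc⟩
  refine ⟨T.card, fun N hN x => ?_⟩
  rcases eq_or_ne x 0 with rfl | hx
  · simp [hgs.map_zero]
  have hpos := hg.pos_of_ne hx
  suffices hunit : ∀ x, g x = 1 → g (N *ᵥ x) ≤ 1 / 2 by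
    have := hunit ((g x)⁻¹ • x) (by
      rw [hgs.smul, abs_of_pos (inv_pos.2 hpos), inv_mul_cancel₀ hpos.ne'])
    rwa [Matrix.mulVec_smul, hgs.smul, abs_of_pos (inv_pos.2 hpos), inv_mul_le_iff₀ hpos,
      mul_comm] at this
  clear hx hpos x
  intro x hx
  by_contra! hlt
  obtain ⟨f, hf⟩ := Set.mem_pow.1 hN
  set L : List (Matrix (Fin d) (Fin d) ℝ) := List.ofFn fun i => (f i : Matrix (Fin d) (Fin d) ℝ)
    with hLdef
  have hLK : ∀ M ∈ L, M ∈ K := by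
    intro M hM
    obtain ⟨i, rfl⟩ := (List.mem_ofFn' _ _).1 hM
    exact (f i).2
  have hLlen : L.length = T.card := by simp [hLdef]
  have hprod : ∀ l : List (Matrix (Fin d) (Fin d) ℝ), (∀ M ∈ l, M ∈ K) → l ≠ [] → l.prod ∈ K := by
    intro l
    induction l with
    | nil => intro _ h; exact absurd rfl h
    | cons M l ih =>
      intro h _
      rcases eq_or_ne l [] with rfl | hl
      · simpa using h M (by simp)
      · rw [List.prod_cons]
        exact hmul M (h M (by simp)) _ (ih (fun M hM => h M (by simp [hM])) hl)
  have hprod_le : ∀ l : List (Matrix (Fin d) (Fin d) ℝ), (∀ M ∈ l, M ∈ K) →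
      ∀ y, g (l.prod *ᵥ y) ≤ g y := by
    intro l hl y
    rcases eq_or_ne l [] with rfl | hne
    · simp
    · exact hgK _ (hprod l hl hne) y
  -- If the image stays larger than 1/2, so do all partial images `y k`, with `k` from 0 to
  -- `T.card`. Two of them share a point of the `δ/4`-net, hence differ by less than `δ/2`; but the
  -- earlier index is the image of the later under an element of `K`, so they differ by more than
  -- `δ/2`.
  set y : ℕ → Fin d → ℝ := fun k => (L.drop k).prod *ᵥ x with hy
  have hsplit : ∀ k, N *ᵥ x = (L.take k).prod *ᵥ y k := by
    intro k
    rw [hy, Matrix.mulVec_mulVec, ← List.prod_append, List.take_append_drop, hf]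
  have hy1 : ∀ k, g (y k) ≤ 1 := fun k => by
    rw [← hx]
    exact hprod_le _ (fun M hM => hLK M (List.mem_of_mem_drop hM)) x
  have hy2 : ∀ k, 1 / 2 < g (y k) := fun k => by
    rw [hsplit k] at hlt
    exact hlt.trans_le (hprod_le _ (fun M hM => hLK M (List.mem_of_mem_take hM)) _)
  choose c hcT hc using fun k => hT (y k) (Or.inr (hy1 k))
  obtain ⟨i, hi, j, hj, hij, hcij⟩ := Finset.exists_ne_map_eq_of_card_lt_of_maps_to
    (s := Finset.range (T.card + 1)) (t := T) (by simp) (f := c) (fun k _ => hcT k)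
  wlog hlt' : i < j generalizing i j
  · exact this j hj i hi hij.symm hcij.symm (by omega)
  have hj' : j ≤ T.card := by simpa [Nat.lt_succ_iff] using hj
  have h1 : y i = ((L.drop i).take (j - i)).prod *ᵥ y j := by
    have h2 : L.drop j = (L.drop i).drop (j - i) := by
      rw [List.drop_drop]; congr 1; omega
    simp only [hy]
    rw [Matrix.mulVec_mulVec, h2, ← List.prod_append, List.take_append_drop]
  have h2 : ((L.drop i).take (j - i)).prod ∈ K := by
    refine hprod _ (fun M hM => hLK M (List.mem_of_mem_drop (List.mem_of_mem_take hM))) ?_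
    rw [← List.length_pos_iff_ne_nil]
    simp only [List.length_take, List.length_drop]
    omega
  have h3 := hδK _ h2 (y j)
  rw [← h1] at h3
  have h4 : g (y i - y j) ≤ g (y i - c i) + g (y j - c j) := by
    rw [← hgs.map_sub_rev (c j), ← hcij]
    have := hgs.add_le (y i - c i) (c i - y j)
    rwa [sub_add_sub_cancel] at this
  nlinarith [hc i, hc j, hy2 j]


/-! ### Real and irrational cases: the modulus is contracted, and norms on the leading subspace are
rigid. -/

section Contracted
variable {d m : ℕ} {B : Fin m → Matrix (Fin d) (Fin d) ℝ} {P : List (Fin m)} {r : ℝ} {lam : ℂ}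
  {U : (Fin d → ℝ) →ₗ[ℝ] ℂ} {V : ℂ →ₗ[ℝ] (Fin d → ℝ)}

namespace IsDominantFamily
variable (hB : IsDominantFamily B P r lam U V)
include hB

lemma norm_eq_one_of_mem_closure {ω : ℂ} (hω : ω ∈ closure (Set.range fun n : ℕ => lam ^ n)) :
    ‖ω‖ = 1 := by
  have hcl : IsClosed {z : ℂ | ‖z‖ = 1} := isClosed_eq continuous_norm continuous_const
  refine closure_minimal ?_ hcl hω
  rintro _ ⟨n, rfl⟩
  rw [Set.mem_ofPred_eq, norm_pow, hB.lead.norm_eq, one_pow]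

/-- If the rotations by powers of the leading eigenvalue act transitively on the circles of the
leading subspace, then the modulus is a contracted seminorm. -/
lemma isContracted_norm (htrans : ∀ x y, U x ≠ 0 → ∃ ω ∈ closure (Set.range fun n : ℕ => lam ^ n),
      ∃ t : ℝ, ω * U y = t * U x) :
    IsContracted B P U V (fun x => ‖U x‖) r where
  isSeminorm := ⟨fun x => norm_nonneg _, fun c x => by
    rw [map_smul, norm_smul, Real.norm_eq_abs], fun x y => by
    rw [map_add]; exact norm_add_le _ _⟩
  nonneg := hB.nonneg
  lt_one := hB.lt_one
  map_P x := by rw [hB.lead.map_U, norm_mul, hB.lead.norm_eq, one_mul]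
  map_VU x := by rw [hB.lead.UVU]
  ne_zero := by
    obtain ⟨x, hx⟩ := hB.lead.U_ne
    exact ⟨x, norm_ne_zero_iff.2 hx⟩
  contract w hw x := by
    rcases eq_or_ne (U x) 0 with h0 | h0
    · simp [h0]
    -- After rotation by `ω` the compressed product maps `V (U x)` to `t` times itself, so `|t|` is
    -- bounded by the gap.
    obtain ⟨ω, hω, t, ht⟩ := htrans x (wordProd B w *ᵥ V (U x)) h0
    have h1 := hB.eigLE_projMatrix hw hω
    have h2 : (projMatrix U V ω * wordProd B w * projMatrix U V 1) *ᵥ V (U x) =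
        t • V (U x) := by
      rw [← Matrix.mulVec_mulVec, ← Matrix.mulVec_mulVec, projMatrix_mulVec, projMatrix_mulVec,
        one_mul, hB.lead.UVU, ht, ← Complex.real_smul, map_smul]
    have h3 : V (U x) ≠ 0 := fun h => h0 (by rw [← hB.lead.UVU, h, map_zero])
    have h4 := h1.abs_le h3 h2
    have h5 : ‖U (wordProd B w *ᵥ V (U x))‖ = |t| * ‖U x‖ := by
      have := congrArg norm ht
      rwa [norm_mul, hB.norm_eq_one_of_mem_closure hω, one_mul, norm_mul, Complex.norm_real,
        Real.norm_eq_abs] at this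
    rw [h5]
    exact mul_le_mul_of_nonneg_right h4 (norm_nonneg _)

lemma isContracted_of_real (h : lam.im = 0) : IsContracted B P U V (fun x => ‖U x‖) r := by
  refine hB.isContracted_norm fun x y hx => ⟨1, subset_closure ⟨0, by simp⟩,
    (U y).re / (U x).re, ?_⟩
  have hx' : ((U x).re : ℂ) = U x := by apply Complex.ext <;> simp [hB.lead.real h x]
  have hy' : ((U y).re : ℂ) = U y := by apply Complex.ext <;> simp [hB.lead.real h y]
  rw [Complex.ofReal_div, hx', hy', one_mul, div_mul_cancel₀ _ hx]

lemma isContracted_of_irrational (h : Irrational (lam.arg / Real.pi)) :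
    IsContracted B P U V (fun x => ‖U x‖) r := by
  refine hB.isContracted_norm fun x y hx => ?_
  rcases eq_or_ne (U y) 0 with hy | hy
  · exact ⟨1, subset_closure ⟨0, by simp⟩, 0, by simp [hy]⟩
  have hx' : (‖U x‖ : ℂ) ≠ 0 := by exact_mod_cast norm_ne_zero_iff.2 hx
  refine ⟨(‖U y‖ / ‖U x‖ : ℝ) * U x / U y, mem_closure_pow_of_irrational hB.lead.norm_eq h ?_,
    ‖U y‖ / ‖U x‖, ?_⟩
  · rw [norm_div, norm_mul, Complex.norm_real, Real.norm_of_nonneg (by positivity),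
      div_mul_cancel₀ _ (norm_ne_zero_iff.2 hx), div_self (norm_ne_zero_iff.2 hy)]
  · rw [div_mul_cancel₀ _ hy]

/-- On the leading subspace a Barabanov norm is a multiple of the modulus if the leading eigenvalue
is real. -/
lemma exists_eq_norm_of_real (h : lam.im = 0) {g : (Fin d → ℝ) → ℝ} (hg : IsUnitBarabanov B g) :
    ∃ c : ℝ, 0 < c ∧ ∀ x, g (V (U x)) = c * ‖U x‖ := by
  have hV : ∀ x, V (U x) = (U x).re • V 1 := fun x => by
    have hx' : U x = (U x).re • (1 : ℂ) := by
      apply Complex.ext <;> simp [hB.lead.real h x]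
    conv_lhs => rw [hx']
    rw [map_smul]
  have hnorm : ∀ x, ‖U x‖ = |(U x).re| := fun x => by
    have hx' : U x = ((U x).re : ℂ) := by apply Complex.ext <;> simp [hB.lead.real h x]
    conv_lhs => rw [hx']
    rw [Complex.norm_real, Real.norm_eq_abs]
  refine ⟨g (V 1), hg.isNorm.pos_of_ne fun h0 => ?_, fun x => ?_⟩
  · obtain ⟨x, hx⟩ := hB.lead.U_ne
    have := hB.lead.UVU x
    rw [hV, h0, smul_zero, map_zero] at this
    exact hx this.symm
  · rw [hV, hg.isNorm.smul, hnorm, mul_comm]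

/-- On the leading subspace a Barabanov norm is a multiple of the modulus if the argument of the
leading eigenvalue is an irrational multiple of `π`. -/
lemma exists_eq_norm_of_irrational (him : lam.im ≠ 0) (h : Irrational (lam.arg / Real.pi))
    {g : (Fin d → ℝ) → ℝ} (hg : IsUnitBarabanov B g) :
    ∃ c : ℝ, 0 < c ∧ ∀ x, g (V (U x)) = c * ‖U x‖ := by
  have hgc := hg.isNorm.continuous.comp (LinearMap.continuous_of_finiteDimensional V)
  have hpow : ∀ (n : ℕ) ζ, g (V (lam ^ n * ζ)) ≤ g (V ζ) := fun n ζ => by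
    rw [← hB.lead.map_V_pow, ← wordProd_wordPow]
    exact hg.wordProd_le _ _
  -- Powers of `P` do not increase `g`, and by density neither does any rotation of the plane;
  -- inverse rotations turn this into equality.
  have hle : ∀ ω : ℂ, ‖ω‖ = 1 → ∀ ζ, g (V (ω * ζ)) ≤ g (V ζ) := by
    intro ω hω ζ
    obtain ⟨c, hc, hclim⟩ := mem_closure_iff_seq_limit.1
      (mem_closure_pow_of_irrational hB.lead.norm_eq h hω)
    refine le_of_tendsto' ((hgc.tendsto _).comp (hclim.mul_const ζ)) fun k => ?_
    obtain ⟨n, hn⟩ := hc k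
    simp only [Function.comp_apply]
    rw [← hn]
    exact hpow n ζ
  have hUV := hB.lead.cplx him
  refine ⟨g (V 1), hg.isNorm.pos_of_ne fun h0 => ?_, fun x => ?_⟩
  · have := hUV 1
    rw [h0, map_zero] at this
    exact zero_ne_one this
  rcases eq_or_ne (U x) 0 with h0 | h0
  · rw [h0, map_zero, hg.isNorm.isSeminorm.map_zero, norm_zero, mul_zero]
  have hn := norm_ne_zero_iff.2 h0
  have hn' : (‖U x‖ : ℂ) ≠ 0 := by exact_mod_cast hn
  have hV : g (V (‖U x‖ : ℂ)) = g (V 1) * ‖U x‖ := by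
    have : (‖U x‖ : ℂ) = ‖U x‖ • (1 : ℂ) := by simp
    rw [this, map_smul, hg.isNorm.smul, abs_of_nonneg (norm_nonneg _), mul_comm]
  rw [← hV]
  apply le_antisymm
  · have := hle (U x / ‖U x‖) (by
      rw [norm_div, Complex.norm_real, norm_norm, div_self hn]) (‖U x‖ : ℂ)
    rwa [div_mul_cancel₀ _ hn'] at this
  · have := hle (‖U x‖ / U x) (by
      rw [norm_div, Complex.norm_real, norm_norm, div_self hn]) (U x)
    rwa [div_mul_cancel₀ _ h0] at this

end IsDominantFamily

lemma exists_pow_eq_one_of_not_irrational {lam : ℂ} (hn : ‖lam‖ = 1)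
    (h : ¬ Irrational (lam.arg / Real.pi)) : ∃ N : ℕ, 0 < N ∧ lam ^ N = 1 := by
  rw [irrational_iff_ne_rational] at h
  push Not at h
  obtain ⟨a, b, hb, hab⟩ := h
  have hlam : Complex.exp (lam.arg * Complex.I) = lam := by
    have := Complex.norm_mul_exp_arg_mul_I lam
    rwa [hn, Complex.ofReal_one, one_mul] at this
  have h1 : lam ^ (2 * b) = 1 := by
    have hb' : (b : ℝ) ≠ 0 := by exact_mod_cast hb
    have h2 : lam.arg * b = a * Real.pi := by
      field_simp at hab
      linarith
    have h3 : (lam.arg : ℂ) * b = a * Real.pi := by exact_mod_cast h2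
    rw [← hlam, ← Complex.exp_int_mul, ← Complex.exp_int_mul_two_pi_mul_I a]
    congr 1
    push_cast
    linear_combination 2 * Complex.I * h3
  refine ⟨(2 * b).natAbs, by omega, ?_⟩
  rcases Int.natAbs_eq (2 * b) with h2 | h2
  · rw [h2, zpow_natCast] at h1
    exact h1
  · rw [h2, zpow_neg, zpow_natCast, inv_eq_one] at h1
    exact h1

/-- A small multiple of the identity makes a real linear map of the plane injective. -/
lemma exists_small_add_injective (T : ℂ →ₗ[ℝ] ℂ) {e : ℝ} (he : 0 < e) :
    ∃ κ : ℝ, 0 < κ ∧ κ < e ∧ ∀ ζ, T ζ + κ * ζ = 0 → ζ = 0 := by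
  set α : ℂ := (T 1 - Complex.I * T Complex.I) / 2
  set β : ℂ := (T 1 + Complex.I * T Complex.I) / 2
  have hT : ∀ ζ, T ζ = α * ζ + β * (starRingEnd ℂ) ζ := by
    intro ζ
    have h1 : ζ = ζ.re • (1 : ℂ) + ζ.im • Complex.I := by
      apply Complex.ext <;> simp
    conv_lhs => rw [h1, map_add, map_smul, map_smul]
    have h2 : (starRingEnd ℂ) ζ = ζ.re - ζ.im * Complex.I := by
      apply Complex.ext <;> simp
    have h3 : ζ = ζ.re + ζ.im * Complex.I := (Complex.re_add_im ζ).symm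
    rw [h2]
    conv_rhs => rw [h3]
    simp only [α, β, Complex.real_smul]
    simp only [Complex.add_re, Complex.add_im, Complex.ofReal_re, Complex.mul_re, Complex.I_re,
      Complex.mul_im, Complex.I_im, Complex.ofReal_im, mul_zero, mul_one, sub_zero, zero_add,
      add_zero]
    linear_combination ((ζ.im : ℂ) * T Complex.I) * Complex.I_sq
  -- With `T ζ = α ζ + β ζ̄`, a nontrivial kernel forces `|α + κ| = |β|`, a quadratic equation in
  -- `κ`; it cannot hold for three different values.
  have hbad : ∀ κ : ℝ, (∃ ζ, T ζ + κ * ζ = 0 ∧ ζ ≠ 0) →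
      (α.re + κ) ^ 2 + α.im ^ 2 = Complex.normSq β := by
    rintro κ ⟨ζ, h0, hζ⟩
    have h1 : (α + κ) * ζ = -(β * (starRingEnd ℂ) ζ) := by
      rw [hT] at h0
      linear_combination h0
    have h2 := congrArg Complex.normSq h1
    rw [Complex.normSq_neg, Complex.normSq_mul, Complex.normSq_mul, Complex.normSq_conj] at h2
    have h3 := mul_right_cancel₀ (by simpa using hζ) h2
    rw [← h3, Complex.normSq_apply]
    simp
    ring
  by_contra! hcon
  have h1 := hbad (e / 2) (hcon _ (by linarith) (by linarith))
  have h2 := hbad (e / 3) (hcon _ (by linarith) (by linarith))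
  have h3 := hbad (e / 4) (hcon _ (by linarith) (by linarith))
  have h4 : (e / 6) * (2 * α.re + 5 * e / 6) = 0 := by linear_combination h1 - h2
  have h5 : (e / 12) * (2 * α.re + 7 * e / 12) = 0 := by linear_combination h2 - h3
  have h6 := (mul_eq_zero.1 h4).resolve_left (by positivity)
  have h7 := (mul_eq_zero.1 h5).resolve_left (by positivity)
  linarith

end Contracted

/-! ### Rational angle: an adapted finite maximum of moduli on the leading plane. -/

section Rational
variable {d m : ℕ} {B : Fin m → Matrix (Fin d) (Fin d) ℝ} {P : List (Fin m)} {r : ℝ} {lam : ℂ}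
  {U : (Fin d → ℝ) →ₗ[ℝ] ℂ} {V : ℂ →ₗ[ℝ] (Fin d → ℝ)}

/-- The closure of the products outside the powers of `P`, compressed to the leading subspace. -/
noncomputable def compressedSet (B : Fin m → Matrix (Fin d) (Fin d) ℝ) (P : List (Fin m))
    (U : (Fin d → ℝ) →ₗ[ℝ] ℂ) (V : ℂ →ₗ[ℝ] (Fin d → ℝ)) : Set (Matrix (Fin d) (Fin d) ℝ) :=
  closure {M | ∃ w, (∀ k, w ≠ wordPow P k) ∧
    M = projMatrix U V 1 * wordProd B w * projMatrix U V 1}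

/-- The functional `θ⁻¹ ^ l • U ∘ N`. -/
noncomputable def scaledMap (U : (Fin d → ℝ) →ₗ[ℝ] ℂ) (θ : ℝ) (l : ℕ)
    (N : Matrix (Fin d) (Fin d) ℝ) : (Fin d → ℝ) →ₗ[ℝ] ℂ :=
  θ⁻¹ ^ l • (U ∘ₗ N.mulVecLin)

lemma scaledMap_apply (θ : ℝ) (l : ℕ) (N : Matrix (Fin d) (Fin d) ℝ) (x : Fin d → ℝ) :
    scaledMap U θ l N x = θ⁻¹ ^ l • U (N *ᵥ x) := rfl

namespace IsDominantFamily
variable (hB : IsDominantFamily B P r lam U V)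
include hB

lemma projMatrix_one_mul_self :
    projMatrix U V 1 * projMatrix U V 1 = projMatrix U V 1 := by
  refine Matrix.ext_of_mulVec_single fun j => ?_
  rw [← Matrix.mulVec_mulVec, projMatrix_mulVec, projMatrix_mulVec, one_mul, one_mul, hB.lead.UVU]

lemma projMatrix_comm :
    wordProd B P * projMatrix U V 1 = projMatrix U V 1 * wordProd B P := by
  refine Matrix.ext_of_mulVec_single fun j => ?_
  rw [← Matrix.mulVec_mulVec, ← Matrix.mulVec_mulVec, projMatrix_mulVec, projMatrix_mulVec,
    one_mul, one_mul, hB.lead.map_V, hB.lead.map_U]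

/-- The bound `2 ≤ φ k` is what `exists_eq_wordPow_of_append` requires. -/
lemma exists_tendsto_projMatrix : ∃ φ : ℕ → ℕ, (∀ k, 2 ≤ φ k) ∧
    Tendsto (fun k => wordProd B P ^ φ k) atTop (𝓝 (projMatrix U V 1)) := by
  obtain ⟨φ, hφ, hφ1⟩ := exists_pow_near_one hB.lead.norm_eq
  refine ⟨fun k => φ (k + 2), fun k => ?_, ?_⟩
  · change 2 ≤ φ (k + 2)
    have := hφ (k + 2)
    omega
  · exact hB.lead.tendsto_pow_of_tendsto (φ := fun k => φ (k + 2))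
      (fun k => by have := hφ (k + 2); omega) ((tendsto_add_atTop_iff_nat 2).2 hφ1)

/-- The inner projection in a product of two compressions is a limit of powers of `P`, so the
product is a limit of compressions of `w₁ P^k w₂`. By primitivity such a word is a power of `P` only
if `w₁` is. -/
lemma compressedSet_mul (hprim : IsPrimitiveWord P) :
    ∀ M ∈ compressedSet B P U V, ∀ N ∈ compressedSet B P U V, M * N ∈ compressedSet B P U V := by
  intro M hM N hN
  have h := map_mem_closure₂ (u := compressedSet B P U V)
    (f := fun M N : Matrix (Fin d) (Fin d) ℝ => M * N) (by fun_prop) hM hN ?_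
  · rwa [compressedSet, closure_closure] at h
  rintro _ ⟨w₂, hw₂, rfl⟩ _ ⟨w₁, hw₁, rfl⟩
  obtain ⟨φ, hφ, hlim⟩ := hB.exists_tendsto_projMatrix
  set p := projMatrix U V 1
  have h1 : p * wordProd B w₂ * p * (p * wordProd B w₁ * p) =
      p * wordProd B w₂ * p * wordProd B w₁ * p := by
    have := hB.projMatrix_one_mul_self
    calc _ = p * wordProd B w₂ * (p * p) * wordProd B w₁ * p := by simp only [mul_assoc]
      _ = _ := by rw [this]
  rw [h1]
  refine mem_closure_of_tendsto
    (((hlim.const_mul (p * wordProd B w₂)).mul_const (wordProd B w₁)).mul_const p)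
    (Eventually.of_forall fun k => ⟨w₁ ++ (wordPow P (φ k) ++ w₂), fun j hj => ?_, ?_⟩)
  · obtain ⟨k', hk'⟩ := exists_eq_wordPow_of_append hprim (hφ k) w₁ w₂ j hj
    exact hw₁ k' hk'
  · rw [wordProd_append, wordProd_append, wordProd_wordPow]
    simp only [mul_assoc, p]

/-- `P` commutes with the projection, and prefixing `P` creates no power of `P`. This is what makes
the adapted seminorm nonincreasing along `P`. -/
lemma compressedSet_mul_P : ∀ M ∈ compressedSet B P U V,
    M * wordProd B P ∈ compressedSet B P U V := by
  intro M hM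
  refine map_mem_closure (f := fun M => M * wordProd B P) (by fun_prop) hM ?_
  rintro _ ⟨w, hw, rfl⟩
  refine ⟨P ++ w, fun k hk => ?_, ?_⟩
  · cases k with
    | zero => simp [hB.ne_nil] at hk
    | succ k => exact hw k (List.append_cancel_left (hk.trans (wordPow_succ P k)))
  · simp only
    rw [wordProd_append, mul_assoc, ← hB.projMatrix_comm]
    simp only [mul_assoc]

lemma compressedSet_mul_proj : ∀ M ∈ compressedSet B P U V, M * projMatrix U V 1 = M := by
  intro M hM
  have hcl : IsClosed {M : Matrix (Fin d) (Fin d) ℝ | M * projMatrix U V 1 = M} :=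
    isClosed_eq (by fun_prop) continuous_id
  refine closure_minimal ?_ hcl hM
  rintro _ ⟨w, -, rfl⟩
  rw [Set.mem_ofPred_eq, mul_assoc, hB.projMatrix_one_mul_self]

/-- The spectral bound `r < 1` of `eigLE_projMatrix` survives the closure and excludes the
eigenvalue 1. -/
lemma compressedSet_fixed : ∀ M ∈ compressedSet B P U V, ∀ x, M *ᵥ x = x → x = 0 := by
  intro M hM x hx
  have h1 : EigLE M r := by
    refine closure_minimal ?_ (isClosed_eigLE r) hM
    rintro _ ⟨w, hw, rfl⟩
    exact hB.eigLE_projMatrix hw (subset_closure ⟨0, by simp⟩)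
  by_contra hne
  exact absurd (h1.one_le hne hx) (not_le.2 hB.lt_one)

lemma compressedSet_le {g : (Fin d → ℝ) → ℝ} (hg : IsUnitBarabanov B g) :
    ∀ M ∈ compressedSet B P U V, ∀ x, g (M *ᵥ x) ≤ g x := by
  obtain ⟨φ, -, hlim⟩ := hB.exists_tendsto_projMatrix
  have hp : ∀ x, g (projMatrix U V 1 *ᵥ x) ≤ g x := fun x => by
    refine le_of_tendsto' ((hg.isNorm.continuous.tendsto _).comp
      (tendsto_mulVec hlim tendsto_const_nhds)) fun k => ?_
    have := hg.wordProd_le (wordPow P (φ k)) x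
    rwa [wordProd_wordPow] at this
  intro M hM
  refine closure_minimal ?_ (isCompact_contractions hg.isNorm).isClosed hM
  rintro _ ⟨w, -, rfl⟩ x
  rw [← Matrix.mulVec_mulVec, ← Matrix.mulVec_mulVec]
  exact (hp _).trans ((hg.wordProd_le w _).trans (hp x))

lemma isCompact_compressedSet : IsCompact (compressedSet B P U V) := by
  obtain ⟨g, hg⟩ := hB.barabanov
  exact (isCompact_contractions hg.isNorm).of_isClosed_subset isClosed_closure
    (hB.compressedSet_le hg)

/-- Products of many compressed matrices decay at a uniform exponential rate. -/
lemma exists_scaledMap_bound (hprim : IsPrimitiveWord P) {g : (Fin d → ℝ) → ℝ}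
    (hg : IsUnitBarabanov B g) : ∃ θ D : ℝ, 0 < θ ∧ θ < 1 ∧ 0 < D ∧
      ∀ l, ∀ N ∈ compressedSet B P U V ^ l, ∀ x, ‖scaledMap U θ l N x‖ ≤ D * g x := by
  obtain ⟨R₀, hR₀⟩ := exists_pow_contract hB.isCompact_compressedSet (hB.compressedSet_mul hprim)
    hB.compressedSet_fixed hg.isNorm (hB.compressedSet_le hg)
  set K := compressedSet B P U V
  have hKg := hB.compressedSet_le hg
  -- A positive block length is needed for the induction on `l` below.
  set R := R₀ + 1 with hRdef
  have hR : ∀ N ∈ K ^ R, ∀ x, g (N *ᵥ x) ≤ 1 / 2 * g x := by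
    intro N hN x
    rw [hRdef, pow_succ'] at hN
    obtain ⟨M, hM, N', hN', rfl⟩ := Set.mem_mul.1 hN
    rw [← Matrix.mulVec_mulVec]
    exact (hKg M hM _).trans (hR₀ N' hN' x)
  obtain ⟨θ, hθ0, hθ1, hθR⟩ : ∃ θ : ℝ, 0 < θ ∧ θ < 1 ∧ 1 / 2 ≤ θ ^ R := by
    have hc : ContinuousAt (fun s : ℝ => s ^ R) 1 := (continuous_pow R).continuousAt
    have h1 : ∀ᶠ s in 𝓝[<] (1 : ℝ), 1 / 2 < s ^ R :=
      (hc.eventually (lt_mem_nhds (by norm_num))).filter_mono nhdsWithin_le_nhds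
    have h2 : ∀ᶠ s in 𝓝[<] (1 : ℝ), 0 < s :=
      (lt_mem_nhds one_pos).filter_mono nhdsWithin_le_nhds
    have h3 : ∀ᶠ s in 𝓝[<] (1 : ℝ), s < 1 := self_mem_nhdsWithin
    obtain ⟨s, h1, h2, h3⟩ := (h1.and (h2.and h3)).exists
    exact ⟨s, h2, h3, h1.le⟩
  have hle : ∀ l, ∀ N ∈ K ^ l, ∀ x, g (N *ᵥ x) ≤ g x := by
    intro l
    induction l with
    | zero => intro N hN x; rw [pow_zero, Set.mem_one] at hN; simp [hN]
    | succ l ih =>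
      intro N hN x
      rw [pow_succ] at hN
      obtain ⟨N', hN', M, hM, rfl⟩ := Set.mem_mul.1 hN
      rw [← Matrix.mulVec_mulVec]
      exact (ih N' hN' _).trans (hKg M hM x)
  -- The factor 2 covers lengths below `R`, where `θ ^ l ≥ θ ^ R ≥ 1 / 2`.
  have hdec : ∀ l, ∀ N ∈ K ^ l, ∀ x, g (N *ᵥ x) ≤ 2 * θ ^ l * g x := by
    intro l
    induction l using Nat.strong_induction_on with
    | _ l ih =>
      intro N hN x
      have hgx := hg.isNorm.nonneg x
      rcases lt_or_ge l R with hlR | hlR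
      · have h1 : θ ^ R ≤ θ ^ l := pow_le_pow_of_le_one hθ0.le hθ1.le hlR.le
        have h2 := hle l N hN x
        nlinarith
      · obtain ⟨k, rfl⟩ := Nat.exists_eq_add_of_le hlR
        rw [pow_add] at hN
        obtain ⟨N₁, hN₁, N₂, hN₂, rfl⟩ := Set.mem_mul.1 hN
        have h1 := hR N₁ hN₁ (N₂ *ᵥ x)
        have h2 := ih k (by omega) N₂ hN₂ x
        rw [← Matrix.mulVec_mulVec, pow_add]
        have h3 : 0 ≤ θ ^ k * g x := mul_nonneg (pow_nonneg hθ0.le k) hgx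
        nlinarith
  have hUs : IsSeminorm fun x => ‖U x‖ := ⟨fun x => norm_nonneg _, fun c x => by
    rw [map_smul, norm_smul, Real.norm_eq_abs], fun x y => by
    rw [map_add]; exact norm_add_le _ _⟩
  obtain ⟨D, hD, hDU⟩ := hUs.exists_le_norm' hg.isNorm
  refine ⟨θ, D * 2, hθ0, hθ1, by positivity, fun l N hN x => ?_⟩
  rw [scaledMap_apply, norm_smul, norm_pow, norm_inv, Real.norm_of_nonneg hθ0.le, inv_pow,
    inv_mul_le_iff₀ (pow_pos hθ0 l)]
  have h1 := hDU (N *ᵥ x)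
  have h2 := mul_le_mul_of_nonneg_left (hdec l N hN x) hD.le
  linarith

/-- If the leading eigenvalue is a root of unity, a finite maximum of moduli of linear images of
the leading coordinate is a contracted seminorm. -/
theorem exists_isContracted_of_pow_eq_one (hprim : IsPrimitiveWord P) {N : ℕ} (hN : 0 < N)
    (hlam : lam ^ N = 1) (him : lam.im ≠ 0) :
    ∃ (ι : Type) (_ : Finite ι) (_ : Nonempty ι) (τ : ι → ℂ →ₗ[ℝ] ℂ) (θ : ℝ),
      (∀ j ζ, τ j ζ = 0 → ζ = 0) ∧ IsContracted B P U V (fun x => ⨆ j, ‖τ j (U x)‖) θ := by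
  obtain ⟨g, hg⟩ := hB.barabanov
  obtain ⟨θ, D, hθ0, hθ1, hD, hbound⟩ := hB.exists_scaledMap_bound hprim hg
  set K := compressedSet B P U V with hK
  let S := {q : ℕ × Matrix (Fin d) (Fin d) ℝ // q.2 ∈ K ^ q.1}
  let T : S → (Fin d → ℝ) →ₗ[ℝ] ℂ := fun q => scaledMap U θ q.1.1 q.1.2
  have hS : Nonempty S := ⟨⟨(0, 1), by simp⟩⟩
  -- The adapted seminorm `sup θ^{-l} ‖U N x‖` over products `N` of `l` elements of `K`. Multiplying
  -- by one more element of `K` raises `l` by one, which yields contraction by `θ`.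
  set n₀ : (Fin d → ℝ) → ℝ := fun x => ⨆ q : S, ‖T q x‖ with hn₀
  have hT_le : ∀ q x, ‖T q x‖ ≤ n₀ x := fun q x =>
    le_ciSup (f := fun q : S => ‖T q x‖)
      ⟨D * g x, by rintro _ ⟨q, rfl⟩; exact hbound _ _ q.2 x⟩ q
  have hU_le : ∀ x, ‖U x‖ ≤ n₀ x := fun x => by
    have := hT_le ⟨(0, 1), by simp⟩ x
    simpa [T, scaledMap_apply] using this
  have hn₀_nonneg : ∀ x, 0 ≤ n₀ x := fun x => (norm_nonneg _).trans (hU_le x)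
  have hn₀K : ∀ M ∈ K, ∀ x, n₀ (M *ᵥ x) ≤ θ * n₀ x := by
    intro M hM x
    refine ciSup_le fun q => ?_
    have h1 := hT_le ⟨(q.1.1 + 1, q.1.2 * M), by
      simp only [pow_succ]; exact Set.mul_mem_mul q.2 hM⟩ x
    simp only [T, scaledMap_apply, norm_smul, pow_succ, norm_mul, norm_inv,
      Real.norm_of_nonneg hθ0.le, ← Matrix.mulVec_mulVec] at h1 ⊢
    rw [mul_right_comm, mul_comm, inv_mul_le_iff₀ hθ0] at h1
    exact h1
  have hn₀P : ∀ x, n₀ (wordProd B P *ᵥ x) ≤ n₀ x := by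
    intro x
    refine ciSup_le fun q => ?_
    obtain ⟨⟨l, M⟩, hM⟩ := q
    simp only at hM
    cases l with
    | zero =>
      rw [pow_zero, Set.mem_one] at hM
      have h1 := hU_le x
      simpa [T, scaledMap_apply, hM, hB.lead.map_U, hB.lead.norm_eq] using h1
    | succ l =>
      rw [pow_succ] at hM
      obtain ⟨N', hN', M', hM', rfl⟩ := Set.mem_mul.1 hM
      have h1 := hT_le ⟨(l + 1, N' * (M' * wordProd B P)), by
        simp only [pow_succ]; exact Set.mul_mem_mul hN' (hB.compressedSet_mul_P M' hM')⟩ x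
      simpa only [T, scaledMap_apply, ← Matrix.mulVec_mulVec] using h1
  have hTVU : ∀ q x, T q (V (U x)) = T q x := by
    rintro ⟨⟨l, M⟩, hM⟩ x
    simp only at hM
    cases l with
    | zero =>
      rw [pow_zero, Set.mem_one] at hM
      simp [T, scaledMap_apply, hM, hB.lead.UVU]
    | succ l =>
      rw [pow_succ] at hM
      obtain ⟨N', hN', M', hM', rfl⟩ := Set.mem_mul.1 hM
      have h1 : V (U x) = projMatrix U V 1 *ᵥ x := by rw [projMatrix_mulVec, one_mul]
      simp only [T, scaledMap_apply]
      rw [h1, Matrix.mulVec_mulVec, mul_assoc, hB.compressedSet_mul_proj M' hM']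
  have hn₀VU : ∀ x, n₀ (V (U x)) = n₀ x := fun x => by simp only [hn₀, hTVU]
  -- The error size is chosen so that `(1 + e) θ ≤ (1 + θ) / 2 · (1 - 3 e)`.
  set e : ℝ := (1 - θ) / 16 with he
  have he0 : 0 < e := by rw [he]; linarith
  -- On the leading plane `T q` is determined by its values at `V 1` and `V I`, which are bounded;
  -- finitely many `q` approximate all of them.
  obtain ⟨F, hF⟩ : ∃ F : Finset S, ∀ q, ∃ q' ∈ F, ‖T q (V 1) - T q' (V 1)‖ ≤ e ∧
      ‖T q (V Complex.I) - T q' (V Complex.I)‖ ≤ e := by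
    let E : S → ℂ × ℂ := fun q => (T q (V 1), T q (V Complex.I))
    have hbd : Bornology.IsBounded (Set.range E) := by
      refine isBounded_iff_forall_norm_le.2 ⟨max (n₀ (V 1)) (n₀ (V Complex.I)), ?_⟩
      rintro _ ⟨q, rfl⟩
      exact max_le_max (hT_le q _) (hT_le q _)
    obtain ⟨F, hF⟩ := hbd.isCompact_closure.elim_finite_subcover (fun q => Metric.ball (E q) e)
      (fun q => Metric.isOpen_ball) (fun z hz => by
        obtain ⟨_, ⟨q, rfl⟩, hq⟩ := Metric.mem_closure_iff.1 hz e he0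
        exact Set.mem_iUnion.2 ⟨q, hq⟩)
    refine ⟨F, fun q => ?_⟩
    obtain ⟨q', hq', hqq'⟩ := Set.mem_iUnion₂.1 (hF (subset_closure ⟨q, rfl⟩))
    rw [Metric.mem_ball, dist_eq_norm] at hqq'
    exact ⟨q', hq', (norm_fst_le _).trans hqq'.le, (norm_snd_le _).trans hqq'.le⟩
  choose κ hκ0 hκe hκ using fun q : S => exists_small_add_injective (T q ∘ₗ V) he0
  let σ : S → ℂ →ₗ[ℝ] ℂ := fun q => T q ∘ₗ V + κ q • LinearMap.id
  have hσ : ∀ q ζ, σ q ζ = T q (V ζ) + κ q * ζ := fun q ζ => by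
    simp [σ]
  -- Composing with all powers of `lam` makes the finite maximum invariant under `P`; the small term
  -- `κ` makes each map injective.
  let τ : F × Fin N → ℂ →ₗ[ℝ] ℂ := fun j => σ j.1 ∘ₗ LinearMap.mulLeft ℝ (lam ^ (j.2 : ℕ))
  have hτ : ∀ j ζ, τ j ζ = σ j.1 (lam ^ (j.2 : ℕ) * ζ) := fun j ζ => rfl
  have hlampow : ∀ k : ℕ, lam ^ k ≠ 0 := fun k => pow_ne_zero _ (by
    rintro rfl; simp at him)
  have hFne : Nonempty F := by
    obtain ⟨q', hq', -⟩ := hF hS.some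
    exact ⟨⟨q', hq'⟩⟩
  have hNne : Nonempty (Fin N) := ⟨⟨0, hN⟩⟩
  set n : (Fin d → ℝ) → ℝ := fun x => ⨆ j, ‖τ j (U x)‖ with hn
  have hle_n : ∀ j x, ‖τ j (U x)‖ ≤ n x := fun j x =>
    le_ciSup (f := fun j => ‖τ j (U x)‖) (Set.finite_range _).bddAbove j
  have hn_le : ∀ x, n x ≤ (1 + e) * n₀ x := by
    intro x
    refine ciSup_le fun j => ?_
    have h1 : V (lam ^ (j.2 : ℕ) * U x) = (wordProd B P ^ (j.2 : ℕ)) *ᵥ V (U x) :=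
      (hB.lead.map_V_pow _ _).symm
    have h2 : ∀ (k : ℕ) y, n₀ ((wordProd B P ^ k) *ᵥ y) ≤ n₀ y := by
      intro k
      induction k with
      | zero => simp
      | succ k ih =>
        intro y
        rw [pow_succ, ← Matrix.mulVec_mulVec]
        exact (ih _).trans (hn₀P y)
    have h3 : ‖T j.1 (V (lam ^ (j.2 : ℕ) * U x))‖ ≤ n₀ x := by
      rw [h1, ← hn₀VU x]
      exact (hT_le _ _).trans (h2 _ _)
    have h4 : ‖(κ j.1 : ℂ) * (lam ^ (j.2 : ℕ) * U x)‖ ≤ e * n₀ x := by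
      rw [norm_mul, norm_mul, norm_pow, hB.lead.norm_eq, one_pow, one_mul, Complex.norm_real,
        Real.norm_of_nonneg (hκ0 _).le]
      exact mul_le_mul (hκe _).le (hU_le x) (norm_nonneg _) he0.le
    rw [hτ, hσ]
    refine (norm_add_le _ _).trans ?_
    linarith
  -- The loss `3 e` is `2 e` from the net, one `e` for each real coordinate of `U x`, plus `e` from
  -- `κ`.
  have hn_ge : ∀ x, (1 - 3 * e) * n₀ x ≤ n x := by
    intro x
    suffices h : n₀ x ≤ n x + 3 * e * n₀ x by linarith
    refine ciSup_le fun q => ?_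
    obtain ⟨q', hq', h1, h2⟩ := hF q
    have h3 : V (U x) = (U x).re • V 1 + (U x).im • V Complex.I := by
      rw [← map_smul, ← map_smul, ← map_add]
      congr 1
      apply Complex.ext <;> simp
    have h4 : ‖T q x - T q' x‖ ≤ 2 * e * ‖U x‖ := by
      have h5 : T q x - T q' x = (U x).re • (T q (V 1) - T q' (V 1)) +
          (U x).im • (T q (V Complex.I) - T q' (V Complex.I)) := by
        rw [← hTVU q, ← hTVU q', h3]
        simp only [map_add, map_smul, smul_sub]
        ring
      rw [h5]
      refine (norm_add_le _ _).trans ?_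
      rw [norm_smul, norm_smul, Real.norm_eq_abs, Real.norm_eq_abs]
      have h6 := mul_le_mul (Complex.abs_re_le_norm (U x)) h1 (norm_nonneg _) (norm_nonneg _)
      have h7 := mul_le_mul (Complex.abs_im_le_norm (U x)) h2 (norm_nonneg _) (norm_nonneg _)
      linarith
    have h5 : ‖T q' x‖ ≤ n x + e * ‖U x‖ := by
      have h6 := hle_n (⟨q', hq'⟩, ⟨0, hN⟩) x
      rw [hτ, hσ] at h6
      simp only [pow_zero, one_mul, hTVU] at h6
      have h7 : ‖(κ q' : ℂ) * U x‖ ≤ e * ‖U x‖ := by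
        rw [norm_mul, Complex.norm_real, Real.norm_of_nonneg (hκ0 _).le]
        exact mul_le_mul_of_nonneg_right (hκe _).le (norm_nonneg _)
      have h8 := norm_sub_le (T q' x + κ q' * U x) (κ q' * U x)
      rw [add_sub_cancel_right] at h8
      linarith
    have h6 : ‖T q x‖ ≤ ‖T q' x‖ + ‖T q x - T q' x‖ := by
      have := norm_add_le (T q' x) (T q x - T q' x)
      rwa [add_sub_cancel] at this
    have h7 := mul_le_mul_of_nonneg_left (hU_le x) he0.le
    linarith
  have hnP_le : ∀ x, n (wordProd B P *ᵥ x) ≤ n x := by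
    intro x
    refine ciSup_le fun j => ?_
    obtain ⟨q, k⟩ := j
    rw [hτ, hB.lead.map_U, ← mul_assoc, ← pow_succ]
    rcases Nat.lt_or_ge ((k : ℕ) + 1) N with hk | hk
    · exact hle_n (q, ⟨(k : ℕ) + 1, hk⟩) x
    · have hk' : (k : ℕ) + 1 = N := by have := k.2; omega
      have h1 := hle_n (q, ⟨0, hN⟩) x
      rw [hτ] at h1
      simp only [pow_zero] at h1
      simp only
      rw [hk', hlam]
      exact h1
  have hnU : ∀ x y, U x = U y → n x = n y := fun x y h => by simp only [hn, h]
  refine ⟨F × Fin N, inferInstance, inferInstance, τ, (1 + θ) / 2, fun j ζ hζ => ?_,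
    ⟨isSeminorm_iSup_norm fun j => τ j ∘ₗ U, by linarith, by linarith, fun x => ?_,
      fun x => hnU _ _ (hB.lead.UVU x), fun w hw x => ?_, ?_⟩⟩
  · rw [hτ, hσ] at hζ
    exact (mul_eq_zero.1 (hκ _ _ hζ)).resolve_left (hlampow _)
  · refine le_antisymm (hnP_le x) ?_
    -- `P ^ N` acts trivially on the coordinate `U`, so going round the cycle reverses the
    -- inequality.
    have h1 : ∀ k : ℕ, n ((wordProd B P ^ (k + 1)) *ᵥ x) ≤ n (wordProd B P *ᵥ x) := by
      intro k
      induction k with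
      | zero => simp
      | succ k ih =>
        rw [pow_succ', ← Matrix.mulVec_mulVec]
        exact (hnP_le _).trans ih
    have h2 := h1 (N - 1)
    rw [Nat.sub_add_cancel hN] at h2
    rwa [hnU _ x (by rw [hB.lead.map_U_pow, hlam, one_mul])] at h2
  · have h1 : n (wordProd B w *ᵥ V (U x)) =
        n ((projMatrix U V 1 * wordProd B w * projMatrix U V 1) *ᵥ x) := by
      refine hnU _ _ ?_
      rw [← Matrix.mulVec_mulVec, ← Matrix.mulVec_mulVec, projMatrix_mulVec, projMatrix_mulVec,
        one_mul, one_mul, hB.lead.UVU]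
    have h2 := hn₀K _ (subset_closure ⟨w, hw, rfl⟩) x
    have h3 := hn_le ((projMatrix U V 1 * wordProd B w * projMatrix U V 1) *ᵥ x)
    have h4 := hn_ge x
    have h5 := hn₀_nonneg x
    change n (wordProd B w *ᵥ V (U x)) ≤ (1 + θ) / 2 * n x
    rw [h1]
    refine h3.trans ?_
    have h6 : (1 + e) * θ ≤ (1 + θ) / 2 * (1 - 3 * e) := by
      rw [he]; nlinarith
    calc (1 + e) * n₀ ((projMatrix U V 1 * wordProd B w * projMatrix U V 1) *ᵥ x)
        ≤ (1 + e) * (θ * n₀ x) := mul_le_mul_of_nonneg_left h2 (by linarith)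
      _ = ((1 + e) * θ) * n₀ x := by ring
      _ ≤ ((1 + θ) / 2 * (1 - 3 * e)) * n₀ x := mul_le_mul_of_nonneg_right h6 h5
      _ = (1 + θ) / 2 * ((1 - 3 * e) * n₀ x) := by ring
      _ ≤ _ := mul_le_mul_of_nonneg_left h4 (by linarith)
  · obtain ⟨x, hx⟩ := hB.lead.U_ne
    refine ⟨x, fun h0 => ?_⟩
    have h1 := hn_ge x
    have h2 := (norm_pos_iff.2 hx).trans_le (hU_le x)
    have h3 : 0 < 1 - 3 * e := by rw [he]; linarith
    have h4 := mul_pos h3 h2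
    have h5 : n x = 0 := h0
    linarith

/-- If the leading eigenvalue is not real, a finite maximum of moduli of linear images of the
leading coordinate is a contracted seminorm. -/
theorem exists_isContracted (hprim : IsPrimitiveWord P) (him : lam.im ≠ 0) :
    ∃ (ι : Type) (_ : Finite ι) (_ : Nonempty ι) (τ : ι → ℂ →ₗ[ℝ] ℂ) (θ : ℝ),
      (∀ j ζ, τ j ζ = 0 → ζ = 0) ∧ IsContracted B P U V (fun x => ⨆ j, ‖τ j (U x)‖) θ := by
  by_cases h : Irrational (lam.arg / Real.pi)
  · refine ⟨Unit, inferInstance, inferInstance, fun _ => LinearMap.id, r, fun _ _ h => h, ?_⟩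
    simpa using hB.isContracted_of_irrational h
  · obtain ⟨N, hN, hlam⟩ := exists_pow_eq_one_of_not_irrational hB.lead.norm_eq h
    exact hB.exists_isContracted_of_pow_eq_one hprim hN hlam him

end IsDominantFamily
end Rational

/-! ### Convex hulls of compact sets. -/

lemma sum_eq_sum_embedding {ι κ F : Type*} [Fintype ι] [Fintype κ] [AddCommMonoid F] (e : ι ↪ κ)
    (f : κ → F) (hf : ∀ k, k ∉ Set.range e → f k = 0) : ∑ k, f k = ∑ i, f (e i) := by
  rw [← Finset.sum_map Finset.univ e f]
  refine (Finset.sum_subset (Finset.subset_univ _) fun k _ hk => hf k ?_).symm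
  simpa using hk

/-- In finite dimensions the convex hull of a compact set is compact. -/
lemma isCompact_convexHull_of_isCompact {E : Type*} [NormedAddCommGroup E] [NormedSpace ℝ E]
    [FiniteDimensional ℝ E] {s : Set E} (hs : IsCompact s) : IsCompact (convexHull ℝ s) := by
  -- By Carathéodory `D` points suffice; shorter combinations are padded with zero weights, so the
  -- hull is a continuous image of a compact set.
  set D := Module.finrank ℝ E + 1 with hD
  have hcomp : IsCompact ((fun p : (Fin D → ℝ) × (Fin D → E) => ∑ k, p.1 k • p.2 k) ''
      (stdSimplex ℝ (Fin D) ×ˢ Set.univ.pi fun _ => s)) :=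
    ((isCompact_stdSimplex ℝ (Fin D)).prod (isCompact_univ_pi fun _ => hs)).image (by fun_prop)
  convert hcomp using 1
  apply Set.Subset.antisymm
  · intro x hx
    obtain ⟨ι, hι, z, w, hz, hind, hw, hw1, rfl⟩ := eq_pos_convex_span_of_mem_convexHull hx
    classical
    have hcard : Fintype.card ι ≤ D := by
      have := hind.card_le_finrank_succ
      have h2 := Submodule.finrank_le (vectorSpan ℝ (Set.range z))
      omega
    have hne : Nonempty ι := by
      by_contra hne
      rw [not_nonempty_iff] at hne
      simp at hw1
    obtain ⟨e⟩ : Nonempty (ι ↪ Fin D) :=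
      Function.Embedding.nonempty_of_card_le (by simpa using hcard)
    have hext : ∀ k, k ∉ Set.range e → Function.extend e w 0 k = 0 := fun k hk => by
      rw [Function.extend_apply' _ _ _ (by simpa using hk)]; rfl
    refine ⟨(Function.extend e w 0, Function.extend e z fun _ => z hne.some), ⟨⟨fun k => ?_, ?_⟩,
      fun k _ => ?_⟩, ?_⟩
    · by_cases hk : k ∈ Set.range e
      · obtain ⟨i, rfl⟩ := hk
        simp only [e.injective.extend_apply]
        exact (hw i).le
      · exact (hext k hk).ge
    · simp only
      rw [sum_eq_sum_embedding e _ hext]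
      simpa only [e.injective.extend_apply] using hw1
    · by_cases hk : k ∈ Set.range e
      · obtain ⟨i, rfl⟩ := hk
        simp only [e.injective.extend_apply]
        exact hz ⟨i, rfl⟩
      · simp only
        rw [Function.extend_apply' _ _ _ (by simpa using hk)]
        exact hz ⟨_, rfl⟩
    · simp only
      rw [sum_eq_sum_embedding e _ fun k hk => by rw [hext k hk, zero_smul]]
      simp only [e.injective.extend_apply]
  · rintro _ ⟨⟨w, z⟩, ⟨⟨hw0, hw1⟩, hz⟩, rfl⟩
    exact (convex_convexHull ℝ s).sum_mem (fun k _ => hw0 k) hw1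
      fun k _ => subset_convexHull ℝ s (hz k trivial)

/-! ### Support functions and the duality between invariant bodies and Barabanov norms. -/

section Support
variable {d m : ℕ}

/-- `f` is the support function of `G`. -/
def IsSupport (G : Set (Fin d → ℝ)) (f : (Fin d → ℝ) → ℝ) : Prop :=
  ∀ x, IsGreatest ((fun z => z ⬝ᵥ x) '' G) (f x)

lemma convex_dotProduct_le (x : Fin d → ℝ) (c : ℝ) : Convex ℝ {z : Fin d → ℝ | z ⬝ᵥ x ≤ c} := by
  refine convex_halfSpace_le ⟨fun a b => add_dotProduct a b x, fun a b => ?_⟩ c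
  exact smul_dotProduct a b x

lemma continuous_dotProduct_left (x : Fin d → ℝ) : Continuous fun z : Fin d → ℝ => z ⬝ᵥ x := by
  unfold dotProduct
  fun_prop

lemma exists_isSupport {G : Set (Fin d → ℝ)} (hG : IsCompact G) (hne : G.Nonempty) :
    ∃ f, IsSupport G f := by
  have h : ∀ x : Fin d → ℝ, ∃ c, IsGreatest ((fun z => z ⬝ᵥ x) '' G) c := fun x =>
    (hG.image (continuous_dotProduct_left x)).exists_isGreatest (hne.image _)
  choose f hf using h
  exact ⟨f, hf⟩

lemma IsSupport.le {G : Set (Fin d → ℝ)} {f : (Fin d → ℝ) → ℝ} (h : IsSupport G f)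
    {z : Fin d → ℝ} (hz : z ∈ G) (x : Fin d → ℝ) : z ⬝ᵥ x ≤ f x := (h x).2 ⟨z, hz, rfl⟩

lemma IsSupport.exists_eq {G : Set (Fin d → ℝ)} {f : (Fin d → ℝ) → ℝ} (h : IsSupport G f)
    (x : Fin d → ℝ) : ∃ z ∈ G, z ⬝ᵥ x = f x := (h x).1

lemma isSupport_convexHull {K : Set (Fin d → ℝ)} {f : (Fin d → ℝ) → ℝ} (h : IsSupport K f) :
    IsSupport (convexHull ℝ K) f := by
  intro x
  obtain ⟨z, hz, hzx⟩ := h.exists_eq x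
  refine ⟨⟨z, subset_convexHull ℝ K hz, hzx⟩, ?_⟩
  rintro _ ⟨y, hy, rfl⟩
  exact convexHull_min (fun z hz => h.le hz x) (convex_dotProduct_le x (f x)) hy

lemma IsSupport.smul {G : Set (Fin d → ℝ)} {f : (Fin d → ℝ) → ℝ} (h : IsSupport G f) {c : ℝ}
    (hc : 0 ≤ c) : IsSupport (c • G) fun x => c * f x := by
  intro x
  obtain ⟨z, hz, hzx⟩ := h.exists_eq x
  refine ⟨⟨c • z, Set.smul_mem_smul_set hz, by simp only [smul_dotProduct, hzx, smul_eq_mul]⟩, ?_⟩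
  rintro _ ⟨_, ⟨y, hy, rfl⟩, rfl⟩
  simp only [smul_dotProduct, smul_eq_mul]
  exact mul_le_mul_of_nonneg_left (h.le hy x) hc

/-- A point bounded by the support function of a closed convex set lies in it. -/
lemma IsSupport.mem_of_forall_le {G : Set (Fin d → ℝ)} {f : (Fin d → ℝ) → ℝ}
    (h : IsSupport G f) (hconv : Convex ℝ G) (hcl : IsClosed G) {z : Fin d → ℝ}
    (hz : ∀ x, z ⬝ᵥ x ≤ f x) : z ∈ G := by
  by_contra hne
  obtain ⟨φ, u, hu, huz⟩ := geometric_hahn_banach_closed_point hconv hcl hne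
  have hφ : ∀ y : Fin d → ℝ, φ y = y ⬝ᵥ fun j => φ (Pi.single j 1) := by
    intro y
    conv_lhs => rw [pi_eq_sum_univ' y]
    rw [map_sum, dotProduct]
    refine Finset.sum_congr rfl fun j _ => ?_
    rw [map_smul, smul_eq_mul]
  obtain ⟨y, hy, hyx⟩ := h.exists_eq fun j => φ (Pi.single j 1)
  have h1 := hz fun j => φ (Pi.single j 1)
  rw [← hyx, ← hφ, ← hφ] at h1
  linarith [hu y hy]

lemma IsSupport.eq_set {G G' : Set (Fin d → ℝ)} {f : (Fin d → ℝ) → ℝ} (h : IsSupport G f)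
    (h' : IsSupport G' f) (hconv : Convex ℝ G) (hcl : IsClosed G) (hconv' : Convex ℝ G')
    (hcl' : IsClosed G') : G = G' :=
  Set.Subset.antisymm (fun _ hz => h'.mem_of_forall_le hconv' hcl' (h.le hz))
    fun _ hz => h.mem_of_forall_le hconv hcl (h'.le hz)

lemma transpose_mulVec_dotProduct (M : Matrix (Fin d) (Fin d) ℝ) (z x : Fin d → ℝ) :
    (Mᵀ *ᵥ z) ⬝ᵥ x = z ⬝ᵥ (M *ᵥ x) := by
  rw [Matrix.mulVec_transpose, Matrix.dotProduct_mulVec]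

section Invariant
variable {A : Fin m → Matrix (Fin d) (Fin d) ℝ} {G : Set (Fin d → ℝ)} {f : (Fin d → ℝ) → ℝ}

/-- Symmetry of `G` gives absolute homogeneity, and an interior point gives definiteness. -/
lemma IsSupport.isNorm (h : IsSupport G f) (hsymm : ∀ x ∈ G, -x ∈ G)
    (hint : (interior G).Nonempty) : IsNorm f := by
  have hneg : ∀ x, f (-x) ≤ f x := fun x => by
    obtain ⟨z, hz, hzx⟩ := h.exists_eq (-x)
    rw [← hzx, dotProduct_neg, ← neg_dotProduct]
    exact h.le (hsymm z hz) x
  have hpos : ∀ (c : ℝ), 0 ≤ c → ∀ x, f (c • x) = c * f x := by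
    intro c hc x
    obtain ⟨z, hz, hzx⟩ := h.exists_eq (c • x)
    obtain ⟨y, hy, hyx⟩ := h.exists_eq x
    apply le_antisymm
    · rw [← hzx, dotProduct_smul, smul_eq_mul]
      exact mul_le_mul_of_nonneg_left (h.le hz x) hc
    · have := h.le hy (c • x)
      rwa [dotProduct_smul, smul_eq_mul, hyx] at this
  refine ⟨fun x => ?_, fun x hx => ?_, fun c x => ?_, fun x y => ?_⟩
  · obtain ⟨z, hz, hzx⟩ := h.exists_eq x
    have h1 := h.le (hsymm z hz) x
    rw [neg_dotProduct, hzx] at h1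
    linarith
  · obtain ⟨z₀, hz₀⟩ := hint
    -- If `f x = 0`, testing `x` against `z₀ + t x` and `-z₀`, both in `G` for small `t > 0`, gives
    -- `t (x ⬝ᵥ x) ≤ 0`.
    have hc : Continuous fun t : ℝ => z₀ + t • x := by fun_prop
    have h0 : ∀ᶠ t in 𝓝[>] (0 : ℝ), z₀ + t • x ∈ G := by
      refine (hc.continuousAt.eventually ?_).filter_mono nhdsWithin_le_nhds
      simp only [zero_smul, add_zero]
      exact mem_interior_iff_mem_nhds.1 hz₀
    obtain ⟨t, ht, ht0⟩ := (h0.and self_mem_nhdsWithin).exists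
    have h1 := h.le ht x
    have h2 := h.le (hsymm _ (interior_subset hz₀)) x
    rw [hx] at h1 h2
    rw [add_dotProduct, smul_dotProduct, smul_eq_mul] at h1
    rw [neg_dotProduct] at h2
    have h3 : t * (x ⬝ᵥ x) ≤ 0 := by linarith
    have h4 : x ⬝ᵥ x ≤ 0 := nonpos_of_mul_nonpos_right h3 ht0
    have h5 : 0 ≤ x ⬝ᵥ x := Finset.sum_nonneg fun i _ => mul_self_nonneg _
    exact dotProduct_self_eq_zero.1 (le_antisymm h4 h5)
  · rcases le_total 0 c with hc | hc
    · rw [hpos c hc, abs_of_nonneg hc]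
    · have h1 : c • x = -((-c) • x) := by simp
      have h2 : f (-((-c) • x)) = f ((-c) • x) := by
        refine le_antisymm (hneg _) ?_
        have := hneg (-((-c) • x))
        rwa [neg_neg] at this
      rw [h1, h2, hpos _ (by linarith), abs_of_nonpos hc]
  · obtain ⟨z, hz, hzx⟩ := h.exists_eq (x + y)
    rw [← hzx, dotProduct_add]
    exact add_le_add (h.le hz x) (h.le hz y)

/-- The support function of an invariant body of the transposed family is a Barabanov norm. -/
lemma IsInvariantBody.isBarabanovNorm [Nonempty (Fin m)]
    (hG : IsInvariantBody (transposeFamily A) G) (h : IsSupport G f) : IsBarabanovNorm A f := by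
  have hρ : 0 ≤ jsr A := (jsr_spec A).1
  have hinv := hG.invariant
  rw [jsr_transposeFamily] at hinv
  have hup : ∀ i x, f (A i *ᵥ x) ≤ jsr A * f x := by
    intro i x
    obtain ⟨z, hz, hzx⟩ := h.exists_eq (A i *ᵥ x)
    have h1 : (A i)ᵀ *ᵥ z ∈ jsr A • G := by
      rw [← hinv]
      exact subset_convexHull ℝ _ (Set.mem_iUnion.2 ⟨i, z, hz, rfl⟩)
    have h2 := (h.smul hρ).le h1 x
    rwa [transpose_mulVec_dotProduct, hzx] at h2
  refine ⟨h.isNorm hG.symm hG.interior_nonempty, fun x => ⟨?_, ?_⟩⟩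
  · obtain ⟨i, hi⟩ := Finite.exists_max fun i => f (A i *ᵥ x)
    refine ⟨i, le_antisymm (hup i x) ?_⟩
    obtain ⟨z, hz, hzx⟩ := (h.smul hρ).exists_eq x
    rw [← hinv] at hz
    rw [← hzx]
    refine convexHull_min ?_ (convex_dotProduct_le x _) hz
    rintro _ hy
    obtain ⟨j, y, hyG, rfl⟩ := Set.mem_iUnion.1 hy
    change ((A j)ᵀ *ᵥ y) ⬝ᵥ x ≤ _
    rw [transpose_mulVec_dotProduct]
    exact (h.le hyG _).trans (hi j)
  · rintro _ ⟨i, rfl⟩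
    exact hup i x

/-- A symmetric convex body whose support function is a Barabanov norm is an invariant body of the
transposed family. -/
lemma IsBarabanovNorm.isInvariantBody [Nonempty (Fin m)] (hf : IsBarabanovNorm A f)
    (h : IsSupport G f) (hconv : Convex ℝ G) (hcomp : IsCompact G) (hsymm : ∀ x ∈ G, -x ∈ G) :
    IsInvariantBody (transposeFamily A) G := by
  have hρ : 0 ≤ jsr A := (jsr_spec A).1
  refine ⟨hconv, hcomp, ?_, hsymm, ?_⟩
  -- In the sup norm `z ⬝ᵥ x ≤ d ‖z‖ ‖x‖`, so a small ball lies below the support function; `d + 1`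
  -- keeps the radius well defined.
  · obtain ⟨C, hC, hCf⟩ := hf.isNorm.exists_norm_le
    refine ⟨0, mem_interior_iff_mem_nhds.2 (Metric.mem_nhds_iff.2
      ⟨1 / (C * (d + 1)), by positivity, fun z hz => ?_⟩)⟩
    refine h.mem_of_forall_le hconv hcomp.isClosed fun x => ?_
    rw [mem_ball_zero_iff, lt_div_iff₀ (by positivity)] at hz
    have h1 : z ⬝ᵥ x ≤ d * (‖z‖ * ‖x‖) := by
      calc z ⬝ᵥ x ≤ ∑ _i : Fin d, ‖z‖ * ‖x‖ := by
            refine Finset.sum_le_sum fun i _ => (le_abs_self _).trans ?_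
            rw [abs_mul]
            exact mul_le_mul (norm_le_pi_norm z i) (norm_le_pi_norm x i) (abs_nonneg _)
              (norm_nonneg _)
        _ = _ := by simp
    have h2 : ‖z‖ * ‖x‖ ≤ ‖z‖ * (C * f x) :=
      mul_le_mul_of_nonneg_left (hCf x) (norm_nonneg _)
    have h3 := hf.isNorm.nonneg x
    calc z ⬝ᵥ x ≤ d * (‖z‖ * ‖x‖) := h1
      _ ≤ (d + 1) * (‖z‖ * (C * f x)) := by
          have : 0 ≤ ‖z‖ * (C * f x) := by positivity
          have : 0 ≤ (d : ℝ) := by positivity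
          nlinarith
      _ = (‖z‖ * (C * (d + 1))) * f x := by ring
      _ ≤ 1 * f x := mul_le_mul_of_nonneg_right hz.le h3
      _ = f x := one_mul _
  · rw [jsr_transposeFamily]
    have hc : ∀ i, IsCompact ((fun x => transposeFamily A i *ᵥ x) '' G) := fun i =>
      hcomp.image (by fun_prop)
    -- The Barabanov identity says that both sides of the invariance equation have the same support
    -- function; closed convex sets are determined by it.
    have hs : IsSupport (⋃ i, (fun x => transposeFamily A i *ᵥ x) '' G)
        fun x => jsr A * f x := by
      intro x
      obtain ⟨⟨i, hi⟩, hmax⟩ := hf.max_eq x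
      simp only at hi
      constructor
      · obtain ⟨z, hz, hzx⟩ := h.exists_eq (A i *ᵥ x)
        refine ⟨(A i)ᵀ *ᵥ z, Set.mem_iUnion.2 ⟨i, z, hz, rfl⟩, ?_⟩
        simp only
        rw [transpose_mulVec_dotProduct, hzx, hi]
      · rintro _ ⟨_, hy, rfl⟩
        obtain ⟨j, y, hyG, rfl⟩ := Set.mem_iUnion.1 hy
        change ((A j)ᵀ *ᵥ y) ⬝ᵥ x ≤ _
        rw [transpose_mulVec_dotProduct]
        exact (h.le hyG _).trans (hmax ⟨j, rfl⟩)
    exact (isSupport_convexHull hs).eq_set (h.smul hρ) (convex_convexHull ℝ _)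
      (isCompact_convexHull_of_isCompact (isCompact_iUnion hc)).isClosed (hconv.smul _)
      (hcomp.smul _).isClosed

end Invariant
end Support

/-! ### Polytopes and piecewise linear norms. -/

section RealCase
variable {d m : ℕ} {A : Fin m → Matrix (Fin d) (Fin d) ℝ} {G : Set (Fin d → ℝ)}
  {f : (Fin d → ℝ) → ℝ}

/-- The support function of a symmetric compact set is attained at extreme points. -/
lemma IsSupport.isGreatest_extremePoints (h : IsSupport G f) (hG : IsCompact G)
    (hsymm : ∀ x ∈ G, -x ∈ G) (x : Fin d → ℝ) :
    IsGreatest ((fun v => |v ⬝ᵥ x|) '' Set.extremePoints ℝ G) (f x) := by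
  let l₀ : (Fin d → ℝ) →ₗ[ℝ] ℝ :=
    { toFun := fun z => z ⬝ᵥ x
      map_add' := fun a b => add_dotProduct a b x
      map_smul' := fun c a => smul_dotProduct c a x }
  let l : StrongDual ℝ (Fin d → ℝ) := LinearMap.toContinuousLinearMap l₀
  have hl : ∀ z, l z = z ⬝ᵥ x := fun z => rfl
  have hle : ∀ z ∈ G, |z ⬝ᵥ x| ≤ f x := fun z hz => by
    refine abs_le'.2 ⟨h.le hz x, ?_⟩
    rw [← neg_dotProduct]
    exact h.le (hsymm z hz) x
  -- The maximisers of `x` on `G` form an exposed face; an extreme point of that face, given by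
  -- Krein–Milman, is an extreme point of `G`.
  have hexp : IsExposed ℝ G (l.toExposed G) := ContinuousLinearMap.toExposed.isExposed
  have hne : (l.toExposed G).Nonempty := by
    obtain ⟨z, hz, hzx⟩ := h.exists_eq x
    exact ⟨z, hz, fun y hy => by rw [hl, hl, hzx]; exact h.le hy x⟩
  obtain ⟨v, hv⟩ := (hexp.isCompact hG).extremePoints_nonempty hne
  refine ⟨⟨v, hexp.isExtreme.extremePoints_subset_extremePoints hv, ?_⟩, ?_⟩
  · have hvG := extremePoints_subset hv
    have hvx : v ⬝ᵥ x = f x := by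
      obtain ⟨z, hz, hzx⟩ := h.exists_eq x
      refine le_antisymm (h.le hvG.1 x) ?_
      rw [← hzx]
      exact hvG.2 z hz
    simp only
    rw [abs_of_nonneg, hvx]
    have := hle v hvG.1
    rw [← hvx] at this
    exact (abs_nonneg _).trans this
  · rintro _ ⟨z, hz, rfl⟩
    exact hle z (extremePoints_subset hz)

/-- A set whose support function is a finite maximum of linear functions has piecewise linear
support function. -/
lemma IsSupport.isPiecewiseLinear {F : Set (Fin d → ℝ)} (hF : F.Finite) (h : IsSupport F f) :
    IsPiecewiseLinear f := by
  obtain ⟨N, v, hv⟩ := hF.fin_param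
  have hF' : F = Set.range v := by rw [← hv.2]
  subst hF'
  refine ⟨N, fun i => {x | ∀ k, 0 ≤ (v i - v k) ⬝ᵥ x}, v, fun i => ⟨N, fun k => v i - v k, rfl⟩,
    ?_, fun i x hx => ?_⟩
  · refine Set.eq_univ_of_forall fun x => ?_
    obtain ⟨_, ⟨i, rfl⟩, hi⟩ := h.exists_eq x
    refine Set.mem_iUnion.2 ⟨i, fun k => ?_⟩
    rw [sub_dotProduct, hi, sub_nonneg]
    exact h.le ⟨k, rfl⟩ x
  · obtain ⟨_, ⟨k, rfl⟩, hk⟩ := h.exists_eq x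
    refine le_antisymm ?_ (h.le ⟨i, rfl⟩ x)
    have := hx k
    rw [sub_dotProduct, hk] at this
    linarith

lemma isSupport_of_abs {F : Set (Fin d → ℝ)}
    (h : ∀ x, IsGreatest ((fun z => |z ⬝ᵥ x|) '' F) (f x)) : IsSupport (F ∪ -F) f := by
  intro x
  obtain ⟨⟨z, hz, hzx⟩, hmax⟩ := h x
  simp only at hzx
  constructor
  · rcases abs_choice (z ⬝ᵥ x) with h1 | h1
    · exact ⟨z, Or.inl hz, by simp only; rw [← hzx, h1]⟩
    · exact ⟨-z, Or.inr (by simpa using hz), by simp only; rw [← hzx, h1, neg_dotProduct]⟩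
  · rintro _ ⟨y, hy, rfl⟩
    simp only
    rcases hy with hy | hy
    · exact (le_abs_self _).trans (hmax ⟨y, hy, rfl⟩)
    · have h1 := hmax ⟨-y, hy, rfl⟩
      simp only [neg_dotProduct, abs_neg] at h1
      exact (le_abs_self _).trans h1

lemma neg_mem_convexHull {K : Set (Fin d → ℝ)} (hK : ∀ x ∈ K, -x ∈ K) :
    ∀ x ∈ convexHull ℝ K, -x ∈ convexHull ℝ K := by
  intro x hx
  have hK' : -K = K := Set.Subset.antisymm
    (fun x hx => by simpa using hK _ (Set.mem_neg.1 hx)) fun x hx => Set.mem_neg.2 (hK x hx)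
  rw [← hK', convexHull_neg]
  simpa using hx

/-- If the Barabanov norm is unique and is a finite maximum of moduli of linear functionals, then
the invariant bodies of the transposed family are the multiples of one polytope. -/
theorem polytope_of_unique [Nonempty (Fin m)] (hf : IsBarabanovNorm A f) {F : Set (Fin d → ℝ)}
    (hF : F.Finite) (h : ∀ x, IsGreatest ((fun z => |z ⬝ᵥ x|) '' F) (f x))
    (huniq : ∀ g, IsBarabanovNorm A g → ∃ c : ℝ, 0 < c ∧ ∀ x, g x = c * f x) :
    (∃ G, IsInvariantBody (transposeFamily A) G) ∧
      ∀ G, IsInvariantBody (transposeFamily A) G →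
        IsPolytope G ∧
        (∀ G', IsInvariantBody (transposeFamily A) G' → ∃ c : ℝ, 0 < c ∧ G' = c • G) ∧
        ∃ f : (Fin d → ℝ) → ℝ,
          IsBarabanovNorm A f ∧
          (∀ g, IsBarabanovNorm A g → ∃ c : ℝ, 0 < c ∧ ∀ x, g x = c * f x) ∧
          IsPiecewiseLinear f ∧
          ∀ x, IsGreatest ((fun v => |v ⬝ᵥ x|) '' Set.extremePoints ℝ G) (f x) := by
  have hKfin : (F ∪ -F).Finite := hF.union hF.neg
  have hK := isSupport_of_abs h
  have hG₀ := isSupport_convexHull hK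
  have hG₀c : IsCompact (convexHull ℝ (F ∪ -F)) :=
    isCompact_convexHull_of_isCompact hKfin.isCompact
  have hG₀inv : IsInvariantBody (transposeFamily A) (convexHull ℝ (F ∪ -F)) :=
    hf.isInvariantBody hG₀ (convex_convexHull ℝ _) hG₀c <| neg_mem_convexHull <| by
      rintro x (hx | hx)
      · exact Or.inr (by simpa using hx)
      · exact Or.inl hx
  -- The support function of any invariant body is a Barabanov norm, hence a multiple of `f`, and it
  -- determines the body.
  have key : ∀ G, IsInvariantBody (transposeFamily A) G →
      ∃ c : ℝ, 0 < c ∧ G = c • convexHull ℝ (F ∪ -F) ∧ IsSupport G fun x => c * f x := by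
    intro G hG
    obtain ⟨g, hg⟩ := exists_isSupport hG.isCompact (hG.interior_nonempty.mono interior_subset)
    obtain ⟨c, hc, hgc⟩ := huniq g (hG.isBarabanovNorm hg)
    obtain rfl : g = fun x => c * f x := funext hgc
    exact ⟨c, hc, hg.eq_set (hG₀.smul hc.le) hG.convex hG.isCompact.isClosed
      ((convex_convexHull ℝ _).smul _) (hG₀c.smul _).isClosed, hg⟩
  refine ⟨⟨_, hG₀inv⟩, fun G hG => ?_⟩
  obtain ⟨c, hc, hGc, hsup⟩ := key G hG
  refine ⟨⟨c • (F ∪ -F), hKfin.smul_set, by rw [convexHull_smul, hGc]⟩, fun G' hG' => ?_, _,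
    hG.isBarabanovNorm hsup, fun g hg => ?_, ?_,
    hsup.isGreatest_extremePoints hG.isCompact hG.symm⟩
  · obtain ⟨c', hc', hGc', -⟩ := key G' hG'
    refine ⟨c' / c, by positivity, ?_⟩
    rw [hGc', hGc, smul_smul, div_mul_cancel₀ _ hc.ne']
  · obtain ⟨c', hc', hg'⟩ := huniq g hg
    refine ⟨c' / c, by positivity, fun x => ?_⟩
    rw [hg', ← mul_assoc, div_mul_cancel₀ _ hc.ne']
  · exact (hK.smul hc.le).isPiecewiseLinear hKfin.smul_set

end RealCase

/-! ### Ellipses, piecewise quadratic norms, and the exclusion of polytopes. -/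

section Ellipses
variable {d m : ℕ} {A : Fin m → Matrix (Fin d) (Fin d) ℝ} {f : (Fin d → ℝ) → ℝ}

/-- Cauchy–Schwarz in the plane, with equality at the unit vector along `(a ⬝ᵥ x, b ⬝ᵥ x)`. -/
lemma isSupport_ellipse (a b : Fin d → ℝ) :
    IsSupport (ellipse a b) fun x => √((a ⬝ᵥ x) ^ 2 + (b ⬝ᵥ x) ^ 2) := by
  intro x
  have hval : ∀ p : ℝ × ℝ, (p.1 • a + p.2 • b) ⬝ᵥ x = p.1 * (a ⬝ᵥ x) + p.2 * (b ⬝ᵥ x) := fun p => by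
    rw [add_dotProduct, smul_dotProduct, smul_dotProduct, smul_eq_mul, smul_eq_mul]
  set α := a ⬝ᵥ x
  set β := b ⬝ᵥ x
  constructor
  · rcases eq_or_ne (√(α ^ 2 + β ^ 2)) 0 with h0 | h0
    · refine ⟨_, ⟨(1, 0), by norm_num, rfl⟩, ?_⟩
      have h1 : α ^ 2 + β ^ 2 = 0 := (Real.sqrt_eq_zero (by positivity)).1 h0
      have h2 : α = 0 := by nlinarith [sq_nonneg α, sq_nonneg β]
      refine (hval (1, 0)).trans ?_
      change _ = √(α ^ 2 + β ^ 2)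
      rw [h0, h2]
      ring
    · have hs : √(α ^ 2 + β ^ 2) ^ 2 = α ^ 2 + β ^ 2 := Real.sq_sqrt (by positivity)
      set r := √(α ^ 2 + β ^ 2)
      refine ⟨_, ⟨(α / r, β / r), ?_, rfl⟩, ?_⟩
      · change (α / r) ^ 2 + (β / r) ^ 2 = 1
        rw [div_pow, div_pow, ← add_div, hs, div_self]
        rw [← hs]
        exact pow_ne_zero 2 h0
      · refine (hval (α / r, β / r)).trans ?_
        change _ = r
        rw [div_mul_eq_mul_div, div_mul_eq_mul_div, ← add_div, div_eq_iff h0]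
        linarith
  · rintro _ ⟨_, ⟨p, hp, rfl⟩, rfl⟩
    simp only [hval]
    have hp' : p.1 ^ 2 + p.2 ^ 2 = 1 := hp
    refine Real.le_sqrt_of_sq_le ?_
    have : α ^ 2 + β ^ 2 = (p.1 * α + p.2 * β) ^ 2 + (p.1 * β - p.2 * α) ^ 2 := by
      linear_combination (-(α ^ 2 + β ^ 2)) * hp'
    rw [this]
    nlinarith [sq_nonneg (p.1 * β - p.2 * α)]

lemma neg_mem_ellipse {a b z : Fin d → ℝ} (hz : z ∈ ellipse a b) : -z ∈ ellipse a b := by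
  obtain ⟨p, hp, rfl⟩ := hz
  have hp' : p.1 ^ 2 + p.2 ^ 2 = 1 := hp
  refine ⟨(-p.1, -p.2), ?_, ?_⟩
  · change (-p.1) ^ 2 + (-p.2) ^ 2 = 1
    rw [neg_sq, neg_sq, hp']
  · simp only [neg_smul]
    abel

lemma isCompact_ellipse (a b : Fin d → ℝ) : IsCompact (ellipse a b) := by
  refine IsCompact.image ?_ (by fun_prop)
  refine Metric.isCompact_of_isClosed_isBounded (isClosed_eq (by fun_prop) (by fun_prop)) ?_
  refine (Metric.isBounded_closedBall (x := (0 : ℝ × ℝ)) (r := 1)).subset fun p hp => ?_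
  have hp' : p.1 ^ 2 + p.2 ^ 2 = 1 := hp
  rw [mem_closedBall_zero_iff, Prod.norm_def, max_le_iff, Real.norm_eq_abs, Real.norm_eq_abs]
  exact ⟨abs_le_one_iff_mul_self_le_one.2 (by nlinarith [sq_nonneg p.2]),
    abs_le_one_iff_mul_self_le_one.2 (by nlinarith [sq_nonneg p.1])⟩

variable {N : ℕ} {a b : Fin N → Fin d → ℝ}

lemma isCompact_iUnion_ellipse (a b : Fin N → Fin d → ℝ) :
    IsCompact (⋃ i, ellipse (a i) (b i)) :=
  isCompact_iUnion fun i => isCompact_ellipse (a i) (b i)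

lemma isSupport_iUnion_ellipse
    (h : ∀ x, IsGreatest (Set.range fun i => √((a i ⬝ᵥ x) ^ 2 + (b i ⬝ᵥ x) ^ 2)) (f x)) :
    IsSupport (⋃ i, ellipse (a i) (b i)) f := by
  intro x
  obtain ⟨⟨i, hi⟩, hmax⟩ := h x
  constructor
  · obtain ⟨z, hz, hzx⟩ := (isSupport_ellipse (a i) (b i)).exists_eq x
    exact ⟨z, Set.mem_iUnion.2 ⟨i, hz⟩, hzx.trans hi⟩
  · rintro _ ⟨z, hz, rfl⟩
    obtain ⟨i, hi⟩ := Set.mem_iUnion.1 hz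
    exact ((isSupport_ellipse (a i) (b i)).le hi x).trans (hmax ⟨i, rfl⟩)

/-- The quadratic form `x ↦ (a ⬝ x)² + (b ⬝ x)²`. -/
noncomputable def ellipseForm (a b : Fin d → ℝ) : QuadraticForm ℝ (Fin d → ℝ) :=
  QuadraticMap.linMulLin (dotProductBilin ℝ ℝ a) (dotProductBilin ℝ ℝ a) +
    QuadraticMap.linMulLin (dotProductBilin ℝ ℝ b) (dotProductBilin ℝ ℝ b)

lemma ellipseForm_apply (a b x : Fin d → ℝ) :
    ellipseForm a b x = (a ⬝ᵥ x) ^ 2 + (b ⬝ᵥ x) ^ 2 := by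
  simp only [ellipseForm, add_apply, QuadraticMap.linMulLin_apply, sq]
  rfl

lemma IsSupport.isPiecewiseQuadratic (h : IsSupport (⋃ i, ellipse (a i) (b i)) f)
    (hf : Continuous f) : IsPiecewiseQuadratic f := by
  refine ⟨N, fun i => {x | f x = √((a i ⬝ᵥ x) ^ 2 + (b i ⬝ᵥ x) ^ 2)},
    fun i => ellipseForm (a i) (b i), fun i => isClosed_eq hf ?_, ?_, fun i x => ?_,
    fun i x hx => ?_⟩
  · unfold dotProduct
    fun_prop
  · refine Set.eq_univ_of_forall fun x => ?_
    obtain ⟨z, hz, hzx⟩ := h.exists_eq x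
    obtain ⟨i, hi⟩ := Set.mem_iUnion.1 hz
    refine Set.mem_iUnion.2 ⟨i, le_antisymm ?_ ?_⟩
    · rw [← hzx]
      exact (isSupport_ellipse (a i) (b i)).le hi x
    · obtain ⟨y, hy, hyx⟩ := (isSupport_ellipse (a i) (b i)).exists_eq x
      rw [← hyx]
      exact h.le (Set.mem_iUnion.2 ⟨i, hy⟩) x
  · rw [ellipseForm_apply]
    positivity
  · rw [ellipseForm_apply]
    exact hx

lemma IsSupport.isGreatest_ellipse (h : IsSupport (⋃ i, ellipse (a i) (b i)) f)
    (x : Fin d → ℝ) :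
    IsGreatest {r : ℝ | ∃ i, ∃ z ∈ ellipse (a i) (b i), r = |z ⬝ᵥ x|} (f x) := by
  have hle : ∀ i, ∀ z ∈ ellipse (a i) (b i), |z ⬝ᵥ x| ≤ f x := fun i z hz => by
    refine abs_le'.2 ⟨h.le (Set.mem_iUnion.2 ⟨i, hz⟩) x, ?_⟩
    rw [← neg_dotProduct]
    exact h.le (Set.mem_iUnion.2 ⟨i, neg_mem_ellipse hz⟩) x
  constructor
  · obtain ⟨z, hz, hzx⟩ := h.exists_eq x
    obtain ⟨i, hi⟩ := Set.mem_iUnion.1 hz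
    refine ⟨i, z, hi, le_antisymm ?_ (hle i z hi)⟩
    rw [← hzx]
    exact le_abs_self _
  · rintro _ ⟨i, z, hz, rfl⟩
    exact hle i z hz

/-- The support function of an invariant body spanned by ellipses. -/
theorem IsInvariantBody.exists_of_ellipseHull [Nonempty (Fin m)]
    (hG : IsInvariantBody (transposeFamily A) (ellipseHull a b)) :
    ∃ f : (Fin d → ℝ) → ℝ, IsBarabanovNorm A f ∧ IsPiecewiseQuadratic f ∧
      ∀ x, IsGreatest {r : ℝ | ∃ i, ∃ z ∈ ellipse (a i) (b i), r = |z ⬝ᵥ x|} (f x) := by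
  obtain ⟨f, hf⟩ := exists_isSupport (isCompact_iUnion_ellipse a b)
    (convexHull_nonempty_iff.1 (hG.interior_nonempty.mono interior_subset))
  have hB : IsBarabanovNorm A f := hG.isBarabanovNorm (isSupport_convexHull hf)
  exact ⟨f, hB, hf.isPiecewiseQuadratic hB.isNorm.continuous, hf.isGreatest_ellipse⟩

/-- A Barabanov norm that is a finite maximum of moduli of complex functionals is the support
function of an invariant body spanned by ellipses. -/
theorem IsBarabanovNorm.exists_ellipseHull [Nonempty (Fin m)] (hf : IsBarabanovNorm A f)
    {ι : Type} [Finite ι] (t : ι → (Fin d → ℝ) →ₗ[ℝ] ℂ)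
    (h : ∀ x, IsGreatest (Set.range fun j => ‖t j x‖) (f x)) :
    ∃ (N : ℕ) (a b : Fin N → Fin d → ℝ), IsSupport (ellipseHull a b) f ∧
      IsInvariantBody (transposeFamily A) (ellipseHull a b) := by
  obtain ⟨N, ⟨e⟩⟩ := Finite.exists_equiv_fin ι
  set a : Fin N → Fin d → ℝ := fun i k => (t (e.symm i) (Pi.single k 1)).re with ha
  set b : Fin N → Fin d → ℝ := fun i k => (t (e.symm i) (Pi.single k 1)).im with hb
  have hsum : ∀ i x, t i x = ∑ k, x k • t i (Pi.single k 1) := fun i x => by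
    conv_lhs => rw [pi_eq_sum_univ' x]
    simp only [map_sum, map_smul]
  have hval : ∀ i x, √((a (e i) ⬝ᵥ x) ^ 2 + (b (e i) ⬝ᵥ x) ^ 2) = ‖t i x‖ := by
    intro i x
    rw [Complex.norm_eq_sqrt_sq_add_sq, hsum i x, Complex.re_sum, Complex.im_sum]
    simp only [ha, hb, dotProduct, Equiv.symm_apply_apply, Complex.smul_re, Complex.smul_im,
      smul_eq_mul, mul_comm]
  have hs : IsSupport (⋃ i, ellipse (a i) (b i)) f := isSupport_iUnion_ellipse fun x => by
    convert h x using 1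
    rw [← e.surjective.range_comp]
    simp only [Function.comp_def, hval]
  have hs' : IsSupport (ellipseHull a b) f := isSupport_convexHull hs
  refine ⟨N, a, b, hs', hf.isInvariantBody hs' (convex_convexHull ℝ _)
    (isCompact_convexHull_of_isCompact (isCompact_iUnion_ellipse a b)) (neg_mem_convexHull ?_)⟩
  intro x hx
  obtain ⟨i, hi⟩ := Set.mem_iUnion.1 hx
  exact Set.mem_iUnion.2 ⟨i, neg_mem_ellipse hi⟩

lemma quadratic_eq_zero_of_infinite {S : Set ℕ} (hS : S.Infinite) {c₀ c₁ c₂ : ℝ}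
    (h : ∀ s ∈ S, c₀ + c₁ * (s : ℝ) + c₂ * (s : ℝ) ^ 2 = 0) : c₀ = 0 ∧ c₁ = 0 ∧ c₂ = 0 := by
  open Polynomial in
  have hp : (C c₀ + C c₁ * X + C c₂ * X ^ 2 : ℝ[X]) = 0 := by
    refine eq_zero_of_infinite_isRoot _ ((hS.image Nat.cast_injective.injOn).mono ?_)
    rintro _ ⟨s, hs, rfl⟩
    simpa [IsRoot] using h s hs
  refine ⟨?_, ?_, ?_⟩
  · simpa [Polynomial.coeff_X, Polynomial.coeff_C] using congrArg (Polynomial.coeff · 0) hp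
  · simpa [Polynomial.coeff_X, Polynomial.coeff_C] using congrArg (Polynomial.coeff · 1) hp
  · simpa [Polynomial.coeff_X, Polynomial.coeff_C] using congrArg (Polynomial.coeff · 2) hp

/-- A polytope has no two-dimensional section of its support function that is a finite maximum of
Euclidean norms. -/
theorem not_isPolytope {G : Set (Fin d → ℝ)} (hG : IsSupport G f) {κ : Type*} [Finite κ]
    (V : ℂ →ₗ[ℝ] (Fin d → ℝ)) (τ : κ → ℂ →ₗ[ℝ] ℂ) (hτ : ∀ j ζ, τ j ζ = 0 → ζ = 0)
    (h : ∀ ζ, ∃ j, f (V ζ) = ‖τ j ζ‖) : ¬ IsPolytope G := by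
  rintro ⟨F, hF, rfl⟩
  have hFs : ∀ x, ∃ v ∈ F, v ⬝ᵥ x = f x := by
    obtain ⟨k, hk⟩ := exists_isSupport hF.isCompact
      ((convexHull_nonempty_iff (𝕜 := ℝ)).1 ⟨_, (hG.exists_eq 0).choose_spec.1⟩)
    intro x
    rw [(hG x).unique (isSupport_convexHull hk x)]
    exact hk.exists_eq x
  -- On the points `1 + s I` with `s ∈ ℕ`, one vertex `v` and one index `j` serve infinitely many
  -- `s`. There a squared affine function of `s` equals a quadratic one, hence identically.
  have hpt : ∀ s : ℕ, ∃ jv : κ × F, (jv.2 : Fin d → ℝ) ⬝ᵥ V (1 + (s : ℝ) • Complex.I) =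
      ‖τ jv.1 (1 + (s : ℝ) • Complex.I)‖ := by
    intro s
    obtain ⟨v, hv, hvx⟩ := hFs (V (1 + (s : ℝ) • Complex.I))
    obtain ⟨j, hj⟩ := h (1 + (s : ℝ) • Complex.I)
    exact ⟨(j, ⟨v, hv⟩), hvx.trans hj⟩
  choose c hc using hpt
  have := hF.to_subtype
  obtain ⟨⟨j, v, hv⟩, hinf⟩ := Finite.exists_infinite_fiber c
  rw [Set.infinite_coe_iff] at hinf
  set γ := v ⬝ᵥ V 1 with hγ
  set δ := v ⬝ᵥ V Complex.I with hδ
  have hnorm : ∀ s : ℝ, ‖τ j (1 + s • Complex.I)‖ ^ 2 =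
      ((τ j 1).re + s * (τ j Complex.I).re) ^ 2 + ((τ j 1).im + s * (τ j Complex.I).im) ^ 2 := by
    intro s
    rw [Complex.sq_norm, Complex.normSq_apply]
    simp only [map_add, map_smul, Complex.add_re, Complex.add_im, Complex.smul_re, Complex.smul_im,
      smul_eq_mul]
    ring
  obtain ⟨h0, h1, h2⟩ := quadratic_eq_zero_of_infinite hinf
    (c₀ := (τ j 1).re ^ 2 + (τ j 1).im ^ 2 - γ ^ 2)
    (c₁ := 2 * ((τ j 1).re * (τ j Complex.I).re + (τ j 1).im * (τ j Complex.I).im - γ * δ))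
    (c₂ := (τ j Complex.I).re ^ 2 + (τ j Complex.I).im ^ 2 - δ ^ 2) <| by
      intro s hs
      have hs' : c s = (j, ⟨v, hv⟩) := hs
      have h3 := hc s
      rw [hs'] at h3
      have h4 := hnorm s
      simp only [map_add, map_smul, dotProduct_add, dotProduct_smul, smul_eq_mul] at h3 h4
      rw [← hγ, ← hδ] at h3
      rw [← h3] at h4
      linear_combination -h4
  have hδ0 : δ ≠ 0 := by
    intro hδ0
    rw [hδ0] at h2
    have hz : τ j Complex.I = 0 := Complex.ext (by simp; nlinarith [sq_nonneg (τ j Complex.I).im])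
      (by simp; nlinarith [sq_nonneg (τ j Complex.I).re])
    exact Complex.I_ne_zero (hτ j _ hz)
  -- At the real zero of the affine function `γ + δ s` the map `τ j` would vanish on `1 + s₀ I ≠ 0`,
  -- against injectivity.
  have hs₀ : δ * (-γ / δ) = -γ := mul_div_cancel₀ _ hδ0
  set s₀ := -γ / δ
  have h5 : ‖τ j (1 + s₀ • Complex.I)‖ ^ 2 = 0 := by
    rw [hnorm]
    linear_combination h0 + s₀ * h1 + s₀ ^ 2 * h2 + (s₀ * δ + γ) * hs₀
  have h6 := hτ j _ (norm_eq_zero.1 (pow_eq_zero_iff two_ne_zero |>.1 h5))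
  have h7 := congrArg Complex.re h6
  simp at h7

end Ellipses

/-! ### Scaling to joint spectral radius one and verification of the standing assumptions. -/

section Normalisation
variable {d m : ℕ} {A : Fin m → Matrix (Fin d) (Fin d) ℝ} {P : List (Fin m)} {lam : ℂ}

/-- The family scaled to joint spectral radius one. -/
noncomputable def normalized (A : Fin m → Matrix (Fin d) (Fin d) ℝ) :
    Fin m → Matrix (Fin d) (Fin d) ℝ := fun i => (jsr A)⁻¹ • A i

lemma isUnitBarabanov_normalized_iff (hρ : 0 < jsr A) {g : (Fin d → ℝ) → ℝ} :
    IsUnitBarabanov (normalized A) g ↔ IsBarabanovNorm A g := by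
  have key : IsNorm g → ∀ x, IsGreatest (Set.range fun i => g (normalized A i *ᵥ x)) (g x) ↔
      IsGreatest (Set.range fun i => g (A i *ᵥ x)) (jsr A * g x) := by
    intro hg x
    have h1 : ∀ i, g (normalized A i *ᵥ x) = (jsr A)⁻¹ * g (A i *ᵥ x) := fun i => by
      rw [normalized, Matrix.smul_mulVec, hg.smul, abs_of_pos (inv_pos.2 hρ)]
    refine and_congr (exists_congr fun i => ?_) ?_
    · simp only [h1, inv_mul_eq_iff_eq_mul₀ hρ.ne']
    · simp only [mem_upperBounds, Set.forall_mem_range, h1, inv_mul_le_iff₀ hρ]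
  exact ⟨fun h => ⟨h.isNorm, fun x => (key h.isNorm x).1 (h.max_eq x)⟩,
    fun h => ⟨h.isNorm, fun x => (key h.isNorm x).2 (h.max_eq x)⟩⟩

lemma exists_isUnitBarabanov_normalized [Nonempty (Fin m)] (hA : IsIrreducible A)
    (hρ : 0 < jsr A) : ∃ g, IsUnitBarabanov (normalized A) g := by
  have hw : ∀ w (x : Fin d → ℝ), ‖wordProd (normalized A) w *ᵥ x‖ =
      ((jsr A) ^ w.length)⁻¹ * ‖wordProd A w *ᵥ x‖ := by
    intro w x
    unfold normalized
    rw [wordProd_smul, Matrix.smul_mulVec, norm_smul, Real.norm_eq_abs, inv_pow,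
      abs_of_pos (by positivity)]
  refine exists_isUnitBarabanov (isIrreducible_smul A (inv_ne_zero hρ.ne') hA) ?_ ?_
  · intro t ht
    obtain ⟨C, hC, h⟩ := norm_wordProd_le A (t := t * jsr A) (by nlinarith)
    refine ⟨C, hC, fun w x => ?_⟩
    have h1 := h w x
    change ‖wordProd (normalized A) w *ᵥ x‖ ≤ _
    rw [hw, inv_mul_le_iff₀ (by positivity)]
    rw [mul_pow] at h1
    linarith
  · obtain ⟨c, hc, h⟩ := exists_le_norm_wordProd A
    refine ⟨c, hc, fun n hn => ?_⟩
    obtain ⟨w, hwn, hmin⟩ := h n hn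
    refine ⟨w, hwn, fun b hb hbj => ?_⟩
    have hpos : 0 < jsr A ^ n := by positivity
    have h1 := hmin (jsr A ^ n * b) (by positivity) fun j => by
      have h2 := hbj j
      change ‖wordProd (normalized A) w *ᵥ _‖ ≤ _ at h2
      rwa [hw, hwn, inv_mul_le_iff₀ hpos] at h2
    exact le_of_mul_le_mul_left (by linarith) hpos

lemma EigLE.mono {M : Matrix (Fin d) (Fin d) ℝ} {r s : ℝ} (h : EigLE M r) (hrs : r ≤ s) :
    EigLE M s := fun μ hμ => (h μ hμ).trans hrs

lemma nu_pow {w : List (Fin m)} (hw : w ≠ []) : nu A w ^ w.length = specRad (wordProd A w) := by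
  rw [nu, one_div]
  exact Real.rpow_inv_natCast_pow (specRad_nonneg _) (by simpa using hw)

lemma wordProd_normalized (w : List (Fin m)) :
    wordProd (normalized A) w = (jsr A ^ w.length)⁻¹ • wordProd A w := by
  unfold normalized
  rw [wordProd_smul, inv_pow]

lemma eigLE_normalized_iff (hρ : 0 < jsr A) {w : List (Fin m)} {r : ℝ} :
    EigLE (wordProd (normalized A) w) r ↔ EigLE (wordProd A w) (jsr A ^ w.length * r) := by
  have hpos : 0 < jsr A ^ w.length := by positivity
  rw [wordProd_normalized]
  constructor
  · intro h
    simpa [smul_smul, hpos.ne'] using h.smul hpos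
  · intro h
    simpa [← mul_assoc, hpos.ne'] using h.smul (inv_pos.2 hpos)

lemma IsUniqueSimpleLeading.eigLE {M : Matrix (Fin d) (Fin d) ℝ}
    (h : IsUniqueSimpleLeading M lam) : EigLE M ‖lam‖ := by
  intro μ hμ
  by_cases h1 : μ = lam
  · rw [h1]
  by_cases h2 : μ = (starRingEnd ℂ) lam
  · rw [h2, RCLike.norm_conj]
  exact (h.2 μ (Matrix.mem_spectrum_iff_isRoot_charpoly.1 hμ) h1 h2).le

lemma IsUniqueSimpleLeading.mem_spectrum {M : Matrix (Fin d) (Fin d) ℝ}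
    (h : IsUniqueSimpleLeading M lam) : lam ∈ spectrum ℂ (toC M) := by
  obtain ⟨v, hv⟩ := exists_isSimpleEigen h.1
  exact mem_spectrum_iff_exists.2 ⟨v, hv.ne_zero, hv.eigen⟩

lemma mem_spectrum_smul {M : Matrix (Fin d) (Fin d) ℂ} {c μ : ℂ} (hc : c ≠ 0) :
    μ ∈ spectrum ℂ (c • M) ↔ c⁻¹ * μ ∈ spectrum ℂ M := by
  have := spectrum.smul_mem_smul_iff (a := M) (s := c⁻¹ * μ) (r := Units.mk0 c hc)
  rw [← this, Units.smul_def, Units.smul_def, Units.val_mk0, smul_eq_mul, mul_inv_cancel_left₀ hc]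

/-- The normalised family satisfies the standing assumptions. -/
theorem exists_isDominantFamily (hA : IsIrreducible A) (hP : IsDominantSet A {P})
    (hlam : IsUniqueSimpleLeading (wordProd A P) lam) (hρ : 0 < jsr A) :
    ∃ (r c : ℝ) (U : (Fin d → ℝ) →ₗ[ℝ] ℂ) (V : ℂ →ₗ[ℝ] (Fin d → ℝ)), 0 < c ∧
      IsDominantFamily (normalized A) P r ((c : ℂ) * lam) U V := by
  have hPne : P ≠ [] := (hP.primitive P rfl).1
  have : Nonempty (Fin m) := ⟨P.head hPne⟩
  have : Nonempty (Fin d) := by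
    obtain ⟨v, hv⟩ := exists_isSimpleEigen hlam.1
    obtain ⟨j, -⟩ := Function.ne_iff.1 hv.ne_zero
    exact ⟨j⟩
  obtain ⟨g, hg⟩ := exists_isUnitBarabanov_normalized hA hρ
  obtain ⟨q, hq, ε, hε0, hε1, hgap⟩ := hP.gap
  have hqP : q = nu A P := (hq P rfl).symm
  have hpos : 0 < jsr A ^ P.length := by positivity
  have hq0 : 0 ≤ q := by
    rw [hqP]
    exact Real.rpow_nonneg (specRad_nonneg _) _
  have hqρ : q ≤ jsr A := by
    have h1 := (eigLE_normalized_iff hρ).1 (eigLE_one_of_norm hg.isNorm (hg.wordProd_le P))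
    rw [mul_one] at h1
    have h2 := specRad_le hpos.le h1
    rw [← nu_pow hPne, ← hqP] at h2
    exact le_of_pow_le_pow_left₀ (by simpa using hPne) hρ.le h2
  -- The gap is stated relative to `q = ν(P)`; since `q ≤ ρ`, it holds a fortiori relative to `ρ`.
  have hgapB : ∀ w, w ≠ [] → ¬ IsRotPow P w → EigLE (wordProd (normalized A) w) (1 - ε) := by
    intro w hw hrot
    have hwl : w.length ≠ 0 := by simpa using hw
    have h1 := hgap w hw (by simpa [IsRotPow] using hrot)
    have h2 : specRad (wordProd A w) ≤ (1 - ε) * q ^ w.length := by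
      rw [← nu_pow hw]
      refine (pow_le_pow_left₀ (Real.rpow_nonneg (specRad_nonneg _) _) h1 _).trans_eq ?_
      rw [mul_pow, one_div, Real.rpow_inv_natCast_pow (by linarith) hwl]
    rw [eigLE_normalized_iff hρ]
    refine (eigLE_specRad _).mono (h2.trans ?_)
    have h3 : q ^ w.length ≤ jsr A ^ w.length := pow_le_pow_left₀ hq0 hqρ _
    nlinarith
  set c := (jsr A ^ P.length)⁻¹ with hc
  have hc0 : 0 < c := inv_pos.2 hpos
  have hcC : (c : ℂ) ≠ 0 := by exact_mod_cast hc0.ne'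
  have hBP : wordProd (normalized A) P = c • wordProd A P := wordProd_normalized P
  have htoC : toC (wordProd (normalized A) P) = (c : ℂ) • toC (wordProd A P) := by
    rw [hBP, toC_smul]
  have hnorm : ∀ μ : ℂ, ‖(c : ℂ) * μ‖ = c * ‖μ‖ := fun μ => by
    rw [norm_mul, Complex.norm_real, Real.norm_eq_abs, abs_of_pos hc0]
  have heig : EigLE (wordProd (normalized A) P) ‖(c : ℂ) * lam‖ := by
    rw [hBP, hnorm]
    exact hlam.eigLE.smul hc0
  have hlam1 : ‖(c : ℂ) * lam‖ = 1 := by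
    refine le_antisymm (eigLE_one_of_norm hg.isNorm (hg.wordProd_le P) _ ?_) ?_
    · rw [htoC, mem_spectrum_smul hcC, inv_mul_cancel_left₀ hcC]
      exact hlam.mem_spectrum
    -- If the leading modulus were below one, a trajectory of constant norm, eventually driven by
    -- `P`, would tend to zero.
    · by_contra! hlt
      obtain ⟨y, hy⟩ := exists_ne (0 : Fin d → ℝ)
      have hgy := hg.isNorm.pos_of_ne hy
      obtain ⟨s, x, hx, hx0, hconst⟩ := hg.exists_trajectory ((g y)⁻¹ • y)
      have h1 : ∀ k, g (x k) = 1 := fun k => by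
        rw [hconst, hg.isNorm.smul, abs_of_pos (inv_pos.2 hgy), inv_mul_cancel₀ hgy.ne']
      obtain ⟨K, hK⟩ := hx.exists_eq_pow hg h1 (by linarith : 1 - ε < 1) hPne hgapB
      have h2 := (hg.isNorm.continuous.tendsto 0).comp (heig.tendsto_pow hlt (x K))
      rw [hg.isNorm.isSeminorm.map_zero] at h2
      refine zero_ne_one (tendsto_nhds_unique h2 (tendsto_const_nhds.congr fun n => ?_))
      simp only [Function.comp_apply]
      rw [← hK, h1]
  obtain ⟨v₀, hv₀⟩ := exists_isSimpleEigen hlam.1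
  have hs : IsSimpleEigen (toC (wordProd (normalized A) P)) ((c : ℂ) * lam) v₀ := by
    rw [htoC]
    exact IsSimpleEigen.smul hv₀ hcC
  obtain ⟨U, V, hL⟩ := exists_isLeadingData hlam1 hs fun μ hμ h1 h2 => by
    rw [htoC, mem_spectrum_smul hcC] at hμ
    have h3 := hlam.2 _ (Matrix.mem_spectrum_iff_isRoot_charpoly.1 hμ)
      (fun h => h1 (by rw [← h, mul_inv_cancel_left₀ hcC])) fun h => h2 (by
        rw [map_mul, Complex.conj_ofReal, ← h, mul_inv_cancel_left₀ hcC])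
    have h4 : μ = c * ((c : ℂ)⁻¹ * μ) := by rw [mul_inv_cancel_left₀ hcC]
    rw [h4, hnorm, ← hlam1, hnorm]
    exact mul_lt_mul_of_pos_left h3 hc0
  exact ⟨1 - ε, c, U, V, hc0, isIrreducible_smul A (inv_ne_zero hρ.ne') hA, hPne, by linarith,
    by linarith, ⟨g, hg⟩, hgapB, hL⟩

end Normalisation

/-! ### Joint spectral radius zero. -/

section Degenerate
variable {d m : ℕ} {A : Fin m → Matrix (Fin d) (Fin d) ℝ}

/-- An irreducible family of joint spectral radius zero vanishes. -/
lemma eq_zero_of_jsr_eq_zero [Nonempty (Fin m)] [Nonempty (Fin d)] (hA : IsIrreducible A)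
    (hρ : jsr A = 0) : ∀ i, A i = 0 := by
  -- The common kernel is invariant. If it is zero, some letter shrinks `x` at most by the fixed
  -- factor `C m`; iterating contradicts radius zero, tested with `t` equal to half of `1 / (C m)`.
  let N : Submodule ℝ (Fin d → ℝ) := ⨅ i, LinearMap.ker (Matrix.toLin' (A i))
  have hN : ∀ x, x ∈ N ↔ ∀ i, A i *ᵥ x = 0 := fun x => by
    simp [N, Submodule.mem_iInf]
  rcases hA N (fun i x hx => by rw [(hN x).1 hx i]; exact N.zero_mem) with h | h
  · exfalso
    set φ : (Fin d → ℝ) → ℝ := fun x => ∑ i, ‖A i *ᵥ x‖ with hφ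
    have hφn : IsNorm φ := by
      refine ⟨fun x => Finset.sum_nonneg fun i _ => norm_nonneg _, fun x hx => ?_, fun c x => ?_,
        fun x y => ?_⟩
      · have hx' := (Finset.sum_eq_zero_iff_of_nonneg fun i _ => norm_nonneg _).1 hx
        have : x ∈ N := (hN x).2 fun i => norm_eq_zero.1 (hx' i (Finset.mem_univ i))
        rwa [h, Submodule.mem_bot] at this
      · simp only [hφ, Matrix.mulVec_smul, norm_smul, Finset.mul_sum, Real.norm_eq_abs]
      · simp only [hφ, Matrix.mulVec_add, ← Finset.sum_add_distrib]
        exact Finset.sum_le_sum fun i _ => norm_add_le _ _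
    obtain ⟨C, hC, hCφ⟩ := hφn.exists_norm_le
    have hm : (0 : ℝ) < m := by
      have := Fin.pos_iff_nonempty.2 ‹Nonempty (Fin m)›
      exact_mod_cast this
    have hstep : ∀ x, ∃ i, ‖x‖ ≤ C * m * ‖A i *ᵥ x‖ := by
      intro x
      obtain ⟨i, hi⟩ := Finite.exists_max fun i => ‖A i *ᵥ x‖
      refine ⟨i, (hCφ x).trans ?_⟩
      rw [mul_assoc]
      refine mul_le_mul_of_nonneg_left ?_ hC.le
      calc φ x ≤ ∑ _i : Fin m, ‖A i *ᵥ x‖ := Finset.sum_le_sum fun j _ => hi j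
        _ = _ := by simp
    have hiter : ∀ (n : ℕ) (x : Fin d → ℝ), ∃ w : List (Fin m), w.length = n ∧
        ‖x‖ ≤ (C * m) ^ n * ‖wordProd A w *ᵥ x‖ := by
      intro n
      induction n with
      | zero => exact fun x => ⟨[], rfl, by simp⟩
      | succ n ih =>
        intro x
        obtain ⟨i, hi⟩ := hstep x
        obtain ⟨w, hw, hwx⟩ := ih (A i *ᵥ x)
        refine ⟨i :: w, by simp [hw], ?_⟩
        rw [wordProd_cons, ← Matrix.mulVec_mulVec, pow_succ]
        calc ‖x‖ ≤ C * m * ‖A i *ᵥ x‖ := hi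
          _ ≤ C * m * ((C * m) ^ n * ‖wordProd A w *ᵥ (A i *ᵥ x)‖) :=
            mul_le_mul_of_nonneg_left hwx (by positivity)
          _ = _ := by ring
    obtain ⟨y, hy⟩ := exists_ne (0 : Fin d → ℝ)
    have hy' : 0 < ‖y‖ := norm_pos_iff.2 hy
    obtain ⟨D, hD, hDw⟩ := norm_wordProd_le A (t := (2 * (C * m))⁻¹) (by rw [hρ]; positivity)
    have hall : ∀ n : ℕ, 1 ≤ D * (1 / 2 : ℝ) ^ n := by
      intro n
      obtain ⟨w, hw, hwy⟩ := hiter n y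
      have h1 := hDw w y
      rw [hw] at h1
      have h2 : ‖y‖ ≤ (C * m) ^ n * (D * (2 * (C * m))⁻¹ ^ n * ‖y‖) :=
        hwy.trans (mul_le_mul_of_nonneg_left h1 (by positivity))
      have h3 : (C * m) ^ n * (2 * (C * m))⁻¹ ^ n = (1 / 2 : ℝ) ^ n := by
        rw [← mul_pow]
        congr 1
        field_simp
      have h4 : ‖y‖ ≤ D * (1 / 2 : ℝ) ^ n * ‖y‖ := by
        rw [← h3]
        linarith
      exact le_of_mul_le_mul_right (by linarith) hy'
    have ht : Tendsto (fun n : ℕ => D * (1 / 2 : ℝ) ^ n) atTop (𝓝 (D * 0)) :=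
      (tendsto_pow_atTop_nhds_zero_of_lt_one (by norm_num) (by norm_num)).const_mul D
    have := ge_of_tendsto' ht hall
    norm_num at this
  · intro i
    have h1 : ∀ x, A i *ᵥ x = 0 := fun x => (hN x).1 (h ▸ Submodule.mem_top) i
    exact Matrix.ext_of_mulVec_single fun j => by rw [h1, Matrix.zero_mulVec]

end Degenerate

/-! ### Finite formulas for the norm and its uniqueness in each case. -/

section Conclusion
variable {d m : ℕ} {A B : Fin m → Matrix (Fin d) (Fin d) ℝ} {P : List (Fin m)} {r θ : ℝ} {lam : ℂ}
  {U : (Fin d → ℝ) →ₗ[ℝ] ℂ} {V : ℂ →ₗ[ℝ] (Fin d → ℝ)}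

/-- The Barabanov norm of a contracted seminorm is a finite maximum over words. -/
lemma IsDominantFamily.exists_isGreatest (hB : IsDominantFamily B P r lam U V) {ι : Type}
    [Finite ι] [Nonempty ι] (τ : ι → ℂ →ₗ[ℝ] ℂ)
    (hn : IsContracted B P U V (fun x => ⨆ j, ‖τ j (U x)‖) θ) :
    ∃ K : ℕ, ∀ x, IsGreatest (Set.range fun p : {w : List (Fin m) // w.length ≤ K} × ι =>
      ‖τ p.2 (U (wordProd B p.1 *ᵥ x))‖) (orbitSup B (fun x => ⨆ j, ‖τ j (U x)‖) x) := by
  obtain ⟨K, hK⟩ := hB.exists_length_le_orbitSup_eq hn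
  obtain ⟨g, hg⟩ := hB.barabanov
  refine ⟨K, fun x => ⟨?_, ?_⟩⟩
  · obtain ⟨w, hw, hwx⟩ := hK x
    obtain ⟨j, hj⟩ := exists_eq_ciSup_of_finite (f := fun j => ‖τ j (U (wordProd B w *ᵥ x))‖)
    exact ⟨(⟨w, hw⟩, j), hj.trans hwx.symm⟩
  · rintro _ ⟨⟨⟨w, hw⟩, j⟩, rfl⟩
    exact (le_ciSup (f := fun j => ‖τ j (U (wordProd B w *ᵥ x))‖)
      (Set.finite_range _).bddAbove j).trans (le_orbitSup hn.isSeminorm hg.exists_bound w x)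

lemma finite_words (m K : ℕ) : Finite {w : List (Fin m) // w.length ≤ K} :=
  (List.finite_length_le (Fin m) K).to_subtype

/-- Uniqueness of the Barabanov norm when the leading eigenvalue is real. -/
lemma IsDominantFamily.exists_eq_orbitSup_of_real (hB : IsDominantFamily B P r lam U V)
    (h : lam.im = 0) {g : (Fin d → ℝ) → ℝ} (hg : IsUnitBarabanov B g) :
    ∃ c : ℝ, 0 < c ∧ ∀ x, g x = c * orbitSup B (fun y => ‖U y‖) x := by
  obtain ⟨c, hc, hgc⟩ := hB.exists_eq_norm_of_real h hg
  exact ⟨c, hc, hB.eq_orbitSup hg hc hgc⟩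

/-- Uniqueness of the Barabanov norm when the leading eigenvalue has irrational argument. -/
lemma IsDominantFamily.exists_eq_of_irrational (hB : IsDominantFamily B P r lam U V)
    (him : lam.im ≠ 0) (h : Irrational (lam.arg / Real.pi)) {f g : (Fin d → ℝ) → ℝ}
    (hf : IsUnitBarabanov B f) (hg : IsUnitBarabanov B g) :
    ∃ c : ℝ, 0 < c ∧ ∀ x, g x = c * f x := by
  obtain ⟨c, hc, hgc⟩ := hB.exists_eq_norm_of_irrational him h hg
  obtain ⟨c', hc', hfc⟩ := hB.exists_eq_norm_of_irrational him h hf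
  refine ⟨c / c', by positivity, fun x => ?_⟩
  rw [hB.eq_orbitSup hg hc hgc, hB.eq_orbitSup hf hc' hfc, ← mul_assoc, div_mul_cancel₀ _ hc'.ne']

/-- With a real leading eigenvalue the Barabanov norm is a finite maximum of moduli of linear
functionals and is unique. -/
theorem IsDominantFamily.exists_finite_of_real (hB : IsDominantFamily B P r lam U V)
    (h : lam.im = 0) : ∃ (F : Set (Fin d → ℝ)) (f : (Fin d → ℝ) → ℝ), F.Finite ∧
      IsUnitBarabanov B f ∧ (∀ x, IsGreatest ((fun z => |z ⬝ᵥ x|) '' F) (f x)) ∧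
      ∀ g, IsUnitBarabanov B g → ∃ c : ℝ, 0 < c ∧ ∀ x, g x = c * f x := by
  have hn : IsContracted B P U V (fun x => ⨆ _j : Unit, ‖(LinearMap.id : ℂ →ₗ[ℝ] ℂ) (U x)‖) r := by
    simpa using hB.isContracted_of_real h
  obtain ⟨K, hK⟩ := hB.exists_isGreatest (fun _ => LinearMap.id) hn
  have hfin := finite_words m K
  simp only [LinearMap.id_coe, id_eq, ciSup_const] at hK hn
  let z : {w : List (Fin m) // w.length ≤ K} → Fin d → ℝ :=
    fun w k => (U (wordProd B w *ᵥ Pi.single k 1)).re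
  have hz : ∀ w x, |z w ⬝ᵥ x| = ‖U (wordProd B w *ᵥ x)‖ := by
    intro w x
    have h1 : (U (wordProd B w *ᵥ x)).re = z w ⬝ᵥ x := by
      have h2 : U (wordProd B w *ᵥ x) = ∑ k, x k • U (wordProd B w *ᵥ Pi.single k 1) := by
        conv_lhs => rw [pi_eq_sum_univ' x]
        simp only [Matrix.mulVec_sum, Matrix.mulVec_smul, map_sum, map_smul]
      rw [h2, Complex.re_sum]
      simp only [z, dotProduct, Complex.smul_re, smul_eq_mul, mul_comm]
    rw [← h1, Complex.abs_re_eq_norm.2 (hB.lead.real h _)]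
  refine ⟨Set.range z, orbitSup B fun x => ‖U x‖, Set.finite_range z,
    hB.isUnitBarabanov_orbitSup hn, fun x => ?_, fun g hg => hB.exists_eq_orbitSup_of_real h hg⟩
  convert hK x using 1
  ext s
  simp [hz]

/-- With a non-real leading eigenvalue there is a Barabanov norm that is a finite maximum of moduli
of complex functionals, and also on the leading plane. -/
theorem IsDominantFamily.exists_finite_of_im_ne_zero (hB : IsDominantFamily B P r lam U V)
    (hprim : IsPrimitiveWord P) (him : lam.im ≠ 0) :
    ∃ (κ ι : Type) (_ : Finite κ) (_ : Finite ι) (t : κ → (Fin d → ℝ) →ₗ[ℝ] ℂ)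
      (τ : ι → ℂ →ₗ[ℝ] ℂ) (f : (Fin d → ℝ) → ℝ), IsUnitBarabanov B f ∧
      (∀ x, IsGreatest (Set.range fun j => ‖t j x‖) (f x)) ∧
      (∀ j ζ, τ j ζ = 0 → ζ = 0) ∧ ∀ ζ, ∃ j, f (V ζ) = ‖τ j ζ‖ := by
  obtain ⟨ι, hι, hι', τ, θ, hτ, hn⟩ := hB.exists_isContracted hprim him
  obtain ⟨K, hK⟩ := hB.exists_isGreatest τ hn
  have hfin := finite_words m K
  refine ⟨{w : List (Fin m) // w.length ≤ K} × ι, ι, inferInstance, hι,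
    fun p => τ p.2 ∘ₗ U ∘ₗ Matrix.toLin' (wordProd B p.1), τ, _, hB.isUnitBarabanov_orbitSup hn,
    fun x => ?_, hτ, fun ζ => ?_⟩
  · simpa using hK x
  · obtain ⟨j, hj⟩ := exists_eq_ciSup_of_finite (f := fun j => ‖τ j ζ‖)
    refine ⟨j, ?_⟩
    -- As `U (V ζ) = ζ` for non-real `lam`, on the leading plane the norm is the contracted seminorm
    -- itself.
    have h1 := hB.orbitSup_VU hn (V ζ)
    rw [hB.lead.cplx him] at h1
    exact h1.trans hj.symm

end Conclusion

/-! ### The zero family. -/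

section Line
variable {d m : ℕ} {A : Fin m → Matrix (Fin d) (Fin d) ℝ}

/-- The zero family is irreducible only on a line, where all norms are proportional. -/
lemma exists_finite_of_eq_zero [Nonempty (Fin m)] [Nonempty (Fin d)] (hA : IsIrreducible A)
    (hρ : jsr A = 0) (h0 : ∀ i, A i = 0) :
    ∃ (F : Set (Fin d → ℝ)) (f : (Fin d → ℝ) → ℝ), F.Finite ∧
      IsBarabanovNorm A f ∧ (∀ x, IsGreatest ((fun z => |z ⬝ᵥ x|) '' F) (f x)) ∧
      ∀ g, IsBarabanovNorm A g → ∃ c : ℝ, 0 < c ∧ ∀ x, g x = c * f x := by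
  obtain ⟨j⟩ := ‹Nonempty (Fin d)›
  set e : Fin d → ℝ := Pi.single j 1 with he
  have hspan : ∀ x : Fin d → ℝ, x = x j • e := by
    intro x
    -- Every subspace is invariant under the zero family, so the line through `e` is the whole
    -- space.
    rcases hA (Submodule.span ℝ {e}) (fun i y _ => by rw [h0, Matrix.zero_mulVec]; exact zero_mem _)
      with h | h
    · have h1 : e = 0 := by simpa using h
      have h2 := congrFun h1 j
      simp [he] at h2
    · obtain ⟨c, rfl⟩ := Submodule.mem_span_singleton.1 (h ▸ Submodule.mem_top : x ∈ _)
      simp [he]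
  have hex : ∀ x : Fin d → ℝ, e ⬝ᵥ x = x j := fun x => by simp [he]
  refine ⟨{e}, fun x => |x j|, Set.finite_singleton e, ⟨⟨fun x => abs_nonneg _, fun x hx => ?_,
    fun c x => ?_, fun x y => abs_add_le _ _⟩, fun x => ?_⟩, fun x => ?_, fun g hg => ?_⟩
  · rw [hspan x, abs_eq_zero.1 hx, zero_smul]
  · simp [abs_mul]
  · simp [h0, hρ]
  · simp [hex]
  · refine ⟨g e, hg.isNorm.pos_of_ne fun h1 => ?_, fun x => ?_⟩
    · have h2 := congrFun h1 j
      simp [he] at h2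
    · conv_lhs => rw [hspan x]
      rw [hg.isNorm.smul, mul_comm]

end Line
end Barabanov

/-! ### Assembly of the cases. -/

theorem theorem2p3 {d m : ℕ} (A : Fin m → Matrix (Fin d) (Fin d) ℝ)
    (hA : Barabanov.IsIrreducible A)
    (P : List (Fin m)) (hP : Barabanov.IsDominantSet A {P})
    (lam : ℂ) (hlam : Barabanov.IsUniqueSimpleLeading (Barabanov.wordProd A P) lam) :
    -- real leading eigenvalue
    (lam.im = 0 →
      (∃ G, Barabanov.IsInvariantBody (Barabanov.transposeFamily A) G) ∧
      ∀ G, Barabanov.IsInvariantBody (Barabanov.transposeFamily A) G →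
        Barabanov.IsPolytope G ∧
        (∀ G', Barabanov.IsInvariantBody (Barabanov.transposeFamily A) G' →
          ∃ c : ℝ, 0 < c ∧ G' = c • G) ∧
        ∃ f : (Fin d → ℝ) → ℝ,
          Barabanov.IsBarabanovNorm A f ∧
          (∀ g, Barabanov.IsBarabanovNorm A g → ∃ c : ℝ, 0 < c ∧ ∀ x, g x = c * f x) ∧
          Barabanov.IsPiecewiseLinear f ∧
          ∀ x, IsGreatest ((fun v => |v ⬝ᵥ x|) '' Set.extremePoints ℝ G) (f x)) ∧
    -- non-real leading eigenvalue
    (lam.im ≠ 0 →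
      (∃ (N : ℕ) (a b : Fin N → Fin d → ℝ),
        Barabanov.IsInvariantBody (Barabanov.transposeFamily A) (Barabanov.ellipseHull a b) ∧
        ¬ Barabanov.IsPolytope (Barabanov.ellipseHull a b)) ∧
      ∀ (N : ℕ) (a b : Fin N → Fin d → ℝ),
        Barabanov.IsInvariantBody (Barabanov.transposeFamily A) (Barabanov.ellipseHull a b) →
        ∃ f : (Fin d → ℝ) → ℝ,
          Barabanov.IsBarabanovNorm A f ∧
          Barabanov.IsPiecewiseQuadratic f ∧
          (∀ x, IsGreatest {r : ℝ | ∃ i, ∃ z ∈ Barabanov.ellipse (a i) (b i), r = |z ⬝ᵥ x|}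
            (f x)) ∧
          (Irrational (lam.arg / Real.pi) →
            ∀ g, Barabanov.IsBarabanovNorm A g → ∃ c : ℝ, 0 < c ∧ ∀ x, g x = c * f x)) := by
  have hPne : P ≠ [] := (hP.primitive P rfl).1
  have : Nonempty (Fin m) := ⟨P.head hPne⟩
  have : Nonempty (Fin d) := by
    obtain ⟨v, hv⟩ := Barabanov.exists_isSimpleEigen hlam.1
    obtain ⟨j, -⟩ := Function.ne_iff.1 hv.ne_zero
    exact ⟨j⟩
  rcases (Barabanov.jsr_spec A).1.eq_or_lt with hρ | hρ
  · have h0 := Barabanov.eq_zero_of_jsr_eq_zero hA hρ.symm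
    -- A zero family gives `lam = 0`, so only the real case remains.
    have him : lam.im = 0 := by
      have hprod : Barabanov.wordProd A P = 0 := by
        obtain ⟨i, w, rfl⟩ := List.exists_cons_of_ne_nil hPne
        rw [Barabanov.wordProd_cons, h0, mul_zero]
      obtain ⟨v, hv, hvl⟩ := Barabanov.mem_spectrum_iff_exists.1 hlam.mem_spectrum
      have h1 : lam • v = 0 := by
        rw [← hvl, hprod]
        ext k
        simp [Barabanov.toC, Matrix.mulVec, dotProduct]
      rw [(smul_eq_zero.1 h1).resolve_right hv, Complex.zero_im]
    obtain ⟨F, f, hF, hf, hmax, huniq⟩ := Barabanov.exists_finite_of_eq_zero hA hρ.symm h0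
    exact ⟨fun _ => Barabanov.polytope_of_unique hf hF hmax huniq, fun h => absurd him h⟩
  · obtain ⟨r, c, U, V, hc, hB⟩ := Barabanov.exists_isDominantFamily hA hP hlam hρ
    have him : ((c : ℂ) * lam).im = 0 ↔ lam.im = 0 := by
      rw [Complex.im_ofReal_mul, mul_eq_zero, or_iff_right hc.ne']
    refine ⟨fun h => ?_, fun h => ⟨?_, fun N a b hG => ?_⟩⟩
    · obtain ⟨F, f, hF, hf, hmax, huniq⟩ := hB.exists_finite_of_real (him.2 h)
      exact Barabanov.polytope_of_unique
        ((Barabanov.isUnitBarabanov_normalized_iff hρ).1 hf) hF hmax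
        fun g hg => huniq g ((Barabanov.isUnitBarabanov_normalized_iff hρ).2 hg)
    · obtain ⟨κ, ι, hκ, hι, t, τ, f, hf, ht, hτ, hV⟩ :=
        hB.exists_finite_of_im_ne_zero (hP.primitive P rfl) (fun h' => h (him.1 h'))
      obtain ⟨N, a, b, hs, hG⟩ :=
        ((Barabanov.isUnitBarabanov_normalized_iff hρ).1 hf).exists_ellipseHull t ht
      exact ⟨N, a, b, hG, Barabanov.not_isPolytope hs V τ hτ hV⟩
    · obtain ⟨f, hf, hpq, hmax⟩ := hG.exists_of_ellipseHull
      refine ⟨f, hf, hpq, hmax, fun hirr g hg => ?_⟩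
      -- The positive scaling factor `c` changes neither the argument of `lam` nor its non-reality.
      exact hB.exists_eq_of_irrational (fun h' => h (him.1 h'))
        (by rwa [Complex.arg_real_mul _ hc])
        ((Barabanov.isUnitBarabanov_normalized_iff hρ).2 hf)
        ((Barabanov.isUnitBarabanov_normalized_iff hρ).2 hg)
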